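/- **Setting.** Let $d,r\ge 1$ and $\Omega=\prod_{t=1}^d[x^-_t,x^+_t]$ with $x_t^-<x_t^+$. There are $r$ tensor-product patches; patch $s$ has $N_{s,t}$ knots and degree $P_{s,t}\le N_{s,t}-2$ along direction $t$. For $\tau_1<\dots<\tau_{p+2}$ put $B_p(\tau)(x)=(\tau_{p+2}-\tau_1)[\tau_1,\dots,\tau_{p+2}](\bullet-x)_+^p$ (divided difference). The basis functions $\phi_i(\xi)$ are all products over $t$ of B-splines of degree $P_{s,t}$ on $p+2$ consecutive knots ($p=P_{s,t}$) of the knot vector $\xi_{s,t}$. Fix $h>0$ and $y^-_t\le x^-_t$, $y^+_t\ge x^+_t$. The admissible set $X$ consists of all knots $\xi$ in $\prod[y_t^-,y_t^+]$ such that consecutive knots of one patch along one direction satisfy $\tau_{i+1}\ge\tau_i+h$, knots of different patches along the same direction are at distance at least $h$, and each knot vector with $n$ knots and degree $p$ satisfies $\tau_{p+1}\ge x_t^-$ and $\tau_{n-p}\le x_t^+$. Fix $\xi_0\in X$, and let $C\subset X$ be the convex component of $X$ containing $\xi_0$: the admissible knots ordered along each direction as those of $\xi_0$. Let $U$ be a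 real Hilbert space of (classes of) functions on $\Omega$, $a$ a symmetric, continuous, coercive bilinear form and $\ell$ a continuous linear form on $U$, $\mathcal J(u)=\frac12a(u,u)-\ell(u)$, $\|u\|_a^2=a(u,u)$, and let $u^\star$ minimise $\mathcal J$ on $U$. Let $U_t$ be linear subspaces of $H^k(x_t^-,x_t^+)$ that contain the B-splines along $t$ of all $\xi\in X$, with $\bigotimes_tU_t\subset U$. On tensor products $a=\sum_s\bigotimes_ta_{s,t}$ and $\ell=\sum_s\bigotimes_t\ell_{s,t}$ (finite sums), where $a_{s,t}(u,v)=\sum_{\alpha,\beta\le k}\int c_{s,t,\alpha,\beta}\,\partial^\alpha u\,\partial^\beta v$ with $c_{s,t,\alpha,\beta}\in L^\infty$ and $\ell_{s,t}(u)=\sum_{\alpha\le k}\int f_{s,t,\alpha}\,\partial^\alpha u$ with $f_{s,t,\alpha}\in L^2$ on $[x_t^-,x_t^+]$; $k$ is the order of the problem. Put $\mathcal R(w,\xi)=\sum_iw_i\phi_i(\xi)$, $\mathcal K=\mathcal J\circ\mathcal R$ on $W\times X$ (with $W$ the space of coefficient vectors $w$), $\hat{\mathcal K}(\xi)=\min_w\mathcal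 K(w,\xi)$, and $V_S=\{\mathcal R(w,\xi):w\in W,\ \xi\in S\}$ for $S\subset X$. **Assumptions.** 1. Either $P_{s,t}>k$ for all $s,t$; or $r=1$, $P_{s,t}\ge k$ for all $s,t$, all $c_{s,t,\alpha,\beta},f_{s,t,\alpha}$ are in $H^1$, and the knots of all $\xi\in C$ stay in $\Omega$. 2. For every $\xi\in C$, every patch, with at most one exception, has along some direction at most $p+1$ knots outside the open interval $(x_t^-,x_t^+)$, with $p$ its degree in that direction. (This is automatic if $r=1$, and also if all knots lie in $\Omega$, the zero-trace constraint.) 3. $\psi$ is differentiable at the points of $C$, with gradient continuous on $C$, and $1$-strongly convex on $C$; $D_\psi(\eta,\xi)=\psi(\eta)-\psi(\xi)-\langle\nabla\psi(\xi),\eta-\xi\rangle$. For $L>0$, the minimisation algorithm on $C$ with step size $1/L$ started at $\xi_0$ produces $w_n\in\arg\min_w\mathcal K(w,\xi_n)$ and $\xi_{n+1}\in\arg\min_{\eta\in C}\big\{\frac1L\langle\nabla_\xi\mathcal K(w_n,\xi_n),\eta\rangle+D_\psi(\eta,\xi_n)\big\}$, gradients being taken within $C$. **Theorem.** The set $C$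 is convex, $C=X$ if $r=1$, and $\mathcal K$ has a global minimiser on $W\times C$. If some $\xi\in C$ belongs to a global minimiser of $\mathcal K$ on $W\times X$, then $\inf_{v\in V_C}\|v-u^\star\|_a=\inf_{v\in V_X}\|v-u^\star\|_a$. The gradient of $\hat{\mathcal K}$ is Lipschitz continuous on $C$ if $P_{s,t}\ge k+2$ for all $s,t$, or if $P_{s,t}\ge k+1$ for all $s,t$ and all $f_{s,t,\alpha}$ are bounded, or if all $c_{s,t,\alpha,\beta}$ and $f_{s,t,\alpha}$ are Lipschitz. Let $L>0$ be a Lipschitz constant of $\nabla\hat{\mathcal K}$ on $C$. Then the algorithm has a run, and along every run $\mathcal K(w_n,\xi_n)$ is non-increasing. Assume directional convexity: the set $M$ of all knots $\xi^\star\in C$ of global minimisers of $\mathcal K$ on $W\times C$ such that $$\hat{\mathcal K}((1-\theta)\xi+\theta\xi^\star)\le(1-\theta)\hat{\mathcal K}(\xi)+\theta\hat{\mathcal K}(\xi^\star)\qquad(\xi\in C,\ \theta\in[0,1])$$ is non-empty, and put $\delta^\star_\psi(\xi_0)=\inf_{\xi^\star\in M}D_\psi(\xi^\star,\xi_0)$.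 Then, along every run, $\mathcal K(w_n,\xi_n)\to\min_{W\times C}\mathcal K$ and every cluster point of $(w_n,\xi_n)$ is a global minimiser of $\mathcal K$ on $W\times C$; if $M$ contains the knots of all global minimisers, $(w_n,\xi_n)$ converges to a global minimiser. Moreover, for all $n\ge1$, $$\|\mathcal R(w_n,\xi_n)-u^\star\|_a^2\le\inf_{v\in V_C}\|v-u^\star\|_a^2+\frac{2L\,\delta^\star_\psi(\xi_0)}{n},$$ $$\|\mathcal R(w_n,\xi_n)-u^\star\|_a\le\inf_{v\in V_C}\|v-u^\star\|_a+\sqrt{2L\,\delta^\star_\psi(\xi_0)}\;n^{-1/2}.$$ -/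

import Mathlib

open MeasureTheory Set Filter Topology
open scoped ContDiff

noncomputable section

namespace FreeKnot

/-! ### One-dimensional B-splines -/

/-- The truncated power `(y - x)₊ ^ p`, with the convention `(y - x)₊ ^ 0 = 1` iff `x < y`. -/
def truncPow (p : ℕ) (x y : ℝ) : ℝ :=
  if x < y then (y - x) ^ p else 0

/-- The divided difference `[τ₁, …, τₙ] f` for pairwise distinct knots. -/
def dividedDiff {n : ℕ} (τ : Fin n → ℝ) (f : ℝ → ℝ) : ℝ :=
  ∑ i, f (τ i) / ∏ j ∈ Finset.univ.erase i, (τ i - τ j)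

/-- The B-spline functor
`B_p(τ)(x) = (τ_{p+2} - τ₁) [τ₁, …, τ_{p+2}] (• - x)₊ ^ p`. -/
def bsplineFunctor (p : ℕ) (τ : Fin (p + 2) → ℝ) (x : ℝ) : ℝ :=
  (τ (Fin.last (p + 1)) - τ 0) * dividedDiff τ (truncPow p x)

/-- The `i`-th B-spline of degree `p` on a vector of `n` knots (`0`-based indices);
there are `n - (p + 1)` of them. -/
def bspline {n : ℕ} (p : ℕ) (τ : Fin n → ℝ) (i : Fin (n - (p + 1))) : ℝ → ℝ :=
  bsplineFunctor p fun j => τ ⟨i + j, by have := i.2; have := j.2; omega⟩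

/-! ### Sobolev functions on a bounded interval -/

/-- `g` is the weak derivative of order `j` of `u` on the interval `(α, β)`. -/
def IsWeakDeriv (α β : ℝ) (j : ℕ) (u g : ℝ → ℝ) : Prop :=
  ∀ θ : ℝ → ℝ, ContDiff ℝ ∞ θ → HasCompactSupport θ → tsupport θ ⊆ Ioo α β →
    ∫ x in Icc α β, u x * iteratedDeriv j θ x = (-1) ^ j * ∫ x in Icc α β, g x * θ x

/-- `D 0, …, D k` are square-integrable weak derivatives of `u` of orders `0, …, k` on
`(α, β)`. -/
def IsSobolevJet (k : ℕ) (α β : ℝ) (u : ℝ → ℝ) (D : ℕ → ℝ → ℝ) : Prop :=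
  MemLp u 2 (volume.restrict (Icc α β)) ∧
    ∀ j ≤ k, MemLp (D j) 2 (volume.restrict (Icc α β)) ∧ IsWeakDeriv α β j u (D j)

/-- `u ∈ H^k(α, β)`. -/
def MemHk (k : ℕ) (α β : ℝ) (u : ℝ → ℝ) : Prop :=
  ∃ D : ℕ → ℝ → ℝ, IsSobolevJet k α β u D

/-! ### Overlapping tensor-product free-knot patches -/

/-- A family of `r` tensor-product patches in dimension `d`: the physical domain is
`Ω = ∏ₜ [xm t, xp t]`; the patch `s` has `N s t` knots and degree `P s t` along the
direction `t`; all knots along `t` are confined to `[ym t, yp t]`, and `h` is the minimum mesh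
size. The zero-trace constraint is the choice `ym = xm`, `yp = xp`. -/
structure Patches (d r : ℕ) where
  N : Fin r → Fin d → ℕ
  P : Fin r → Fin d → ℕ
  xm : Fin d → ℝ
  xp : Fin d → ℝ
  ym : Fin d → ℝ
  yp : Fin d → ℝ
  h : ℝ
  P_lt_N : ∀ s t, P s t + 2 ≤ N s t
  xm_lt_xp : ∀ t, xm t < xp t
  ym_le_xm : ∀ t, ym t ≤ xm t
  xp_le_yp : ∀ t, xp t ≤ yp t
  h_pos : 0 < h

namespace Patches

variable {d r : ℕ} (Q : Patches d r)

/-- The ambient Euclidean space of the nonlinear parameters (all knots of all patches). -/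
abbrev KnotSpace : Type :=
  EuclideanSpace ℝ ((q : Fin r × Fin d) × Fin (Q.N q.1 q.2))

/-- Enumeration of the tensor-product B-splines: a patch and a multi-index. -/
abbrev BasisIndex : Type :=
  (s : Fin r) × ((t : Fin d) → Fin (Q.N s t - (Q.P s t + 1)))

/-- The space `W` of linear parameters. -/
abbrev CoeffSpace : Type := EuclideanSpace ℝ Q.BasisIndex

/-- The knot vector of the patch `s` along the direction `t`. -/
def knots (ξ : Q.KnotSpace) (s : Fin r) (t : Fin d) (i : Fin (Q.N s t)) : ℝ :=
  ξ ⟨(s, t), i⟩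

/-- The physical domain. -/
def Omega : Set (Fin d → ℝ) := Icc Q.xm Q.xp

/-- The tensor-product B-spline of index `i`. -/
def basisFun (ξ : Q.KnotSpace) (i : Q.BasisIndex) (x : Fin d → ℝ) : ℝ :=
  ∏ t, bspline (Q.P i.1 t) (Q.knots ξ i.1 t) (i.2 t) (x t)

/-- The function `∑ᵢ wᵢ φᵢ(ξ)`. -/
def ansatz (w : Q.CoeffSpace) (ξ : Q.KnotSpace) (x : Fin d → ℝ) : ℝ :=
  ∑ i, w i * Q.basisFun ξ i x

/-- The admissible knots: bounded, with the minimum mesh size `h` inside every patch and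
across the patches along each direction, and such that the support of every B-spline meets the
domain: with `n` knots `τ₁ < … < τₙ` and degree `p`, one asks `τ_{p+1} ≥ x₋` and
`τ_{n-p} ≤ x₊`. -/
def admissible : Set Q.KnotSpace :=
  {ξ | (∀ s t i, Q.knots ξ s t i ∈ Icc (Q.ym t) (Q.yp t)) ∧
    (∀ s t, ∀ i j : Fin (Q.N s t), (j : ℕ) = i + 1 →
      Q.knots ξ s t i + Q.h ≤ Q.knots ξ s t j) ∧
    (∀ s s' t, s ≠ s' → ∀ i j, Q.h ≤ |Q.knots ξ s t i - Q.knots ξ s' t j|) ∧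
    (∀ s t, ∀ i : Fin (Q.N s t), (i : ℕ) = Q.P s t → Q.xm t ≤ Q.knots ξ s t i) ∧
    (∀ s t, ∀ i : Fin (Q.N s t), (i : ℕ) + Q.P s t + 1 = Q.N s t → Q.knots ξ s t i ≤ Q.xp t)}

/-- The convex component of the admissible set that contains `ξ₀`: the admissible knots which
are ordered, along every direction, in the same way as those of `ξ₀`. -/
def component (ξ₀ : Q.KnotSpace) : Set Q.KnotSpace :=
  {ξ | ξ ∈ Q.admissible ∧ ∀ t s s' i j,
    (Q.knots ξ s t i < Q.knots ξ s' t j ↔ Q.knots ξ₀ s t i < Q.knots ξ₀ s' t j)}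

/-- The patch `s` is anchored in the domain if, along some direction, at most `p + 1` of its
knots lie outside the open interval. This holds for every patch of degrees at least one all of
whose knots lie in the closed domain. -/
def Anchored (ξ : Q.KnotSpace) (s : Fin r) : Prop :=
  ∃ t, {i | Q.knots ξ s t i ∉ Ioo (Q.xm t) (Q.xp t)}.ncard ≤ Q.P s t + 1

end Patches

/-! ### The variational problem -/

/-- An energy `J(u) = a(u, u) / 2 - ℓ(u)` on a Hilbert space `U` of (classes of) functions on
`Ω`, with separable forms whose one-dimensional factors are
`a_{s,t}(u, v) = ∑_{α, β ≤ k} ∫ c_{s,t,α,β} ∂^α u ∂^β v` and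
`ℓ_{s,t}(u) = ∑_{α ≤ k} ∫ f_{s,t,α} ∂^α u`. The number `k` is the order of the problem. -/
structure Problem {d r : ℕ} (Q : Patches d r) (U : Type*) [NormedAddCommGroup U]
    [InnerProductSpace ℝ U] where
  /-- the inclusion of `U` in the functions on `Ω` up to equality almost everywhere -/
  incl : U →ₗ[ℝ] ((Fin d → ℝ) →ₘ[volume.restrict Q.Omega] ℝ)
  incl_injective : Function.Injective incl
  a : U →L[ℝ] U →L[ℝ] ℝ
  symm : ∀ u v, a u v = a v u
  coercive : IsCoercive a
  ell : U →L[ℝ] ℝ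
  /-- the order -/
  k : ℕ
  /-- the one-dimensional function spaces -/
  Ut : Fin d → Submodule ℝ (ℝ → ℝ)
  Ut_sobolev : ∀ t, ∀ u ∈ Ut t, MemHk k (Q.xm t) (Q.xp t) u
  /-- the tensor product of the spaces `Ut` is contained in `U` -/
  tensor_mem : ∀ u : Fin d → ℝ → ℝ, (∀ t, u t ∈ Ut t) →
    ∃ z : U, incl z =ᵐ[volume.restrict Q.Omega] fun x => ∏ t, u t (x t)
  rankA : ℕ
  c : Fin rankA → Fin d → ℕ → ℕ → ℝ → ℝ
  c_bdd : ∀ s t, ∀ α ≤ k, ∀ β ≤ k,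
    MemLp (c s t α β) ⊤ (volume.restrict (Icc (Q.xm t) (Q.xp t)))
  a_separable : ∀ (u v : Fin d → ℝ → ℝ) (Du Dv : Fin d → ℕ → ℝ → ℝ) (z z' : U),
    (∀ t, u t ∈ Ut t) → (∀ t, v t ∈ Ut t) →
    (∀ t, IsSobolevJet k (Q.xm t) (Q.xp t) (u t) (Du t)) →
    (∀ t, IsSobolevJet k (Q.xm t) (Q.xp t) (v t) (Dv t)) →
    incl z =ᵐ[volume.restrict Q.Omega] (fun x => ∏ t, u t (x t)) →
    incl z' =ᵐ[volume.restrict Q.Omega] (fun x => ∏ t, v t (x t)) →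
    a z z' = ∑ s, ∏ t, ∑ α ∈ Finset.range (k + 1), ∑ β ∈ Finset.range (k + 1),
      ∫ x in Icc (Q.xm t) (Q.xp t), c s t α β x * Du t α x * Dv t β x
  rankL : ℕ
  f : Fin rankL → Fin d → ℕ → ℝ → ℝ
  f_sq : ∀ s t, ∀ α ≤ k, MemLp (f s t α) 2 (volume.restrict (Icc (Q.xm t) (Q.xp t)))
  ell_separable : ∀ (u : Fin d → ℝ → ℝ) (Du : Fin d → ℕ → ℝ → ℝ) (z : U),
    (∀ t, u t ∈ Ut t) →
    (∀ t, IsSobolevJet k (Q.xm t) (Q.xp t) (u t) (Du t)) →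
    incl z =ᵐ[volume.restrict Q.Omega] (fun x => ∏ t, u t (x t)) →
    ell z = ∑ s, ∏ t, ∑ α ∈ Finset.range (k + 1),
      ∫ x in Icc (Q.xm t) (Q.xp t), f s t α x * Du t α x

namespace Problem

variable {d r : ℕ} {Q : Patches d r} {U : Type*} [NormedAddCommGroup U] [InnerProductSpace ℝ U]
  (E : Problem Q U)

/-- The energy. -/
def energy (u : U) : ℝ := E.a u u / 2 - E.ell u

/-- The squared energy norm `‖u‖_a ^ 2`. -/
def normSq (u : U) : ℝ := E.a u u

/-- The conformity `V ⊂ U`: the B-splines belong to the one-dimensional function spaces. -/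
def Conforming : Prop :=
  ∀ ξ ∈ Q.admissible, ∀ s t i, bspline (Q.P s t) (Q.knots ξ s t) i ∈ E.Ut t

/-- The realisation map: the element of `U` whose function is `∑ᵢ wᵢ φᵢ(ξ)` on `Ω`. -/
def realise (w : Q.CoeffSpace) (ξ : Q.KnotSpace) : U :=
  Classical.epsilon fun z => E.incl z =ᵐ[volume.restrict Q.Omega] Q.ansatz w ξ

/-- The discrete energy. -/
def discreteEnergy (w : Q.CoeffSpace) (ξ : Q.KnotSpace) : ℝ := E.energy (E.realise w ξ)

/-- The reduced energy, minimised over the linear parameters. -/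
def reducedEnergy (ξ : Q.KnotSpace) : ℝ := ⨅ w, E.discreteEnergy w ξ

/-- The nonlinear approximation space with knots in `C`. -/
def approxSpace (C : Set Q.KnotSpace) : Set U :=
  {v | ∃ w, ∃ ξ ∈ C, v = E.realise w ξ}

/-- The squared best approximation error `inf_{v ∈ V} ‖v - u‖_a ^ 2`. -/
def bestErrorSq (C : Set Q.KnotSpace) (u : U) : ℝ :=
  ⨅ v : E.approxSpace C, E.normSq (v - u)

/-- Either all degrees exceed the order, or there is a single patch of degrees at least the
order, the data are in `H¹`, and the knots do not cross the boundary of the domain. -/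
def DegreeCondition (C : Set Q.KnotSpace) : Prop :=
  (∀ s t, E.k < Q.P s t) ∨
    (r = 1 ∧ (∀ s t, E.k ≤ Q.P s t) ∧
      (∀ s t, ∀ α ≤ E.k, ∀ β ≤ E.k, MemHk 1 (Q.xm t) (Q.xp t) (E.c s t α β)) ∧
      (∀ s t, ∀ α ≤ E.k, MemHk 1 (Q.xm t) (Q.xp t) (E.f s t α)) ∧
      ∀ ξ ∈ C, ∀ s t i, Q.knots ξ s t i ∈ Icc (Q.xm t) (Q.xp t))

/-- Regularity of the data under which the reduced gradient is Lipschitz continuous: nothing more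
if the degrees exceed the order by at least two, bounded linear data if they exceed it by
one, Lipschitz data if some degree equals the order. -/
def LipschitzData : Prop :=
  (∀ s t, E.k + 1 < Q.P s t) ∨
    ((∀ s t, E.k < Q.P s t) ∧ ∀ s t, ∀ α ≤ E.k,
      MemLp (E.f s t α) ⊤ (volume.restrict (Icc (Q.xm t) (Q.xp t)))) ∨
    ((∀ s t, ∀ α ≤ E.k, ∀ β ≤ E.k, ∃ K, LipschitzOnWith K (E.c s t α β)
        (Icc (Q.xm t) (Q.xp t))) ∧
      ∀ s t, ∀ α ≤ E.k, ∃ K, LipschitzOnWith K (E.f s t α) (Icc (Q.xm t) (Q.xp t)))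

/-- `(w, ξ)` is a global minimiser of the discrete energy over `W × C`. -/
def IsGlobalMin (C : Set Q.KnotSpace) (w : Q.CoeffSpace) (ξ : Q.KnotSpace) : Prop :=
  ξ ∈ C ∧ ∀ w', ∀ ξ' ∈ C, E.discreteEnergy w ξ ≤ E.discreteEnergy w' ξ'

/-- The knots of the global minimisers. -/
def minimisers (C : Set Q.KnotSpace) : Set Q.KnotSpace :=
  {ξ | ∃ w, E.IsGlobalMin C w ξ}

/-- The knots `ξ⋆` of global minimisers such that the reduced energy is convex on `C` in the
direction of `ξ⋆`. Directional convexity means that there is such a `ξ⋆`. -/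
def convexTargets (C : Set Q.KnotSpace) : Set Q.KnotSpace :=
  {ξ' | ξ' ∈ E.minimisers C ∧ ∀ ξ ∈ C, ∀ θ ∈ Icc (0 : ℝ) 1,
    E.reducedEnergy ((1 - θ) • ξ + θ • ξ') ≤
      (1 - θ) * E.reducedEnergy ξ + θ * E.reducedEnergy ξ'}

end Problem

/-! ### Mirror descent -/

section Mirror

variable {X : Type*} [NormedAddCommGroup X] [InnerProductSpace ℝ X] [CompleteSpace X]

/-- The Bregman divergence of `ψ`. -/
def bregman (ψ : X → ℝ) (η ξ : X) : ℝ := ψ η - ψ ξ - inner ℝ (gradient ψ ξ) (η - ξ)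

/-- A mirror map on `C`: continuously differentiable and `1`-strongly convex. -/
def IsMirrorMap (C : Set X) (ψ : X → ℝ) : Prop :=
  (∀ ξ ∈ C, DifferentiableAt ℝ ψ ξ) ∧ ContinuousOn (gradient ψ) C ∧ StrongConvexOn C 1 ψ

/-- `F` has an `L`-Lipschitz gradient on `C`. The gradient is taken within `C`, so that nothing is
required of `F` outside `C`. -/
def HasLipschitzGradientOn (F : X → ℝ) (C : Set X) (L : ℝ) : Prop :=
  ∃ g : X → X, (∀ ξ ∈ C, HasGradientWithinAt F (g ξ) C ξ) ∧
    ∀ ξ ∈ C, ∀ η ∈ C, ‖g ξ - g η‖ ≤ L * ‖ξ - η‖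

/-- `ξ'` is obtained from `ξ` by a mirror descent step for `F` over `C` with step size `γ`. -/
def IsMirrorStep (ψ : X → ℝ) (C : Set X) (γ : ℝ) (F : X → ℝ) (ξ ξ' : X) : Prop :=
  ∃ g : X, HasGradientWithinAt F g C ξ ∧ ξ' ∈ C ∧
    IsMinOn (fun η => γ * inner ℝ g η + bregman ψ η ξ) C ξ'

end Mirror

namespace Problem

variable {d r : ℕ} {Q : Patches d r} {U : Type*} [NormedAddCommGroup U] [InnerProductSpace ℝ U]
  (E : Problem Q U)

/-- The minimisation algorithm: at each iteration a linear solve for the linear parameters,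
then a mirror descent step for the nonlinear parameters. -/
def IsRun (ψ : Q.KnotSpace → ℝ) (C : Set Q.KnotSpace) (γ : ℝ) (ξ₀ : Q.KnotSpace)
    (w : ℕ → Q.CoeffSpace) (ξ : ℕ → Q.KnotSpace) : Prop :=
  ξ 0 = ξ₀ ∧
    (∀ n, IsMinOn (fun w' => E.discreteEnergy w' (ξ n)) univ (w n)) ∧
    ∀ n, IsMirrorStep ψ C γ (fun η => E.discreteEnergy (w n) η) (ξ n) (ξ (n + 1))

/-- The Bregman distance `δ⋆_ψ(ξ)` from `ξ` to the minimisers. -/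
def deltaStar (ψ : Q.KnotSpace → ℝ) (C : Set Q.KnotSpace) (ξ : Q.KnotSpace) : ℝ :=
  ⨅ ξ' : E.convexTargets C, bregman ψ ξ' ξ

end Problem

end FreeKnot

end

namespace FreeKnot

/-! For fixed knots the discrete energy is a quadratic function of the coefficients, with matrix
`stiffness` and right-hand side `load`. Coercivity and the linear independence of the B-splines on
the domain make the matrix positive definite, so the optimal coefficients are A(ξ)⁻¹b(ξ), and the
reduced energy is as smooth in the knots as the entries of A and b. The algorithm then becomes plain
mirror descent for the reduced energy on a compact convex set.

Smoothness of the entries. A B-spline is a combination of truncated powers (τⱼ - x)₊ ^ p whose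
coefficients are rational in the knots, with denominators that do not vanish on the admissible set.
What remains are the moments of the data against truncated powers. The y-derivative of the moment of
order m + 1 is m + 1 times the moment of order m, so integrable data suffice as long as the order is
positive (`hasDerivAt_truncMoment_succ`); order zero is a primitive of the datum and needs
continuity (`C1On.truncMoment_zero`). In the bilinear form two truncated powers meet. Below the
smaller of the two knots the other factor is a polynomial, so the product reduces to moments at the
smaller knot (`mixedMoment_of_lt`). This is where the constant ordering of the knots on a component
enters.

Independence. A combination of truncated powers that vanishes on an interval has no contribution
from interior nodes. At most p + 1 exterior nodes of a patch remain, and they are eliminated because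
p-th powers at p + 1 nodes are independent and because divided differences annihilate polynomials of
degree p (`bspline_coeff_eq_zero_of_anchored`, `bspline_coeff_eq_zero`). Tensor products are treated
one coordinate at a time.

Convergence. By the envelope identity `hasGradientWithinAt_iff` the partial gradient at the optimal
coefficients is the gradient of the reduced energy. The descent lemma and the three-point inequality
give a telescoping bound against any point toward which the reduced energy is convex; convexity
elsewhere is not needed. Finally ‖v - u⋆‖_a² = 2 (J(v) - J(u⋆)) (`normSq_sub`) turns energy gaps
into errors. -/

theorem exists_lipschitzOnWith_smul {V E : Type*} [NormedAddCommGroup V] [NormedAddCommGroup E]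
    [NormedSpace ℝ E]    {C : Set V} (hC : IsCompact C) {f : V → ℝ} {g : V → E}
    (hf : ∃ K, LipschitzOnWith K f C) (hg : ∃ K, LipschitzOnWith K g C) :
    ∃ K, LipschitzOnWith K (fun x => f x • g x) C := by
  obtain ⟨K₁, h₁⟩ := hf
  obtain ⟨K₂, h₂⟩ := hg
  obtain ⟨M₁, hM₁⟩ := hC.exists_bound_of_continuousOn h₁.continuousOn
  obtain ⟨M₂, hM₂⟩ := hC.exists_bound_of_continuousOn h₂.continuousOn
  refine ⟨K₁ * M₂.toNNReal + M₁.toNNReal * K₂, LipschitzOnWith.of_dist_le_mul ?_⟩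
  intro x hx y hy
  have e : f x • g x - f y • g y = (f x - f y) • g x + f y • (g x - g y) := by
    rw [sub_smul, smul_sub]; abel
  have b₁ := h₁.dist_le_mul x hx y hy
  have b₂ := h₂.dist_le_mul x hx y hy
  rw [dist_eq_norm] at b₁ b₂ ⊢
  rw [e]
  refine (norm_add_le _ _).trans ?_
  rw [norm_smul, norm_smul]
  have c₁ : ‖g x‖ ≤ (M₂.toNNReal : ℝ) := (hM₂ x hx).trans (Real.le_coe_toNNReal _)
  have c₂ : ‖f y‖ ≤ (M₁.toNNReal : ℝ) := (hM₁ y hy).trans (Real.le_coe_toNNReal _)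
  push_cast
  calc ‖f x - f y‖ * ‖g x‖ + ‖f y‖ * ‖g x - g y‖
      ≤ (K₁ * dist x y) * (M₂.toNNReal : ℝ) + (M₁.toNNReal : ℝ) * (K₂ * dist x y) := by
        gcongr
    _ = _ := by ring

theorem exists_lipschitzOnWith_add {V E : Type*} [NormedAddCommGroup V] [NormedAddCommGroup E]
    {C : Set V} {f g : V → E}
    (hf : ∃ K, LipschitzOnWith K f C) (hg : ∃ K, LipschitzOnWith K g C) :
    ∃ K, LipschitzOnWith K (fun x => f x + g x) C := by
  obtain ⟨K₁, h₁⟩ := hf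
  obtain ⟨K₂, h₂⟩ := hg
  exact ⟨K₁ + K₂, h₁.add h₂⟩

theorem exists_lipschitzOnWith_inv {V : Type*} [NormedAddCommGroup V] {C : Set V}
    (hC : IsCompact C) {F : V → ℝ}
    (hF : ∃ K, LipschitzOnWith K F C) (h0 : ∀ x ∈ C, F x ≠ 0) :
    ∃ K, LipschitzOnWith K (fun x => (F x)⁻¹) C := by
  obtain ⟨K, hK⟩ := hF
  obtain ⟨M, hM⟩ := hC.exists_bound_of_continuousOn (hK.continuousOn.inv₀ h0)
  refine ⟨M.toNNReal * M.toNNReal * K, LipschitzOnWith.of_dist_le_mul fun x hx y hy => ?_⟩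
  have hx0 := h0 x hx
  have hy0 := h0 y hy
  have e : (F x)⁻¹ - (F y)⁻¹ = (F x)⁻¹ * (F y)⁻¹ * (F y - F x) := by field_simp
  have b := hK.dist_le_mul y hy x hx
  rw [dist_eq_norm, dist_comm y x] at b
  rw [dist_eq_norm, e, norm_mul, norm_mul]
  have c₁ : ‖(F x)⁻¹‖ ≤ (M.toNNReal : ℝ) := (hM x hx).trans (Real.le_coe_toNNReal _)
  have c₂ : ‖(F y)⁻¹‖ ≤ (M.toNNReal : ℝ) := (hM y hy).trans (Real.le_coe_toNNReal _)
  push_cast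
  rw [mul_assoc _ (K : ℝ)]
  gcongr

/-! ### Calculus of functions with continuous, optionally Lipschitz, derivative within a set. -/

section C1On

variable {V : Type*} [NormedAddCommGroup V] [NormedSpace ℝ V]

/-- `F` is continuously differentiable within `C`, with a Lipschitz derivative if `lip` holds. -/
def C1On (lip : Prop) (C : Set V) (F : V → ℝ) : Prop :=
  ∃ g : V → V →L[ℝ] ℝ, (∀ x ∈ C, HasFDerivWithinAt F (g x) C x) ∧ ContinuousOn g C ∧
    (lip → ∃ K, LipschitzOnWith K g C)

theorem C1On.continuousOn {lip : Prop} {C : Set V} {F : V → ℝ} (h : C1On lip C F) :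
    ContinuousOn F C := by
  obtain ⟨g, hg, -⟩ := h
  exact fun x hx => (hg x hx).continuousWithinAt

/-- Mean value inequality: on a compact convex set the derivative is bounded. No Lipschitz
derivative is needed, so this holds for every `lip`. It keeps the class closed under products and
inverses, where the function itself multiplies a derivative. -/
theorem C1On.exists_lipschitzOnWith {lip : Prop} {C : Set V} (hC : IsCompact C)
    (hconv : Convex ℝ C) {F : V → ℝ} (h : C1On lip C F) : ∃ K, LipschitzOnWith K F C := by
  obtain ⟨g, hg, hc, -⟩ := h
  obtain ⟨M, hM⟩ := hC.exists_bound_of_continuousOn hc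
  refine ⟨M.toNNReal, hconv.lipschitzOnWith_of_nnnorm_hasFDerivWithin_le hg fun x hx => ?_⟩
  rw [← NNReal.coe_le_coe]
  exact (hM x hx).trans (Real.le_coe_toNNReal _)

theorem C1On.congr {lip : Prop} {C : Set V} {F G : V → ℝ} (h : C1On lip C F)
    (hFG : ∀ x ∈ C, G x = F x) : C1On lip C G := by
  obtain ⟨g, hg, hc, hL⟩ := h
  exact ⟨g, fun x hx => (hg x hx).congr hFG (hFG x hx), hc, hL⟩

theorem C1On.const (lip : Prop) (C : Set V) (a : ℝ) : C1On lip C (fun _ => a) :=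
  ⟨fun _ => 0, fun x _ => hasFDerivWithinAt_const a x C, continuousOn_const,
    fun _ => ⟨0, LipschitzOnWith.of_dist_le_mul fun _ _ _ _ => by simp⟩⟩

theorem C1On.add {lip : Prop} {C : Set V} {F G : V → ℝ} (hF : C1On lip C F) (hG : C1On lip C G) :
    C1On lip C (fun x => F x + G x) := by
  obtain ⟨f, hf, hfc, hfL⟩ := hF
  obtain ⟨g, hg, hgc, hgL⟩ := hG
  exact ⟨fun x => f x + g x, fun x hx => (hf x hx).add (hg x hx), hfc.add hgc,
    fun h => exists_lipschitzOnWith_add (hfL h) (hgL h)⟩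

theorem C1On.sum {lip : Prop} {C : Set V} {ι : Type*} (s : Finset ι) {F : ι → V → ℝ}
    (hF : ∀ i ∈ s, C1On lip C (F i)) : C1On lip C (fun x => ∑ i ∈ s, F i x) := by
  classical
  induction s using Finset.induction_on with
  | empty => simpa using C1On.const lip C 0
  | insert a s ha ih =>
    simp only [Finset.sum_insert ha]
    exact (hF a (Finset.mem_insert_self _ _)).add
      (ih fun i hi => hF i (Finset.mem_insert_of_mem hi))

theorem C1On.mul {lip : Prop} {C : Set V} (hC : IsCompact C) (hconv : Convex ℝ C) {F G : V → ℝ}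
    (hF : C1On lip C F) (hG : C1On lip C G) : C1On lip C (fun x => F x * G x) := by
  have hFl := hF.exists_lipschitzOnWith hC hconv
  have hGl := hG.exists_lipschitzOnWith hC hconv
  have hFc := hF.continuousOn
  have hGc := hG.continuousOn
  obtain ⟨f, hf, hfc, hfL⟩ := hF
  obtain ⟨g, hg, hgc, hgL⟩ := hG
  exact ⟨fun x => F x • g x + G x • f x, fun x hx => (hf x hx).mul (hg x hx),
    (hFc.smul hgc).add (hGc.smul hfc),
    fun h => exists_lipschitzOnWith_add (exists_lipschitzOnWith_smul hC hFl (hgL h))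
      (exists_lipschitzOnWith_smul hC hGl (hfL h))⟩

theorem C1On.const_mul {lip : Prop} {C : Set V} (hC : IsCompact C) (hconv : Convex ℝ C)
    (a : ℝ) {F : V → ℝ} (hF : C1On lip C F) : C1On lip C (fun x => a * F x) :=
  (C1On.const lip C a).mul hC hconv hF

theorem C1On.prod {lip : Prop} {C : Set V} (hC : IsCompact C) (hconv : Convex ℝ C) {ι : Type*}
    (s : Finset ι) {F : ι → V → ℝ} (hF : ∀ i ∈ s, C1On lip C (F i)) :
    C1On lip C (fun x => ∏ i ∈ s, F i x) := by
  classical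
  induction s using Finset.induction_on with
  | empty => simpa using C1On.const lip C 1
  | insert a s ha ih =>
    simp only [Finset.prod_insert ha]
    exact (hF a (Finset.mem_insert_self _ _)).mul hC hconv
      (ih fun i hi => hF i (Finset.mem_insert_of_mem hi))

theorem C1On.pow {lip : Prop} {C : Set V} (hC : IsCompact C) (hconv : Convex ℝ C) (n : ℕ)
    {F : V → ℝ} (hF : C1On lip C F) : C1On lip C (fun x => F x ^ n) := by
  have := C1On.prod hC hconv (Finset.range n) (F := fun _ => F) fun _ _ => hF
  simpa using this

theorem C1On.inv {lip : Prop} {C : Set V} (hC : IsCompact C) (hconv : Convex ℝ C) {F : V → ℝ}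
    (hF : C1On lip C F) (h0 : ∀ x ∈ C, F x ≠ 0) : C1On lip C (fun x => (F x)⁻¹) := by
  have hFl := exists_lipschitzOnWith_inv hC (hF.exists_lipschitzOnWith hC hconv) h0
  have hFc := hF.continuousOn.inv₀ h0
  obtain ⟨f, hf, hfc, hfL⟩ := hF
  have hn : lip → ∃ K, LipschitzOnWith K (fun x => -f x) C := fun h => by
    obtain ⟨K, hK⟩ := hfL h
    exact ⟨K, hK.neg⟩
  refine ⟨fun x => (F x)⁻¹ • (F x)⁻¹ • (-f x), fun x hx => ?_, hFc.smul (hFc.smul hfc.neg),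
    fun h => exists_lipschitzOnWith_smul hC hFl (exists_lipschitzOnWith_smul hC hFl (hn h))⟩
  have := (hasDerivAt_inv (h0 x hx)).comp_hasFDerivWithinAt x (hf x hx)
  refine this.congr_fderiv ?_
  ext v
  simp
  field_simp

theorem C1On.comp_clm {W : Type*} [NormedAddCommGroup W] [NormedSpace ℝ W] {lip : Prop}
    {C : Set V} {S : Set W} {F : W → ℝ} (hF : C1On lip S F) (T : V →L[ℝ] W)
    (hT : MapsTo T C S) : C1On lip C (fun x => F (T x)) := by
  obtain ⟨f, hf, hfc, hfL⟩ := hF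
  refine ⟨fun x => (f (T x)).comp T,
    fun x hx => (hf _ (hT hx)).comp x T.hasFDerivWithinAt hT,
    ((ContinuousLinearMap.compL ℝ V W ℝ).flip T).continuous.comp_continuousOn
      (hfc.comp T.continuous.continuousOn hT), fun h => ?_⟩
  obtain ⟨K, hK⟩ := hfL h
  obtain ⟨K', hK'⟩ : ∃ K', LipschitzWith K' ((ContinuousLinearMap.compL ℝ V W ℝ).flip T) :=
    ⟨_, ((ContinuousLinearMap.compL ℝ V W ℝ).flip T).lipschitz⟩
  exact ⟨_, hK'.comp_lipschitzOnWith (hK.comp (T.lipschitz.lipschitzOnWith (s := C)) hT)⟩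

theorem C1On.clm (lip : Prop) (C : Set V) (T : V →L[ℝ] ℝ) : C1On lip C (fun x => T x) :=
  ⟨fun _ => T, fun x _ => T.hasFDerivWithinAt, continuousOn_const,
    fun _ => ⟨0, LipschitzOnWith.of_dist_le_mul fun _ _ _ _ => by simp⟩⟩

/-- A function of one variable, through its derivative. -/
theorem C1On.of_hasDerivWithinAt {lip : Prop} {S : Set ℝ} {F f : ℝ → ℝ}
    (hF : ∀ y ∈ S, HasDerivWithinAt F (f y) S y) (hf : ContinuousOn f S)
    (hL : lip → ∃ K, LipschitzOnWith K f S) : C1On lip S F := by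
  refine ⟨fun y => ContinuousLinearMap.toSpanSingleton ℝ (f y),
    fun y hy => (hF y hy).hasFDerivWithinAt, ?_, fun h => ?_⟩
  · exact (ContinuousLinearMap.toSpanSingletonCLE (𝕜 := ℝ) (E := ℝ)).continuous.comp_continuousOn hf
  · obtain ⟨K, hK⟩ := hL h
    exact ⟨_, (ContinuousLinearMap.toSpanSingletonCLE (𝕜 := ℝ)
      (E := ℝ)).toContinuousLinearMap.lipschitz.comp_lipschitzOnWith hK⟩

end C1On

theorem C1On.exists_gradient {X : Type*} [NormedAddCommGroup X] [InnerProductSpace ℝ X]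
    [CompleteSpace X] {lip : Prop} {C : Set X} {F : X → ℝ} (h : C1On lip C F) :
    ∃ g : X → X, (∀ ξ ∈ C, HasGradientWithinAt F (g ξ) C ξ) ∧ ContinuousOn g C ∧
      (lip → ∃ K, LipschitzOnWith K g C) := by
  obtain ⟨f, hf, hfc, hfL⟩ := h
  refine ⟨fun x => (InnerProductSpace.toDual ℝ X).symm (f x), fun x hx => ?_,
    (InnerProductSpace.toDual ℝ X).symm.continuous.comp_continuousOn hfc, fun h => ?_⟩
  · exact (hasFDerivWithinAt_iff_hasGradientWithinAt).1 (hf x hx)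
  · obtain ⟨K, hK⟩ := hfL h
    exact ⟨_, (InnerProductSpace.toDual ℝ X).symm.lipschitz.comp_lipschitzOnWith hK⟩

theorem C1On.hasLipschitzGradientOn {X : Type*} [NormedAddCommGroup X] [InnerProductSpace ℝ X]
    [CompleteSpace X] {C : Set X} {F : X → ℝ} (h : C1On True C F) :
    ∃ L, 0 < L ∧ HasLipschitzGradientOn F C L := by
  obtain ⟨g, hg, -, hL⟩ := h.exists_gradient
  obtain ⟨K, hK⟩ := hL trivial
  -- The constant `K` may vanish, whereas the step size 1 / L requires L > 0.
  refine ⟨K + 1, by positivity, g, hg, fun ξ hξ η hη => ?_⟩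
  have := hK.dist_le_mul ξ hξ η hη
  rw [dist_eq_norm, dist_eq_norm] at this
  nlinarith [norm_nonneg (ξ - η)]

/-! ### Mirror descent on a convex set. -/

section MirrorDescent

/-- One-sided first-order condition. It replaces every limit "divide by t and let t → 0" below:
strong convexity, optimality of a step, and convexity toward a point. -/
theorem nonneg_of_hasDerivWithinAt_of_le {φ : ℝ → ℝ} {c : ℝ}
    (h : HasDerivWithinAt φ c (Icc 0 1) 0) (hm : ∀ t ∈ Icc (0 : ℝ) 1, φ 0 ≤ φ t) : 0 ≤ c := by
  have h' : HasDerivWithinAt φ c (Ioc 0 1) 0 := h.mono Ioc_subset_Icc_self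
  rw [hasDerivWithinAt_iff_tendsto_slope' (by simp)] at h'
  have : (𝓝[Ioc (0 : ℝ) 1] 0).NeBot := by
    rw [nhdsWithin_Ioc_eq_nhdsGT zero_lt_one]; infer_instance
  refine ge_of_tendsto h' ?_
  filter_upwards [self_mem_nhdsWithin] with t ht
  rw [slope_def_field]
  exact div_nonneg (sub_nonneg.2 (hm t ⟨ht.1.le, ht.2⟩)) (by linarith [ht.1])

variable {X : Type*} [NormedAddCommGroup X] [InnerProductSpace ℝ X] [CompleteSpace X]

theorem hasDerivWithinAt_lineMap {C : Set X} (hC : Convex ℝ C) {F : X → ℝ} {g ξ η : X}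
    (hξ : ξ ∈ C) (hη : η ∈ C) {t : ℝ}
    (h : HasGradientWithinAt F g C (AffineMap.lineMap ξ η t)) :
    HasDerivWithinAt (fun s : ℝ => F (AffineMap.lineMap ξ η s)) (inner ℝ g (η - ξ))
      (Icc 0 1) t := by
  have h₂ : HasDerivWithinAt (fun s : ℝ => AffineMap.lineMap ξ η s) (η - ξ) (Icc 0 1) t :=
    AffineMap.hasDerivWithinAt_lineMap
  exact h.hasFDerivWithinAt.comp_hasDerivWithinAt t h₂ fun s hs => hC.lineMap_mem hξ hη hs

theorem hasDerivWithinAt_lineMap_zero {C : Set X} (hC : Convex ℝ C) {F : X → ℝ} {g ξ η : X}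
    (hξ : ξ ∈ C) (hη : η ∈ C) (h : HasGradientWithinAt F g C ξ) :
    HasDerivWithinAt (fun s : ℝ => F (AffineMap.lineMap ξ η s)) (inner ℝ g (η - ξ)) (Icc 0 1) 0 :=
  hasDerivWithinAt_lineMap hC hξ hη (by simpa using h)

/-- The gradient within a convex set is determined along the directions of the set. -/
theorem inner_gradientWithin_unique {C : Set X} (hC : Convex ℝ C) {F : X → ℝ} {g g' ξ η : X}
    (hξ : ξ ∈ C) (hη : η ∈ C) (h : HasGradientWithinAt F g C ξ)
    (h' : HasGradientWithinAt F g' C ξ) : inner ℝ g (η - ξ) = inner ℝ g' (η - ξ) :=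
  (uniqueDiffOn_Icc_zero_one 0 (by simp)).eq_deriv _ (hasDerivWithinAt_lineMap_zero hC hξ hη h)
    (hasDerivWithinAt_lineMap_zero hC hξ hη h')

/-- Descent lemma. It uses only the segment inside the set, so it holds for any choice of a gradient
within the set. -/
theorem le_of_hasLipschitzGradientOn {C : Set X} (hC : Convex ℝ C) {F : X → ℝ} {L : ℝ}
    (hF : HasLipschitzGradientOn F C L) {g ξ η : X} (hξ : ξ ∈ C) (hη : η ∈ C)
    (hg : HasGradientWithinAt F g C ξ) :
    F η ≤ F ξ + inner ℝ g (η - ξ) + L / 2 * ‖η - ξ‖ ^ 2 := by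
  obtain ⟨G, hG, hGL⟩ := hF
  rw [inner_gradientWithin_unique hC hξ hη hg (hG ξ hξ)]
  set φ : ℝ → ℝ := fun t => F (AffineMap.lineMap ξ η t) -
    (t * inner ℝ (G ξ) (η - ξ) + L / 2 * ‖η - ξ‖ ^ 2 * t ^ 2) with hφ
  have hd : ∀ t ∈ Icc (0 : ℝ) 1, HasDerivWithinAt φ
      (inner ℝ (G (AffineMap.lineMap ξ η t)) (η - ξ) -
        (1 * inner ℝ (G ξ) (η - ξ) + L / 2 * ‖η - ξ‖ ^ 2 * (2 * t))) (Icc 0 1) t := by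
    intro t ht
    refine (hasDerivWithinAt_lineMap hC hξ hη (hG _ (hC.lineMap_mem hξ hη ht))).sub
      (HasDerivAt.hasDerivWithinAt ?_)
    refine ((hasDerivAt_id t).mul_const _).add (HasDerivAt.const_mul _ ?_)
    simpa using hasDerivAt_pow 2 t
  -- By Cauchy–Schwarz the increment of the slope at t is at most L t ‖η - ξ‖², exactly the
  -- derivative of the quadratic term subtracted in `φ`.
  have hanti : AntitoneOn φ (Icc 0 1) := by
    refine antitoneOn_of_hasDerivWithinAt_nonpos (convex_Icc 0 1)
      (fun t ht => (hd t ht).continuousWithinAt)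
      (fun t ht => (hd t (interior_subset ht)).mono interior_subset) fun t ht => ?_
    have ht' := interior_subset ht
    have e : (AffineMap.lineMap ξ η t : X) - ξ = t • (η - ξ) := by
      rw [AffineMap.lineMap_apply_module']; abel
    have b := hGL _ (hC.lineMap_mem hξ hη ht') ξ hξ
    rw [e, norm_smul, Real.norm_of_nonneg ht'.1] at b
    have b₂ := real_inner_le_norm (G (AffineMap.lineMap ξ η t) - G ξ) (η - ξ)
    rw [inner_sub_left] at b₂
    nlinarith [mul_le_mul_of_nonneg_right b (norm_nonneg (η - ξ))]
  have := hanti (by simp : (0 : ℝ) ∈ Icc (0 : ℝ) 1) (by simp : (1 : ℝ) ∈ Icc (0 : ℝ) 1) zero_le_one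
  simp only [hφ, AffineMap.lineMap_apply_one, AffineMap.lineMap_apply_zero] at this
  linarith

theorem IsMirrorMap.hasGradientWithinAt {C : Set X} {ψ : X → ℝ} (hψ : IsMirrorMap C ψ) {ξ : X}
    (hξ : ξ ∈ C) : HasGradientWithinAt ψ (gradient ψ ξ) C ξ :=
  (hψ.1 ξ hξ).hasGradientAt.hasFDerivAt.hasFDerivWithinAt

theorem IsMirrorMap.continuousOn {C : Set X} {ψ : X → ℝ} (hψ : IsMirrorMap C ψ) :
    ContinuousOn ψ C := fun ξ hξ => (hψ.1 ξ hξ).continuousAt.continuousWithinAt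

theorem IsMirrorMap.sq_norm_le_bregman {C : Set X} {ψ : X → ℝ} (hψ : IsMirrorMap C ψ) {η ξ : X}
    (hη : η ∈ C) (hξ : ξ ∈ C) : 1 / 2 * ‖η - ξ‖ ^ 2 ≤ bregman ψ η ξ := by
  have hC := hψ.2.2.1
  have hd := hasDerivWithinAt_lineMap_zero hC hξ hη (hψ.hasGradientWithinAt hξ)
  -- This function minus ψ along the segment is smallest at t = 0: that is the strong convexity
  -- inequality.
  have hq : HasDerivAt (fun t : ℝ => t * (ψ η - ψ ξ) - (t - t ^ 2) * (1 / 2 * ‖η - ξ‖ ^ 2))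
      (1 * (ψ η - ψ ξ) - (1 - (2 : ℕ) * (0 : ℝ) ^ (2 - 1)) * (1 / 2 * ‖η - ξ‖ ^ 2)) 0 :=
    ((hasDerivAt_id _).mul_const _).sub
      (((hasDerivAt_id _).sub (hasDerivAt_pow 2 _)).mul_const _)
  have key := nonneg_of_hasDerivWithinAt_of_le (hq.hasDerivWithinAt.sub hd) fun t ht => by
    have := hψ.2.2.2 hξ hη (sub_nonneg.2 ht.2) ht.1 (by ring)
    simp only [smul_eq_mul] at this
    have e : (AffineMap.lineMap ξ η t : X) = (1 - t) • ξ + t • η := by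
      rw [AffineMap.lineMap_apply_module]
    rw [norm_sub_rev] at this
    simp only [Pi.sub_apply, AffineMap.lineMap_apply_zero, e]
    nlinarith
  rw [bregman]
  norm_num at key
  norm_num
  linarith

theorem IsMirrorMap.bregman_nonneg {C : Set X} {ψ : X → ℝ} (hψ : IsMirrorMap C ψ) {η ξ : X}
    (hη : η ∈ C) (hξ : ξ ∈ C) : 0 ≤ bregman ψ η ξ :=
  (by positivity : 0 ≤ 1 / 2 * ‖η - ξ‖ ^ 2).trans (hψ.sq_norm_le_bregman hη hξ)

/-- The derivative of the minimised function at ξ' toward η is nonnegative; it equals γ⟨g, η - ξ'⟩ +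
⟨∇ψ(ξ') - ∇ψ(ξ), η - ξ'⟩, and the second term is D(η, ξ) - D(η, ξ') - D(ξ', ξ). -/
theorem IsMirrorMap.three_point {C : Set X} {ψ : X → ℝ} (hψ : IsMirrorMap C ψ) {γ : ℝ}
    {g ξ ξ' η : X} (hξ' : ξ' ∈ C) (hη : η ∈ C)
    (hmin : IsMinOn (fun η => γ * inner ℝ g η + bregman ψ η ξ) C ξ') :
    γ * inner ℝ g ξ' + bregman ψ ξ' ξ + bregman ψ η ξ' ≤ γ * inner ℝ g η + bregman ψ η ξ := by
  have hC := hψ.2.2.1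
  have hd := hasDerivWithinAt_lineMap_zero hC hξ' hη (hψ.hasGradientWithinAt hξ')
  have hl : ∀ v : X, HasDerivWithinAt (fun t : ℝ => inner ℝ v (AffineMap.lineMap ξ' η t))
      (inner ℝ v (η - ξ')) (Icc 0 1) 0 := fun v =>
    hasDerivWithinAt_lineMap_zero hC hξ' hη (F := fun x => inner ℝ v x) (g := v)
      ((InnerProductSpace.toDual ℝ X v).hasFDerivWithinAt)
  have key := nonneg_of_hasDerivWithinAt_of_le
    ((((hl g).const_mul γ).add hd).sub (hl (gradient ψ ξ))) fun t ht => by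
      have := hmin (hC.lineMap_mem hξ' hη ht)
      simp only [mem_ofPred_eq, bregman, inner_sub_right] at this
      simp only [Pi.sub_apply, Pi.add_apply, AffineMap.lineMap_apply_zero]
      linarith
  simp only [bregman, inner_sub_right] at key ⊢
  linarith

/-- With step size 1 / L and a 1-strongly convex ψ, the quadratic remainder of the descent lemma is
absorbed by the term L D(ξ', ξ) of the three-point inequality. -/
theorem IsMirrorStep.le {C : Set X} {ψ : X → ℝ} (hψ : IsMirrorMap C ψ) {F : X → ℝ} {L : ℝ}
    (hL : 0 < L) (hF : HasLipschitzGradientOn F C L) {ξ ξ' η g : X} (hξ : ξ ∈ C) (hη : η ∈ C)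
    (hstep : IsMirrorStep ψ C (1 / L) F ξ ξ') (hg : HasGradientWithinAt F g C ξ) :
    F ξ' ≤ F ξ + inner ℝ g (η - ξ) + L * bregman ψ η ξ - L * bregman ψ η ξ' := by
  have hC := hψ.2.2.1
  obtain ⟨g', hg', hξ', hmin⟩ := hstep
  have h₁ := le_of_hasLipschitzGradientOn hC hF hξ hξ' hg'
  have h₂ := hψ.sq_norm_le_bregman hξ' hξ
  have h₃ := hψ.three_point hξ' hη hmin
  rw [inner_gradientWithin_unique hC hξ hη hg hg']
  rw [inner_sub_right] at h₁ ⊢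
  have h₄ := mul_le_mul_of_nonneg_left h₂ hL.le
  have h₅ := mul_le_mul_of_nonneg_left h₃ hL.le
  have e : ∀ z : ℝ, L * (1 / L * z) = z := fun z => by field_simp
  rw [mul_add, mul_add, mul_add, e, e] at h₅
  linarith

theorem IsMirrorStep.antitone {C : Set X} {ψ : X → ℝ} (hψ : IsMirrorMap C ψ) {F : X → ℝ} {L : ℝ}
    (hL : 0 < L) (hF : HasLipschitzGradientOn F C L) {ξ ξ' : X} (hξ : ξ ∈ C)
    (hstep : IsMirrorStep ψ C (1 / L) F ξ ξ') : F ξ' ≤ F ξ := by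
  have hξ' : ξ' ∈ C := by obtain ⟨_, _, h, _⟩ := hstep; exact h
  obtain ⟨G, hG, -⟩ := id hF
  -- Comparison with η = ξ, where the linear term and D(ξ, ξ) vanish.
  have := hstep.le hψ hL hF hξ hξ (hG ξ hξ)
  have h0 := mul_nonneg hL.le (hψ.bregman_nonneg hξ hξ')
  simp [bregman] at this h0
  linarith

/-- `F` is convex on `C` in the direction of `ξ'`. -/
def ConvexToward (F : X → ℝ) (C : Set X) (ξ' : X) : Prop :=
  ∀ ξ ∈ C, ∀ θ ∈ Icc (0 : ℝ) 1, F ((1 - θ) • ξ + θ • ξ') ≤ (1 - θ) * F ξ + θ * F ξ'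

theorem ConvexToward.inner_le {F : X → ℝ} {C : Set X} (hC : Convex ℝ C) {ξ ξ' g : X}
    (h : ConvexToward F C ξ') (hξ : ξ ∈ C) (hξ' : ξ' ∈ C) (hg : HasGradientWithinAt F g C ξ) :
    inner ℝ g (ξ' - ξ) ≤ F ξ' - F ξ := by
  have hd := hasDerivWithinAt_lineMap_zero hC hξ hξ' hg
  have hq : HasDerivAt (fun t : ℝ => t * (F ξ' - F ξ)) (1 * (F ξ' - F ξ)) 0 :=
    (hasDerivAt_id _).mul_const _
  have key := nonneg_of_hasDerivWithinAt_of_le (hq.hasDerivWithinAt.sub hd) fun t ht => by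
    have := h ξ hξ t ht
    simp only [Pi.sub_apply, AffineMap.lineMap_apply_module]
    simp only [zero_mul, sub_zero, one_smul, zero_smul, add_zero]
    linarith
  linarith

/-- Convexity toward η removes the linear term and leaves a bound that telescopes. -/
theorem IsMirrorStep.sub_le {C : Set X} {ψ : X → ℝ} (hψ : IsMirrorMap C ψ) {F : X → ℝ} {L : ℝ}
    (hL : 0 < L) (hF : HasLipschitzGradientOn F C L) {ξ ξ' η : X} (hξ : ξ ∈ C) (hη : η ∈ C)
    (hstep : IsMirrorStep ψ C (1 / L) F ξ ξ') (hconv : ConvexToward F C η) :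
    F ξ' - F η ≤ L * bregman ψ η ξ - L * bregman ψ η ξ' := by
  obtain ⟨G, hG, -⟩ := id hF
  have h₁ := hstep.le hψ hL hF hξ hη (hG ξ hξ)
  have h₂ := hconv.inner_le hψ.2.2.1 hξ hη (hG ξ hξ)
  linarith

theorem exists_isMirrorStep {C : Set X} (hcpt : IsCompact C) {ψ : X → ℝ} (hψ : IsMirrorMap C ψ)
    {F : X → ℝ} {g ξ : X} (γ : ℝ) (hξ : ξ ∈ C) (hg : HasGradientWithinAt F g C ξ) :
    ∃ ξ', IsMirrorStep ψ C γ F ξ ξ' := by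
  have hc : ContinuousOn (fun η => γ * inner ℝ g η + bregman ψ η ξ) C := by
    unfold bregman
    have := hψ.continuousOn
    fun_prop
  obtain ⟨ξ', hξ', hmin⟩ := hcpt.exists_isMinOn ⟨ξ, hξ⟩ hc
  exact ⟨ξ', g, hg, hξ', hmin⟩

section Run

variable {C : Set X} {ψ : X → ℝ} {F : X → ℝ} {L : ℝ} {ξ : ℕ → X}

theorem mem_of_isMirrorStep {γ : ℝ} (h0 : ξ 0 ∈ C)
    (hstep : ∀ n, IsMirrorStep ψ C γ F (ξ n) (ξ (n + 1))) (n : ℕ) : ξ n ∈ C := by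
  cases n with
  | zero => exact h0
  | succ n => obtain ⟨_, _, h, _⟩ := hstep n; exact h

theorem antitone_of_isMirrorStep (hψ : IsMirrorMap C ψ) (hL : 0 < L)
    (hF : HasLipschitzGradientOn F C L) (h0 : ξ 0 ∈ C)
    (hstep : ∀ n, IsMirrorStep ψ C (1 / L) F (ξ n) (ξ (n + 1))) : Antitone fun n => F (ξ n) :=
  antitone_nat_of_succ_le fun n =>
    (hstep n).antitone hψ hL hF (mem_of_isMirrorStep h0 hstep n)

/-- Sum of the telescoping one-step bounds; monotonicity of the values lets the last iterate stand
for all earlier ones. -/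
theorem mul_sub_le_of_isMirrorStep (hψ : IsMirrorMap C ψ) (hL : 0 < L)
    (hF : HasLipschitzGradientOn F C L) (h0 : ξ 0 ∈ C)
    (hstep : ∀ n, IsMirrorStep ψ C (1 / L) F (ξ n) (ξ (n + 1))) {η : X} (hη : η ∈ C)
    (hconv : ConvexToward F C η) (n : ℕ) :
    n * (F (ξ n) - F η) ≤ L * bregman ψ η (ξ 0) - L * bregman ψ η (ξ n) := by
  induction n with
  | zero => simp
  | succ n ih =>
    have h₁ := (hstep n).sub_le hψ hL hF (mem_of_isMirrorStep h0 hstep n) hη hconv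
    have h₂ : F (ξ (n + 1)) ≤ F (ξ n) := antitone_of_isMirrorStep hψ hL hF h0 hstep n.le_succ
    have h₃ : (n : ℝ) * F (ξ (n + 1)) ≤ n * F (ξ n) := by gcongr
    push_cast
    linarith

theorem sub_le_div_of_isMirrorStep (hψ : IsMirrorMap C ψ) (hL : 0 < L)
    (hF : HasLipschitzGradientOn F C L) (h0 : ξ 0 ∈ C)
    (hstep : ∀ n, IsMirrorStep ψ C (1 / L) F (ξ n) (ξ (n + 1))) {η : X} (hη : η ∈ C)
    (hconv : ConvexToward F C η) {n : ℕ} (hn : 1 ≤ n) :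
    F (ξ n) - F η ≤ L * bregman ψ η (ξ 0) / n := by
  have := mul_sub_le_of_isMirrorStep hψ hL hF h0 hstep hη hconv n
  have hb := mul_nonneg hL.le (hψ.bregman_nonneg hη (mem_of_isMirrorStep h0 hstep n))
  rw [le_div_iff₀ (by exact_mod_cast hn)]
  linarith

theorem tendsto_value_of_isMirrorStep (hψ : IsMirrorMap C ψ) (hL : 0 < L)
    (hF : HasLipschitzGradientOn F C L) (h0 : ξ 0 ∈ C)
    (hstep : ∀ n, IsMirrorStep ψ C (1 / L) F (ξ n) (ξ (n + 1))) {η : X} (hη : η ∈ C)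
    (hconv : ConvexToward F C η) (hmin : ∀ x ∈ C, F η ≤ F x) :
    Tendsto (fun n => F (ξ n)) atTop (𝓝 (F η)) := by
  have h : Tendsto (fun n : ℕ => F η + L * bregman ψ η (ξ 0) / n) atTop (𝓝 (F η + 0)) :=
    tendsto_const_nhds.add (tendsto_const_div_atTop_nhds_zero_nat _)
  rw [add_zero] at h
  refine tendsto_of_tendsto_of_tendsto_of_le_of_le' tendsto_const_nhds h
    (Eventually.of_forall fun n => hmin _ (mem_of_isMirrorStep h0 hstep n)) ?_
  filter_upwards [eventually_ge_atTop 1] with n hn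
  linarith [sub_le_div_of_isMirrorStep hψ hL hF h0 hstep hη hconv hn]

/-- Fejér monotonicity: a cluster point y is a minimiser, so F is convex toward y and D(y, ξₙ)
decreases. It tends to 0 along a subsequence, hence along the whole sequence, and strong convexity
gives convergence in norm. -/
theorem tendsto_of_isMirrorStep (hcpt : IsCompact C) (hψ : IsMirrorMap C ψ) (hL : 0 < L)
    (hF : HasLipschitzGradientOn F C L) (h0 : ξ 0 ∈ C)
    (hstep : ∀ n, IsMirrorStep ψ C (1 / L) F (ξ n) (ξ (n + 1))) {η : X} (hη : η ∈ C)
    (hmin : ∀ x ∈ C, F η ≤ F x) (hconv : ∀ y ∈ C, F y = F η → ConvexToward F C y) :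
    ∃ y ∈ C, F y = F η ∧ Tendsto ξ atTop (𝓝 y) := by
  have hmem := mem_of_isMirrorStep h0 hstep
  obtain ⟨y, hy, φ, hφ, hlim⟩ := hcpt.tendsto_subseq hmem
  have hlim' : Tendsto (ξ ∘ φ) atTop (𝓝[C] y) :=
    tendsto_nhdsWithin_iff.2 ⟨hlim, Eventually.of_forall fun n => hmem _⟩
  have hFc : ContinuousOn F C := fun x hx => by
    obtain ⟨G, hG, -⟩ := hF
    exact (hG x hx).hasFDerivWithinAt.continuousWithinAt
  have hval := tendsto_value_of_isMirrorStep hψ hL hF h0 hstep hη (hconv η hη rfl) hmin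
  have hFy : F y = F η :=
    tendsto_nhds_unique ((hFc y hy).tendsto.comp hlim') (hval.comp hφ.tendsto_atTop)
  refine ⟨y, hy, hFy, ?_⟩
  have hanti : Antitone fun n => bregman ψ y (ξ n) := antitone_nat_of_succ_le fun n => by
    have h := (hstep n).sub_le hψ hL hF (hmem n) hy (hconv y hy hFy)
    have h' := hmin _ (hmem (n + 1))
    exact le_of_mul_le_mul_left (by linarith) hL
  -- The second argument of the divergence varies, so continuity of the gradient of ψ is needed
  -- here.
  have hbc : ContinuousWithinAt (fun x => bregman ψ y x) C y := by
    unfold bregman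
    have h₁ := hψ.continuousOn y hy
    have h₂ := hψ.2.1 y hy
    exact (continuousWithinAt_const.sub h₁).sub
      (h₂.inner (𝕜 := ℝ) (continuousWithinAt_const.sub continuousWithinAt_id))
  have hb0 : Tendsto (fun n => bregman ψ y (ξ (φ n))) atTop (𝓝 0) := by
    have := hbc.tendsto.comp hlim'
    simpa [bregman, Function.comp_def] using this
  have hb : Tendsto (fun n => bregman ψ y (ξ n)) atTop (𝓝 0) :=
    tendsto_iff_tendsto_subseq_of_antitone hanti hφ.tendsto_atTop |>.2 hb0
  rw [tendsto_iff_norm_sub_tendsto_zero]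
  have hsq : Tendsto (fun n => √(2 * bregman ψ y (ξ n))) atTop (𝓝 0) := by
    have := (Real.continuous_sqrt.tendsto _).comp (hb.const_mul 2)
    simpa [Function.comp_def] using this
  refine squeeze_zero (fun n => norm_nonneg _) (fun n => ?_) hsq
  refine Real.le_sqrt_of_sq_le ?_
  have := hψ.sq_norm_le_bregman hy (hmem n)
  rw [norm_sub_rev]
  linarith

end Run

end MirrorDescent

/-! ### Quadratic functions with matrices that depend on a parameter. -/

section Quadratic

open Matrix

variable {ι : Type*} [Fintype ι]

/-- The quadratic function with matrix `A` and linear part `b`. -/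
noncomputable def quadEnergy (A : Matrix ι ι ℝ) (b w : ι → ℝ) : ℝ := w ⬝ᵥ A *ᵥ w / 2 - b ⬝ᵥ w

theorem det_ne_zero_of_pos [DecidableEq ι] {A : Matrix ι ι ℝ} (hpos : ∀ w ≠ 0, 0 < w ⬝ᵥ A *ᵥ w) :
    A.det ≠ 0 := by
  intro h
  obtain ⟨v, hv, hv'⟩ := Matrix.exists_mulVec_eq_zero_iff.2 h
  have := hpos v hv
  simp [hv'] at this

/-- Completing the square. For a fixed matrix it yields the unique minimiser; for a varying one it
measures how far frozen coefficients are from optimal, which gives the envelope identity. -/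
theorem quadEnergy_eq [DecidableEq ι] {A : Matrix ι ι ℝ} (hsymm : A.IsSymm) (hdet : A.det ≠ 0)
    (b w : ι → ℝ) :
    quadEnergy A b w = quadEnergy A b (A⁻¹ *ᵥ b) +
      (w - A⁻¹ *ᵥ b) ⬝ᵥ A *ᵥ (w - A⁻¹ *ᵥ b) / 2 := by
  have hb : A *ᵥ (A⁻¹ *ᵥ b) = b := by
    rw [mulVec_mulVec, mul_nonsing_inv _ (isUnit_iff_ne_zero.2 hdet), one_mulVec]
  generalize A⁻¹ *ᵥ b = v at *
  subst hb
  have hs : ∀ x y : ι → ℝ, x ⬝ᵥ A *ᵥ y = y ⬝ᵥ A *ᵥ x := fun x y => by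
    rw [dotProduct_mulVec, ← mulVec_transpose, hsymm.eq, dotProduct_comm]
  simp only [quadEnergy, mulVec_sub, dotProduct_sub, sub_dotProduct]
  rw [dotProduct_comm (A *ᵥ v) w, dotProduct_comm (A *ᵥ v) v, hs v w]
  ring

theorem quadEnergy_min [DecidableEq ι] {A : Matrix ι ι ℝ} (hsymm : A.IsSymm)
    (hpos : ∀ w ≠ 0, 0 < w ⬝ᵥ A *ᵥ w)
    (b w : ι → ℝ) : quadEnergy A b (A⁻¹ *ᵥ b) ≤ quadEnergy A b w := by
  rw [quadEnergy_eq hsymm (det_ne_zero_of_pos hpos) b w]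
  by_cases h : w - A⁻¹ *ᵥ b = 0
  · simp [h]
  · linarith [hpos _ h]

theorem eq_of_quadEnergy_le [DecidableEq ι] {A : Matrix ι ι ℝ} (hsymm : A.IsSymm)
    (hpos : ∀ w ≠ 0, 0 < w ⬝ᵥ A *ᵥ w) {b w : ι → ℝ}
    (h : quadEnergy A b w ≤ quadEnergy A b (A⁻¹ *ᵥ b)) : w = A⁻¹ *ᵥ b := by
  rw [quadEnergy_eq hsymm (det_ne_zero_of_pos hpos) b w] at h
  by_contra hne
  linarith [hpos _ (sub_ne_zero.2 hne)]

variable {V : Type*} [NormedAddCommGroup V] [NormedSpace ℝ V] {lip : Prop} {C : Set V}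

theorem C1On.det [DecidableEq ι] (hC : IsCompact C) (hconv : Convex ℝ C) {A : V → Matrix ι ι ℝ}
    (hA : ∀ i j, C1On lip C fun ξ => A ξ i j) : C1On lip C fun ξ => (A ξ).det := by
  simp only [det_apply']
  exact C1On.sum _ fun σ _ => (C1On.prod hC hconv _ fun i _ => hA _ _).const_mul hC hconv _

/-- Cramer's rule: the entries of the adjugate are determinants, hence polynomials in the entries of
the matrix. -/
theorem C1On.inv_mulVec [DecidableEq ι] (hC : IsCompact C) (hconv : Convex ℝ C)
    {A : V → Matrix ι ι ℝ} {b : V → ι → ℝ} (hA : ∀ i j, C1On lip C fun ξ => A ξ i j)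
    (hb : ∀ i, C1On lip C fun ξ => b ξ i) (hdet : ∀ ξ ∈ C, (A ξ).det ≠ 0) (i : ι) :
    C1On lip C fun ξ => ((A ξ)⁻¹ *ᵥ b ξ) i := by
  have hadj : ∀ i j, C1On lip C fun ξ => (A ξ).adjugate i j := fun i j => by
    simp only [adjugate_apply]
    refine C1On.det hC hconv fun k l => ?_
    by_cases hk : k = j
    · subst hk
      simpa using C1On.const lip C _
    · simpa [updateRow_ne hk] using hA k l
  have h : ∀ j, C1On lip C fun ξ => (A ξ).det⁻¹ * (A ξ).adjugate i j * b ξ j := fun j =>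
    (((C1On.det hC hconv hA).inv hC hconv hdet).mul hC hconv (hadj i j)).mul hC hconv (hb j)
  refine (C1On.sum Finset.univ fun j _ => h j).congr fun ξ _ => ?_
  simp [inv_def, mulVec, dotProduct]

theorem C1On.quadEnergy (hC : IsCompact C) (hconv : Convex ℝ C) {A : V → Matrix ι ι ℝ}
    {b w : V → ι → ℝ} (hA : ∀ i j, C1On lip C fun ξ => A ξ i j)
    (hb : ∀ i, C1On lip C fun ξ => b ξ i) (hw : ∀ i, C1On lip C fun ξ => w ξ i) :
    C1On lip C fun ξ => quadEnergy (A ξ) (b ξ) (w ξ) := by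
  have h₁ : C1On lip C fun ξ => ∑ i, w ξ i * ∑ j, A ξ i j * w ξ j :=
    C1On.sum _ fun i _ => (hw i).mul hC hconv (C1On.sum _ fun j _ => (hA i j).mul hC hconv (hw j))
  have h₂ : C1On lip C fun ξ => ∑ i, b ξ i * w ξ i :=
    C1On.sum _ fun i _ => (hb i).mul hC hconv (hw i)
  refine ((h₁.const_mul hC hconv (1 / 2)).add (h₂.const_mul hC hconv (-1))).congr fun ξ _ => ?_
  simp only [FreeKnot.quadEnergy, dotProduct, mulVec]
  ring

/-- A quadratic form with differentiable coefficients has zero derivative where its argument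
vanishes. -/
theorem hasFDerivWithinAt_quadForm_zero {A : V → Matrix ι ι ℝ} {e : V → ι → ℝ} {ξ : V}
    (hA : ∀ i j, DifferentiableWithinAt ℝ (fun η => A η i j) C ξ)
    (he : ∀ i, DifferentiableWithinAt ℝ (fun η => e η i) C ξ) (h0 : e ξ = 0) :
    HasFDerivWithinAt (fun η => e η ⬝ᵥ A η *ᵥ e η / 2) (0 : V →L[ℝ] ℝ) C ξ := by
  -- Every term of the product rule keeps a factor `e ξ i` or `e ξ j`, which is zero.
  have h : ∀ i j, HasFDerivWithinAt (fun η => e η i * (A η i j * e η j)) (0 : V →L[ℝ] ℝ) C ξ := by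
    intro i j
    have := (he i).hasFDerivWithinAt.mul ((hA i j).mul (he j)).hasFDerivWithinAt
    refine this.congr_fderiv ?_
    simp [h0]
  have hs := HasFDerivWithinAt.fun_sum (u := Finset.univ) fun i _ =>
    HasFDerivWithinAt.fun_sum (u := Finset.univ) fun j _ => h i j
  have := hs.mul_const (1 / 2 : ℝ)
  refine (this.congr_fderiv (by simp)).congr_of_eventuallyEq ?_ ?_
  · refine Eventually.of_forall fun η => ?_
    simp [dotProduct, mulVec, Finset.mul_sum, div_eq_mul_inv]
  · simp [dotProduct, mulVec, Finset.mul_sum, div_eq_mul_inv]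

end Quadratic

/-! ### Truncated powers and their moments as functions of the knot. -/

section TruncatedPowers

theorem truncPow_succ_eq (m : ℕ) (x y : ℝ) : truncPow (m + 1) x y = max (y - x) 0 ^ (m + 1) := by
  unfold truncPow
  split_ifs with h
  · rw [max_eq_left (by linarith)]
  · rw [max_eq_right (by linarith), zero_pow (by omega)]

theorem abs_truncPow_le (m : ℕ) {x y M : ℝ} (h : |y - x| ≤ M) : |truncPow m x y| ≤ M ^ m := by
  unfold truncPow
  split_ifs
  · rw [abs_pow]; gcongr
  · simpa using pow_nonneg ((abs_nonneg _).trans h) m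

/-- The Lipschitz constant is uniform in x, as domination under the integral requires. -/
theorem abs_truncPow_sub_le (m : ℕ) {x y z M : ℝ} (hy : |y - x| ≤ M) (hz : |z - x| ≤ M) :
    |truncPow (m + 1) x y - truncPow (m + 1) x z| ≤ (m + 1) * M ^ m * |y - z| := by
  rw [truncPow_succ_eq, truncPow_succ_eq]
  have hM : 0 ≤ M := (abs_nonneg _).trans hy
  have hb : ∀ u : ℝ, |u| ≤ M → |max u 0| ≤ M := fun u hu => by
    rw [abs_of_nonneg (le_max_right _ _)]
    exact max_le ((le_abs_self _).trans hu) hM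
  refine (abs_pow_sub_pow_le ..).trans ?_
  have h₁ : |max (y - x) 0 - max (z - x) 0| ≤ |y - z| := by
    refine (abs_max_sub_max_le_abs _ _ _).trans (le_of_eq ?_)
    congr 1; ring
  have h₂ : max |max (y - x) 0| |max (z - x) 0| ≤ M := max_le (hb _ hy) (hb _ hz)
  rw [Nat.add_sub_cancel]
  push_cast
  calc _ ≤ |y - z| * (m + 1) * M ^ m := by gcongr
    _ = _ := by ring

theorem hasDerivAt_truncPow_succ (m : ℕ) {x y : ℝ} (h : x ≠ y) :
    HasDerivAt (truncPow (m + 1) x) ((m + 1) * truncPow m x y) y := by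
  rcases lt_or_gt_of_ne h with h | h
  · have h₁ : HasDerivAt (fun z => (z - x) ^ (m + 1)) ((m + 1) * truncPow m x y) y := by
      have := ((hasDerivAt_id y).sub_const x).fun_pow (m + 1)
      simpa [truncPow, h] using this
    refine h₁.congr_of_eventuallyEq ?_
    filter_upwards [lt_mem_nhds h] with z hz
    simp [truncPow, hz]
  · have h₁ : HasDerivAt (fun _ : ℝ => (0 : ℝ)) ((m + 1) * truncPow m x y) y := by
      simpa [truncPow, h.not_gt] using hasDerivAt_const y (0 : ℝ)
    refine h₁.congr_of_eventuallyEq ?_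
    filter_upwards [gt_mem_nhds h] with z hz
    simp [truncPow, hz.not_gt]

theorem continuousAt_truncPow (m : ℕ) {x y : ℝ} (h : x ≠ y) : ContinuousAt (truncPow m x) y := by
  cases m with
  | succ m => exact (hasDerivAt_truncPow_succ m h).continuousAt
  | zero =>
    rcases lt_or_gt_of_ne h with h | h
    · refine (continuousAt_const (y := (1 : ℝ))).congr ?_
      filter_upwards [lt_mem_nhds h] with z hz
      simp [truncPow, hz]
    · refine (continuousAt_const (y := (0 : ℝ))).congr ?_
      filter_upwards [gt_mem_nhds h] with z hz
      simp [truncPow, hz.not_gt]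

theorem measurable_truncPow (m : ℕ) (y : ℝ) : Measurable fun x => truncPow m x y :=
  Measurable.ite measurableSet_Iio (by fun_prop) measurable_const

/-- The moments `∫ f(x) (y - x)₊ ^ m dx` over `[α, β]`. -/
noncomputable def truncMoment (α β : ℝ) (f : ℝ → ℝ) (m : ℕ) (y : ℝ) : ℝ :=
  ∫ x in Icc α β, f x * truncPow m x y

variable {α β : ℝ} {f : ℝ → ℝ}

theorem abs_sub_le_of_mem_Icc {x y : ℝ} (hx : x ∈ Icc α β) : |y - x| ≤ |y| + (|α| + |β|) := by
  refine (abs_sub _ _).trans (add_le_add_right ?_ _)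
  rw [abs_le]
  constructor
  · linarith [hx.1, neg_abs_le α, abs_nonneg β]
  · linarith [hx.2, le_abs_self β, abs_nonneg α]

theorem ae_restrict_Icc_mem : ∀ᵐ x ∂volume.restrict (Icc α β), x ∈ Icc α β :=
  ae_restrict_mem measurableSet_Icc

theorem integrable_mul_truncPow (hf : IntegrableOn f (Icc α β)) (m : ℕ) (y : ℝ) :
    IntegrableOn (fun x => f x * truncPow m x y) (Icc α β) := by
  refine Integrable.mul_bdd (c := (|y| + (|α| + |β|)) ^ m) hf
    (measurable_truncPow m y).aestronglyMeasurable ?_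
  filter_upwards [ae_restrict_Icc_mem] with x hx
  exact abs_truncPow_le m (abs_sub_le_of_mem_Icc hx)

theorem ae_restrict_ne (y : ℝ) : ∀ᵐ x ∂volume.restrict (Icc α β), x ≠ y :=
  ae_restrict_of_ae (by simp [ae_iff])

/-- Differentiation under the integral. The integrand fails to be differentiable at most at x = y, a
null set, so mere integrability of f suffices even for m = 0. -/
theorem hasDerivAt_truncMoment_succ (hf : IntegrableOn f (Icc α β)) (m : ℕ) (y : ℝ) :
    HasDerivAt (truncMoment α β f (m + 1)) ((m + 1) * truncMoment α β f m y) y := by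
  -- A bound for |u - x| when u lies in the unit ball around y and x in the interval.
  set M := |y| + 1 + (|α| + |β|) with hM
  have key := (hasDerivAt_integral_of_dominated_loc_of_lip
    (μ := volume.restrict (Icc α β)) (F := fun y x => f x * truncPow (m + 1) x y)
    (F' := fun x => f x * ((m + 1) * truncPow m x y)) (x₀ := y)
    (bound := fun x => |f x| * ((m + 1) * M ^ m)) (Metric.ball_mem_nhds y one_pos)
    (Eventually.of_forall fun z =>
      (integrable_mul_truncPow hf (m + 1) z).aestronglyMeasurable)
    (integrable_mul_truncPow hf (m + 1) y)
    (hf.aestronglyMeasurable.mul ((measurable_truncPow m y).const_mul _).aestronglyMeasurable)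
    ?_ (hf.abs.mul_const _) ?_).2
  · rw [truncMoment, ← integral_const_mul]
    refine key.congr_deriv (congrArg _ (funext fun x => ?_))
    ring
  · filter_upwards [ae_restrict_Icc_mem] with x hx
    refine LipschitzOnWith.of_dist_le_mul fun u hu v hv => ?_
    have hball : ∀ u ∈ Metric.ball y 1, |u - x| ≤ M := fun u hu => by
      refine (abs_sub_le_of_mem_Icc hx).trans ?_
      rw [Metric.mem_ball, Real.dist_eq] at hu
      have := abs_sub_abs_le_abs_sub u y
      linarith
    have h := abs_truncPow_sub_le m (hball u hu) (hball v hv)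
    have hb : 0 ≤ |f x| * ((m + 1) * M ^ m) := by positivity
    rw [Real.dist_eq, Real.dist_eq, ← mul_sub, abs_mul, Real.coe_nnabs, abs_of_nonneg hb, mul_assoc]
    gcongr
  · filter_upwards [ae_restrict_ne y] with x hx
    exact (hasDerivAt_truncPow_succ m hx).const_mul _

theorem continuous_truncMoment (hf : IntegrableOn f (Icc α β)) (m : ℕ) :
    Continuous (truncMoment α β f m) := by
  cases m with
  | succ m =>
    exact continuous_iff_continuousAt.2 fun y => (hasDerivAt_truncMoment_succ hf m y).continuousAt
  | zero =>
    refine continuous_iff_continuousAt.2 fun y => ?_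
    refine continuousAt_of_dominated (bound := fun x => |f x|)
      (Eventually.of_forall fun z => (integrable_mul_truncPow hf 0 z).aestronglyMeasurable)
      (Eventually.of_forall fun z => Eventually.of_forall fun x => ?_) hf.abs ?_
    · rw [norm_mul, Real.norm_eq_abs]
      refine mul_le_of_le_one_right (abs_nonneg _) ?_
      simpa using abs_truncPow_le 0 (le_refl |z - x|)
    · filter_upwards [ae_restrict_ne y] with x hx
      exact continuousAt_const.mul (continuousAt_truncPow 0 hx)

theorem truncMoment_zero_eq (y : ℝ) :
    truncMoment α β f 0 y = ∫ x in Icc α β ∩ Iio y, f x := by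
  rw [truncMoment, ← setIntegral_indicator measurableSet_Iio]
  refine integral_congr_ae (Eventually.of_forall fun x => ?_)
  by_cases h : x < y <;> simp [truncPow, h]

/-- An increment is the integral of a bounded function over an interval whose length is the
increment of the knot. -/
theorem exists_lipschitz_truncMoment_zero (hf : MemLp f ⊤ (volume.restrict (Icc α β))) :
    ∃ K, LipschitzWith K (truncMoment α β f 0) := by
  have hfi : IntegrableOn f (Icc α β) := hf.integrable (by simp)
  obtain ⟨M, hM⟩ : ∃ M : ℝ, ∀ᵐ x ∂volume.restrict (Icc α β), ‖f x‖ ≤ M := by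
    have h := hf.2
    rw [eLpNorm_exponent_top] at h
    refine ⟨(eLpNormEssSup f (volume.restrict (Icc α β))).toReal, ?_⟩
    filter_upwards [ae_le_eLpNormEssSup (f := f) (μ := volume.restrict (Icc α β))] with x hx
    have := ENNReal.toReal_mono h.ne hx
    simpa using this
  refine ⟨M.toNNReal, LipschitzWith.of_le_add_mul _ fun y z => ?_⟩
  rw [← sub_le_iff_le_add']
  have hmain : ∀ u v : ℝ, u ≤ v →
      |truncMoment α β f 0 v - truncMoment α β f 0 u| ≤ M.toNNReal * (v - u) := by
    intro u v huv
    have e : truncMoment α β f 0 v - truncMoment α β f 0 u =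
        ∫ x in Icc α β ∩ Ico u v, f x := by
      rw [truncMoment_zero_eq, truncMoment_zero_eq, sub_eq_iff_eq_add,
        ← setIntegral_union _ (measurableSet_Icc.inter measurableSet_Iio)
          (hfi.mono_set inter_subset_left) (hfi.mono_set inter_subset_left)]
      · rw [← inter_union_distrib_left, union_comm, Iio_union_Ico_eq_Iio huv]
      · refine (disjoint_left.2 ?_)
        rintro x ⟨-, hx⟩ ⟨-, hx'⟩
        exact absurd hx.1 (not_le.2 hx')
    have hvol : volume (Icc α β ∩ Ico u v) ≤ ENNReal.ofReal (v - u) :=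
      (measure_mono inter_subset_right).trans (by simp)
    rw [e, ← Real.norm_eq_abs]
    refine (norm_setIntegral_le_of_norm_le_const_ae (C := (M.toNNReal : ℝ))
      (hvol.trans_lt ENNReal.ofReal_lt_top) ?_).trans ?_
    · refine ae_mono (Measure.restrict_mono inter_subset_left le_rfl) ?_
      filter_upwards [hM] with x hx
      exact hx.trans (Real.le_coe_toNNReal _)
    · gcongr
      exact ENNReal.toReal_le_of_le_ofReal (by linarith) hvol
  rcases le_total y z with h | h
  · have := neg_le_of_abs_le (hmain y z h)
    rw [Real.dist_eq, abs_sub_comm, abs_of_nonneg (sub_nonneg.2 h)]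
    linarith
  · have := le_of_abs_le (hmain z y h)
    rw [Real.dist_eq, abs_of_nonneg (sub_nonneg.2 h)]
    linarith

/-- The derivative is a multiple of the moment of order m. This is Lipschitz either because it is
itself continuously differentiable (m ≥ 1) or because f is bounded (m = 0). -/
theorem C1On.truncMoment_succ {lip : Prop} (hf : IntegrableOn f (Icc α β)) (m : ℕ)
    (hl : lip → 1 ≤ m ∨ MemLp f ⊤ (volume.restrict (Icc α β))) (a b : ℝ) :
    C1On lip (Icc a b) (truncMoment α β f (m + 1)) := by
  have key : ∀ lip' : Prop, (lip' → ∃ K, LipschitzOnWith K (truncMoment α β f m) (Icc a b)) →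
      C1On lip' (Icc a b) (truncMoment α β f (m + 1)) := fun lip' h =>
    C1On.of_hasDerivWithinAt (f := fun y => (m + 1) * truncMoment α β f m y)
      (fun y _ => (hasDerivAt_truncMoment_succ hf m y).hasDerivWithinAt)
      (continuous_const.mul (continuous_truncMoment hf m)).continuousOn
      fun hh => by
        obtain ⟨K, hK⟩ := h hh
        exact ⟨_, (lipschitzWith_smul (m + 1 : ℝ)).comp_lipschitzOnWith hK⟩
  refine key lip fun hh => ?_
  cases m with
  | zero =>
    rcases hl hh with h | h
    · omega
    · obtain ⟨K, hK⟩ := exists_lipschitz_truncMoment_zero h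
      exact ⟨K, hK.lipschitzOnWith⟩
  | succ m =>
    refine C1On.exists_lipschitzOnWith (lip := False) isCompact_Icc (convex_Icc a b) ?_
    exact C1On.of_hasDerivWithinAt (f := fun y => (m + 1) * truncMoment α β f m y)
      (fun y _ => (hasDerivAt_truncMoment_succ hf m y).hasDerivWithinAt)
      (continuous_const.mul (continuous_truncMoment hf m)).continuousOn False.elim

/-- On [α, β] the moment is a primitive of F. Outside it is constant, so its derivative may jump at
the endpoints; hence knots must stay in the domain when a degree equals the order. -/
theorem C1On.truncMoment_zero {lip : Prop} {F : ℝ → ℝ} (hF : Continuous F)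
    (hfF : f =ᵐ[volume.restrict (Icc α β)] F)
    (hl : lip → ∃ K, LipschitzOnWith K F (Icc α β)) :
    C1On lip (Icc α β) (truncMoment α β f 0) := by
  have h : C1On lip (Icc α β) (fun y => ∫ x in α..y, F x) :=
    C1On.of_hasDerivWithinAt (f := F)
      (fun y _ => (hF.integral_hasStrictDerivAt α y).hasDerivAt.hasDerivWithinAt)
      hF.continuousOn hl
  refine h.congr fun y hy => ?_
  rw [truncMoment_zero_eq, setIntegral_congr_ae (g := F)
    (measurableSet_Icc.inter measurableSet_Iio), intervalIntegral.integral_of_le hy.1,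
    ← integral_Ico_eq_integral_Ioc]
  · congr 2
    ext x
    constructor
    · rintro ⟨h₁, h₂⟩; exact ⟨h₁.1, h₂⟩
    · rintro ⟨h₁, h₂⟩; exact ⟨⟨h₁, h₂.le.trans hy.2⟩, h₂⟩
  · rw [Filter.EventuallyEq, ae_restrict_iff' measurableSet_Icc] at hfF
    filter_upwards [hfF] with x hx hx'
    exact hx hx'.1

end TruncatedPowers

/-! ### Weak derivatives of splines and continuous representatives in H¹. -/

section WeakDerivatives

variable {α β : ℝ}

theorem setIntegral_Icc_eq_interval (hαβ : α ≤ β) (f : ℝ → ℝ) :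
    ∫ x in Icc α β, f x = ∫ x in α..β, f x := by
  rw [integral_Icc_eq_integral_Ioc, intervalIntegral.integral_of_le hαβ]

theorem test_eq_zero {θ : ℝ → ℝ} (h : tsupport θ ⊆ Ioo α β) {x : ℝ} (hx : x ∉ Ioo α β) :
    θ x = 0 := image_eq_zero_of_notMem_tsupport fun h' => hx (h h')

/-- Reflection exchanges knot and variable, so derivatives in y become derivatives in x. -/
theorem truncPow_neg (m : ℕ) (x y : ℝ) : truncPow m x y = truncPow m (-y) (-x) := by
  unfold truncPow
  simp only [neg_lt_neg_iff]
  congr 2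
  ring

theorem hasDerivAt_truncPow_succ_left (m : ℕ) {x y : ℝ} (h : x ≠ y) :
    HasDerivAt (fun x => truncPow (m + 1) x y) (-((m + 1) * truncPow m x y)) x := by
  have h₁ := (hasDerivAt_truncPow_succ m (x := -y) (y := -x) fun h' => h (neg_injective h').symm)
  have := h₁.comp x (hasDerivAt_neg x)
  rw [← truncPow_neg, mul_neg_one] at this
  refine this.congr_of_eventuallyEq (Eventually.of_forall fun z => ?_)
  exact truncPow_neg _ _ _

theorem continuous_truncPow_succ_left (m : ℕ) (y : ℝ) :
    Continuous fun x => truncPow (m + 1) x y := by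
  simp only [truncPow_succ_eq]
  fun_prop

/-- Integration by parts off the single point y. No sign appears: the minus sign from the parts
cancels the one from differentiating (y - x)₊ in x. -/
theorem integral_truncPow_mul_deriv (m : ℕ) (y : ℝ) {θ : ℝ → ℝ} (hαβ : α ≤ β)
    (hθ : ContDiff ℝ 1 θ) (hs : tsupport θ ⊆ Ioo α β) :
    ∫ x in Icc α β, truncPow (m + 1) x y * deriv θ x =
      (m + 1) * ∫ x in Icc α β, truncPow m x y * θ x := by
  have hθ' : Continuous (deriv θ) := hθ.continuous_deriv le_rfl
  have hi₁ : IntegrableOn (fun x => truncPow (m + 1) x y * deriv θ x) (Icc α β) :=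
    ((continuous_truncPow_succ_left m y).mul hθ').continuousOn.integrableOn_Icc
  have hi₂ : IntegrableOn (fun x => truncPow m x y * θ x) (Icc α β) := by
    have := integrable_mul_truncPow
      (hθ.continuous.continuousOn.integrableOn_Icc (a := α) (b := β)) m y
    simpa [mul_comm] using this
  have hint : IntegrableOn (fun x => -((m + 1) * truncPow m x y) * θ x +
      truncPow (m + 1) x y * deriv θ x) (Icc α β) := by
    refine Integrable.add ?_ hi₁
    refine (hi₂.const_mul (-(m + 1 : ℝ))).congr (Eventually.of_forall fun x => ?_)
    simp only
    ring
  have h := integral_eq_of_hasDerivAt_off_countable_of_le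
    (fun x => truncPow (m + 1) x y * θ x)
    (fun x => -((m + 1) * truncPow m x y) * θ x + truncPow (m + 1) x y * deriv θ x) hαβ
    (countable_singleton y) ((continuous_truncPow_succ_left m y).mul hθ.continuous).continuousOn
    (fun x hx => (hasDerivAt_truncPow_succ_left m hx.2).mul
      (hθ.differentiable (by simp) x).hasDerivAt)
    ((intervalIntegrable_iff_integrableOn_Icc_of_le hαβ).2 hint)
  rw [test_eq_zero hs (by simp : β ∉ Ioo α β), test_eq_zero hs (by simp : α ∉ Ioo α β),
    ← setIntegral_Icc_eq_interval hαβ] at h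
  have e : (fun x => -((m + 1) * truncPow m x y) * θ x + truncPow (m + 1) x y * deriv θ x) =
      fun x => truncPow (m + 1) x y * deriv θ x - (m + 1) * (truncPow m x y * θ x) := by
    ext x; ring
  rw [e, integral_sub hi₁ (hi₂.const_mul _), integral_const_mul] at h
  linarith

theorem integral_truncPow_mul_iteratedDeriv (y : ℝ) (hαβ : α ≤ β) (p j : ℕ) (hj : j ≤ p)
    {θ : ℝ → ℝ} (hθ : ContDiff ℝ ∞ θ) (hs : tsupport θ ⊆ Ioo α β) :
    ∫ x in Icc α β, truncPow p x y * iteratedDeriv j θ x =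
      p.descFactorial j * ∫ x in Icc α β, truncPow (p - j) x y * θ x := by
  induction j generalizing θ with
  | zero => simp
  | succ j ih =>
    rw [iteratedDeriv_succ', ih (by omega) (contDiff_infty_iff_deriv.1 hθ).2
      (tsupport_deriv_subset.trans hs)]
    obtain ⟨q, hq⟩ : ∃ q, p - j = q + 1 := ⟨p - j - 1, by omega⟩
    rw [Nat.descFactorial_succ, hq, integral_truncPow_mul_deriv q y hαβ (hθ.of_le (by simp)) hs,
      show p - (j + 1) = q by omega]
    push_cast
    ring

/-- The `j`-th derivative of `(y - x)₊ ^ p` in `x`. -/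
noncomputable def truncPowDeriv (p j : ℕ) (x y : ℝ) : ℝ :=
  (-1) ^ j * p.descFactorial j * truncPow (p - j) x y

theorem memLp_truncPow (p : ℕ) (y : ℝ) :
    MemLp (fun x => truncPow p x y) 2 (volume.restrict (Icc α β)) := by
  refine MemLp.of_bound (measurable_truncPow p y).aestronglyMeasurable
    ((|y| + (|α| + |β|)) ^ p) ?_
  filter_upwards [ae_restrict_Icc_mem] with x hx
  exact abs_truncPow_le p (abs_sub_le_of_mem_Icc hx)

theorem isWeakDeriv_truncPow (hαβ : α ≤ β) {p j : ℕ} (hj : j ≤ p) (y : ℝ) :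
    IsWeakDeriv α β j (fun x => truncPow p x y) (fun x => truncPowDeriv p j x y) := by
  intro θ hθ _ hs
  rw [integral_truncPow_mul_iteratedDeriv y hαβ p j hj hθ hs]
  simp only [truncPowDeriv, mul_assoc, integral_const_mul]
  rw [← mul_assoc ((-1 : ℝ) ^ j), ← mul_pow]
  simp

theorem isSobolevJet_sum_truncPow (hαβ : α ≤ β) {ι : Type*} [Fintype ι] {k p : ℕ} (hk : k ≤ p)
    (κ y : ι → ℝ) :
    IsSobolevJet k α β (fun x => ∑ i, κ i * truncPow p x (y i))
      (fun j x => ∑ i, κ i * truncPowDeriv p j x (y i)) := by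
  refine ⟨memLp_finsetSum _ fun i _ => (memLp_truncPow p (y i)).const_mul _, fun j hj => ⟨?_, ?_⟩⟩
  · exact memLp_finsetSum _ fun i _ => ((memLp_truncPow (p - j) (y i)).const_mul _).const_mul _
  · intro θ hθ hc hs
    have hint : ∀ (g : ℝ → ℝ), Continuous g → ∀ q i,
        IntegrableOn (fun x => truncPow q x (y i) * g x) (Icc α β) := fun g hg q i => by
      have := integrable_mul_truncPow (hg.continuousOn.integrableOn_Icc (a := α) (b := β)) q (y i)
      simpa [mul_comm] using this
    simp only [Finset.sum_mul, mul_assoc]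
    rw [integral_finsetSum _ fun i _ =>
        (hint _ (hθ.continuous_iteratedDeriv j (by exact_mod_cast le_top)) p i).const_mul _,
      integral_finsetSum _ fun i _ => by
        simp only [truncPowDeriv, mul_assoc]
        exact (((hint _ hθ.continuous (p - j) i).const_mul _).const_mul _).const_mul _,
      Finset.mul_sum]
    refine Finset.sum_congr rfl fun i _ => ?_
    rw [integral_const_mul, integral_const_mul,
      isWeakDeriv_truncPow hαβ (hj.trans hk) (y i) θ hθ hc hs]
    ring

/-- A function with zero weak derivative is constant. -/
theorem ae_eq_const_of_integral_mul_deriv_eq_zero (hαβ : α < β) {v : ℝ → ℝ}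
    (hv : IntegrableOn v (Icc α β))
    (h : ∀ θ : ℝ → ℝ, ContDiff ℝ ∞ θ → HasCompactSupport θ → tsupport θ ⊆ Ioo α β →
      ∫ x in Icc α β, v x * deriv θ x = 0) :
    ∃ c : ℝ, v =ᵐ[volume.restrict (Icc α β)] fun _ => c := by
  have hint : ∀ g : ℝ → ℝ, Continuous g → IntegrableOn (fun x => v x * g x) (Icc α β) :=
    fun g hg => hv.mul_continuousOn hg.continuousOn isCompact_Icc
  have hint' : ∀ g : ℝ → ℝ, Continuous g → IntegrableOn g (Icc α β) :=
    fun g hg => hg.continuousOn.integrableOn_Icc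
  obtain ⟨χ₀, hχ₀s, hχ₀c, hχ₀, hχ₀r, hχ₀1⟩ := exists_contDiff_tsupport_subset (n := ⊤)
    (Ioo_mem_nhds (left_lt_add_div_two.2 hαβ) (add_div_two_lt_right.2 hαβ) :
      Ioo α β ∈ 𝓝 ((α + β) / 2))
  have hpos : 0 < ∫ x in Icc α β, χ₀ x := by
    rw [setIntegral_Icc_eq_interval hαβ.le]
    refine intervalIntegral.integral_pos hαβ hχ₀.continuous.continuousOn
      (fun x _ => (hχ₀r (mem_range_self x)).1)
      ⟨(α + β) / 2, ⟨(left_lt_add_div_two.2 hαβ).le, (add_div_two_lt_right.2 hαβ).le⟩, ?_⟩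
    rw [hχ₀1]; exact one_pos
  set I := ∫ x in Icc α β, χ₀ x with hI
  refine ⟨(∫ x in Icc α β, v x * χ₀ x) / I, ?_⟩
  -- The constant is the mean of v weighted by the bump `χ₀`.
  set c := (∫ x in Icc α β, v x * χ₀ x) / I with hc
  have key : ∀ η : ℝ → ℝ, ContDiff ℝ ∞ η → HasCompactSupport η → tsupport η ⊆ Ioo α β →
      ∫ x, η x • (v x - c) = 0 := by
    intro η hη hηc hηs
    set J := ∫ x in Icc α β, η x with hJ
    -- Subtracting a multiple of the bump makes the integral zero, so that the primitive of `ρ` is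
    -- again a test function.
    set ρ : ℝ → ℝ := fun x => η x - J / I * χ₀ x with hρ
    have hρd : ContDiff ℝ ∞ ρ := hη.sub (contDiff_const.mul hχ₀)
    set K := tsupport η ∪ tsupport χ₀ with hK
    have hKc : IsCompact K := hηc.isCompact.union hχ₀c.isCompact
    have hKne : K.Nonempty := ⟨(α + β) / 2, Or.inr (subset_tsupport _ (by simp [hχ₀1]))⟩
    have hKs : K ⊆ Ioo α β := union_subset hηs hχ₀s
    obtain ⟨a, haK, ha⟩ := hKc.exists_isLeast hKne
    obtain ⟨b, hbK, hb⟩ := hKc.exists_isGreatest hKne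
    have hρ0 : ∀ x, x ∉ K → ρ x = 0 := fun x hx => by
      rw [hρ]
      simp only
      rw [image_eq_zero_of_notMem_tsupport fun h' => hx (Or.inl h'),
        image_eq_zero_of_notMem_tsupport fun h' => hx (Or.inr h')]
      simp
    have hρi : ∫ x in α..β, ρ x = 0 := by
      rw [← setIntegral_Icc_eq_interval hαβ.le, hρ,
        integral_sub (hint' _ hη.continuous) ((hint' _ hχ₀.continuous).const_mul _),
        integral_const_mul, ← hI, ← hJ, div_mul_cancel₀ _ hpos.ne', sub_self]
    set θ : ℝ → ℝ := fun x => ∫ s in α..x, ρ s with hθ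
    have hθd : ∀ x, HasDerivAt θ (ρ x) x := fun x =>
      (hρd.continuous.integral_hasStrictDerivAt α x).hasDerivAt
    have hθderiv : deriv θ = ρ := funext fun x => (hθd x).deriv
    have hθsm : ContDiff ℝ ∞ θ :=
      contDiff_infty_iff_deriv.2 ⟨fun x => (hθd x).differentiableAt, hθderiv ▸ hρd⟩
    -- Left of `a` nothing has been integrated yet; right of `b` the primitive equals the total
    -- integral, zero.
    have hθs : tsupport θ ⊆ Icc a b := by
      refine closure_minimal (fun x hx => ?_) isClosed_Icc
      by_contra hx'
      refine hx ?_
      rw [mem_Icc, not_and_or, not_le, not_le] at hx'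
      have hz : ∀ u w : ℝ, (∀ s ∈ uIcc u w, s ∉ K) → ∫ s in u..w, ρ s = 0 := fun u w huw => by
        rw [intervalIntegral.integral_congr (g := fun _ => 0) fun s hs => hρ0 s (huw s hs)]
        simp
      rcases hx' with hx' | hx'
      · refine hz α x fun s hs hsK => ?_
        have := hs.2
        rcases max_cases α x with ⟨h₁, -⟩ | ⟨h₁, -⟩
        · linarith [ha hsK, (hKs haK).1]
        · linarith [ha hsK]
      · have h₁ : θ x + ∫ s in x..β, ρ s = 0 := by
          rw [hθ, ← hρi]
          exact intervalIntegral.integral_add_adjacent_intervals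
            (hρd.continuous.intervalIntegrable _ _) (hρd.continuous.intervalIntegrable _ _)
        rw [hz x β fun s hs hsK => ?_, add_zero] at h₁
        · exact h₁
        · have := hs.1
          rcases min_cases x β with ⟨h₁, -⟩ | ⟨h₁, -⟩
          · linarith [hb hsK]
          · linarith [hb hsK, (hKs hbK).2]
    have hfin := h θ hθsm (isCompact_Icc.of_isClosed_subset (isClosed_tsupport _) hθs)
      (hθs.trans fun x hx => ⟨(hKs haK).1.trans_le hx.1, hx.2.trans_lt (hKs hbK).2⟩)
    rw [hθderiv] at hfin
    have e₁ : ∫ x, η x • (v x - c) = ∫ x in Icc α β, η x • (v x - c) := by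
      refine (setIntegral_eq_integral_of_forall_compl_eq_zero fun x hx => ?_).symm
      rw [test_eq_zero hηs fun h' => hx (Ioo_subset_Icc_self h'), zero_smul]
    have e₂ : (fun x => η x • (v x - c)) = fun x => v x * η x - c * η x := by
      ext x; simp only [smul_eq_mul]; ring
    have e₃ : (fun x => v x * ρ x) = fun x => v x * η x - J / I * (v x * χ₀ x) := by
      ext x; simp only [hρ]; ring
    rw [e₃, integral_sub (hint _ hη.continuous) ((hint _ hχ₀.continuous).const_mul _),
      integral_const_mul] at hfin
    rw [e₁, e₂, integral_sub (hint _ hη.continuous) ((hint' _ hη.continuous).const_mul _),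
      integral_const_mul, ← hJ, hc, ← hfin]
    ring
  have hloc : LocallyIntegrableOn (fun x => v x - c) (Ioo α β) := by
    refine IntegrableOn.locallyIntegrableOn ?_
    exact (hv.sub (integrableOn_const (by simp))).mono_set Ioo_subset_Icc_self
  have := isOpen_Ioo.ae_eq_zero_of_integral_contDiff_smul_eq_zero hloc key
  rw [← ae_restrict_iff' measurableSet_Ioo, Measure.restrict_congr_set Ioo_ae_eq_Icc] at this
  filter_upwards [this] with x hx
  linarith

/-- Functions in `H¹` have a continuous representative. -/
theorem MemHk.exists_continuous (hαβ : α < β) {u : ℝ → ℝ} (hu : MemHk 1 α β u) :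
    ∃ F : ℝ → ℝ, Continuous F ∧ u =ᵐ[volume.restrict (Icc α β)] F := by
  obtain ⟨D, hu2, hD⟩ := hu
  obtain ⟨hg2, hg⟩ := hD 1 le_rfl
  have hui : IntegrableOn u (Icc α β) := hu2.integrable (by norm_num)
  have hgi : IntegrableOn (D 1) (Icc α β) := hg2.integrable (by norm_num)
  have hgI : IntervalIntegrable (D 1) volume α β :=
    (intervalIntegrable_iff_integrableOn_Icc_of_le hαβ.le).2 hgi
  -- The primitive of the weak derivative is absolutely continuous; u - G has zero weak derivative
  -- and is therefore constant.
  set G : ℝ → ℝ := fun x => ∫ s in α..x, D 1 s with hG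
  have hGc : ContinuousOn G (Icc α β) := by
    have := intervalIntegral.continuousOn_primitive_interval (f := D 1) (μ := volume)
      (a := α) (b := β)
      (by rwa [uIcc_of_le hαβ.le])
    rwa [uIcc_of_le hαβ.le] at this
  obtain ⟨c, hc⟩ := ae_eq_const_of_integral_mul_deriv_eq_zero hαβ (v := fun x => u x - G x)
    (hui.sub hGc.integrableOn_Icc) fun θ hθ hθc hθs => by
      have h₁ := hg θ hθ hθc hθs
      rw [iteratedDeriv_one] at h₁
      have hθ' : Continuous (deriv θ) := (contDiff_infty_iff_deriv.1 hθ).2.continuous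
      have hac : AbsolutelyContinuousOnInterval θ α β := by
        obtain ⟨K, hK⟩ := (hθ.of_le
          (by simp : (1 : WithTop ℕ∞) ≤ ∞)).lipschitzWith_of_hasCompactSupport hθc (by simp)
        exact (hK.lipschitzOnWith (s := uIcc α β)).absolutelyContinuousOnInterval
      have h₂ := (hgI.absolutelyContinuousOnInterval_intervalIntegral
        (c := α) (by simp)).integral_mul_deriv_eq_deriv_mul hac
      rw [test_eq_zero hθs (by simp : β ∉ Ioo α β), test_eq_zero hθs (by simp : α ∉ Ioo α β),
        intervalIntegral.integral_congr_ae (a := α) (b := β)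
          (f := fun x => deriv (fun x => ∫ v in α..x, D 1 v) x * θ x) (g := fun x => D 1 x * θ x),
        ← setIntegral_Icc_eq_interval hαβ.le (fun x => D 1 x * θ x),
        ← setIntegral_Icc_eq_interval hαβ.le (fun x => (∫ v in α..x, D 1 v) * deriv θ x)] at h₂
      · have hi : IntegrableOn (fun x => G x * deriv θ x) (Icc α β) :=
          (hGc.mul hθ'.continuousOn).integrableOn_Icc
        simp only [sub_mul]
        rw [integral_sub (hui.mul_continuousOn hθ'.continuousOn isCompact_Icc) hi, h₁, hG, h₂]
        ring
      · filter_upwards [hgI.ae_hasDerivAt_integral] with x hx hx'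
        rw [(hx (uIoc_subset_uIcc hx') α (by simp)).deriv]
  refine ⟨fun x => IccExtend hαβ.le ((Icc α β).domRestrict G) x + c,
    (continuousOn_iff_continuous_domRestrict.1 hGc).Icc_extend'.add continuous_const, ?_⟩
  filter_upwards [hc, ae_restrict_Icc_mem] with x hx hx'
  rw [IccExtend_of_mem _ _ hx', domRestrict_apply]
  linarith

end WeakDerivatives

/-! ### Linear independence of univariate B-splines on an interval. -/

section SplineIndependence

/-- The coefficient of `(τⱼ - x)₊ ^ p` in the B-spline on the knots `τ`. -/
noncomputable def bsplineCoeff (p : ℕ) (τ : Fin (p + 2) → ℝ) (j : Fin (p + 2)) : ℝ :=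
  (τ (Fin.last (p + 1)) - τ 0) / ∏ l ∈ Finset.univ.erase j, (τ j - τ l)

/-- The index in a vector of `n` knots of the `j`-th knot of the `i`-th B-spline. -/
def knotIndex {n p : ℕ} (i : Fin (n - (p + 1))) (j : Fin (p + 2)) : Fin n :=
  ⟨i + j, by have := i.2; have := j.2; omega⟩

theorem bspline_eq {n : ℕ} (p : ℕ) (τ : Fin n → ℝ) (i : Fin (n - (p + 1))) (x : ℝ) :
    bspline p τ i x =
      ∑ j, bsplineCoeff p (fun j => τ (knotIndex i j)) j * truncPow p x (τ (knotIndex i j)) := by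
  simp only [bspline, bsplineFunctor, dividedDiff, bsplineCoeff, Finset.mul_sum]
  refine Finset.sum_congr rfl fun j _ => ?_
  simp only [knotIndex]
  ring

theorem bsplineCoeff_ne_zero {p : ℕ} {τ : Fin (p + 2) → ℝ} (hτ : Function.Injective τ)
    (j : Fin (p + 2)) : bsplineCoeff p τ j ≠ 0 := by
  refine div_ne_zero (sub_ne_zero.2 (hτ.ne ?_)) (Finset.prod_ne_zero_iff.2 fun l hl => ?_)
  · simp [Fin.ext_iff]
  · exact sub_ne_zero.2 (hτ.ne (Finset.ne_of_mem_erase hl).symm)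

theorem knotIndex_injective {n p : ℕ} (i : Fin (n - (p + 1))) :
    Function.Injective (knotIndex i : Fin (p + 2) → Fin n) := fun a b h => by
  simp only [knotIndex, Fin.mk.injEq] at h
  exact Fin.ext (by omega)

open Polynomial in
-- A divided difference over p + 2 nodes is the coefficient of degree p + 1 of the interpolating
-- polynomial, and so kills polynomials of degree p.
theorem sum_bsplineCoeff_mul_pow {p : ℕ} {τ : Fin (p + 2) → ℝ} (hτ : Function.Injective τ)
    (x : ℝ) : ∑ j, bsplineCoeff p τ j * (τ j - x) ^ p = 0 := by
  have hdeg : ((X - C x) ^ p : ℝ[X]).natDegree = p := by simp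
  have hP : ((X - C x) ^ p : ℝ[X]).degree < (Finset.univ : Finset (Fin (p + 2))).card := by
    refine degree_le_natDegree.trans_lt ?_
    rw [hdeg]
    simp only [Finset.card_univ, Fintype.card_fin]
    exact_mod_cast (by omega : p < p + 2)
  have h := Lagrange.coeff_eq_sum (hτ.injOn (s := ↑(Finset.univ : Finset (Fin (p + 2))))) hP
  rw [coeff_eq_zero_of_natDegree_lt (by rw [hdeg]; simp)] at h
  simp only [eval_pow, eval_sub, eval_X, eval_C] at h
  calc ∑ j, bsplineCoeff p τ j * (τ j - x) ^ p
      = (τ (Fin.last (p + 1)) - τ 0) *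
        ∑ j, (τ j - x) ^ p / ∏ l ∈ Finset.univ.erase j, (τ j - τ l) := by
        rw [Finset.mul_sum]
        refine Finset.sum_congr rfl fun j _ => ?_
        rw [bsplineCoeff]; ring
    _ = 0 := by rw [← h, mul_zero]

/-- The coefficients in truncated powers of a combination of B-splines. -/
noncomputable def truncCoeff {n : ℕ} (p : ℕ) (τ : Fin n → ℝ) (c : Fin (n - (p + 1)) → ℝ)
    (m : Fin n) : ℝ :=
  ∑ i, ∑ j : Fin (p + 2),
    if knotIndex i j = m then c i * bsplineCoeff p (fun j => τ (knotIndex i j)) j else 0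

/-- Regrouping by knots for arbitrary `g`: it is applied both to truncated powers and to full
powers, which ties the spline to the polynomial identity below. -/
theorem sum_truncCoeff_mul {n : ℕ} (p : ℕ) (τ : Fin n → ℝ) (c : Fin (n - (p + 1)) → ℝ)
    (g : ℝ → ℝ) : ∑ m, truncCoeff p τ c m * g (τ m) =
      ∑ i, c i * ∑ j, bsplineCoeff p (fun j => τ (knotIndex i j)) j * g (τ (knotIndex i j)) := by
  simp only [truncCoeff, Finset.sum_mul, Finset.mul_sum]
  rw [Finset.sum_comm]
  refine Finset.sum_congr rfl fun i _ => ?_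
  rw [Finset.sum_comm]
  refine Finset.sum_congr rfl fun j _ => ?_
  simp only [ite_mul, zero_mul, Finset.sum_ite_eq, Finset.mem_univ, if_true]
  ring

theorem sum_mul_bspline {n : ℕ} (p : ℕ) (τ : Fin n → ℝ) (c : Fin (n - (p + 1)) → ℝ) (x : ℝ) :
    ∑ i, c i * bspline p τ i x = ∑ m, truncCoeff p τ c m * truncPow p x (τ m) := by
  rw [sum_truncCoeff_mul p τ c (truncPow p x)]
  simp only [bspline_eq]

theorem sum_truncCoeff_mul_pow {n : ℕ} (p : ℕ) {τ : Fin n → ℝ} (hτ : Function.Injective τ)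
    (c : Fin (n - (p + 1)) → ℝ) (x : ℝ) : ∑ m, truncCoeff p τ c m * (τ m - x) ^ p = 0 := by
  rw [sum_truncCoeff_mul p τ c fun y => (y - x) ^ p]
  refine Finset.sum_eq_zero fun i _ => ?_
  rw [sum_bsplineCoeff_mul_pow (τ := fun j => τ (knotIndex i j))
    (hτ.comp (knotIndex_injective i)), mul_zero]

/-- The system is triangular: the knot of index k belongs only to B-splines of index at most k, and
it is the first knot of the k-th one, where the coefficient is nonzero. -/
theorem eq_zero_of_truncCoeff_eq_zero {n : ℕ} {p : ℕ} {τ : Fin n → ℝ}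
    (hτ : Function.Injective τ) {c : Fin (n - (p + 1)) → ℝ} (h : ∀ m, truncCoeff p τ c m = 0) :
    c = 0 := by
  have key : ∀ (k : ℕ) (hk : k < n - (p + 1)), c ⟨k, hk⟩ = 0 := by
    intro k
    induction k using Nat.strong_induction_on with
    | _ k ih =>
      intro hk
      have h₁ := h (knotIndex ⟨k, hk⟩ 0)
      rw [truncCoeff, Finset.sum_eq_single ⟨k, hk⟩, Finset.sum_eq_single 0] at h₁
      · rw [if_pos rfl] at h₁
        exact (mul_eq_zero.1 h₁).resolve_right
          (bsplineCoeff_ne_zero (hτ.comp (knotIndex_injective ⟨k, hk⟩)) 0)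
      · intro j _ hj
        rw [if_neg fun h' => hj (knotIndex_injective _ h')]
      · simp
      · intro i _ hi
        refine Finset.sum_eq_zero fun j _ => ?_
        split_ifs with h₂
        · simp only [knotIndex, Fin.mk.injEq, Fin.val_zero, add_zero] at h₂
          have hik : (i : ℕ) < k := by
            have : (i : ℕ) ≠ k := fun h' => hi (Fin.ext h')
            omega
          rw [ih i hik i.2, zero_mul]
        · rfl
      · simp
  exact funext fun i => key i i.2

open Polynomial in
/-- At most `p + 1` powers `(Tⱼ - x) ^ p` with distinct nodes are linearly independent. -/
theorem eq_zero_of_sum_mul_pow_eq_zero {J : Type*} {S : Finset J} {T e : J → ℝ} {p : ℕ}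
    (hT : InjOn T S) (hS : S.card ≤ p + 1) {A : Set ℝ} (hA : A.Infinite)
    (h : ∀ x ∈ A, ∑ j ∈ S, e j * (T j - x) ^ p = 0) : ∀ j ∈ S, e j = 0 := by
  classical
  have hpoly : (∑ j ∈ S, C (e j) * (X + C (-T j)) ^ p : ℝ[X]) = 0 := by
    refine eq_zero_of_infinite_isRoot _ (hA.mono fun x hx => ?_)
    simp only [IsRoot.def, mem_ofPred_eq, eval_finsetSum, eval_mul, eval_C, eval_pow,
      eval_add, eval_X]
    have := h x hx
    have e₁ : ∀ j, e j * (x + -T j) ^ p = (-1) ^ p * (e j * (T j - x) ^ p) := fun j => by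
      rw [show x + -T j = (-1) * (T j - x) by ring, mul_pow]; ring
    simp only [e₁]
    rw [← Finset.mul_sum, this, mul_zero]
  -- Comparison of the coefficients of x ^ (p - l), whose binomial factors do not vanish.
  have hmom : ∀ l ≤ p, ∑ j ∈ S, e j * (-T j) ^ l = 0 := fun l hl => by
    have h₁ := congrArg (fun q => q.coeff (p - l)) hpoly
    simp only [finsetSum_coeff, coeff_C_mul, coeff_X_add_C_pow, coeff_zero] at h₁
    rw [Nat.sub_sub_self hl] at h₁
    simp only [← mul_assoc] at h₁
    rw [← Finset.sum_mul] at h₁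
    exact (mul_eq_zero.1 h₁).resolve_right
      (by exact_mod_cast (Nat.choose_pos (Nat.sub_le p l)).ne')
  intro j hj
  -- This polynomial vanishes at all nodes but the j-th and has degree at most p, so the moments
  -- determine `e j`.
  set P : ℝ[X] := ∏ i ∈ S.erase j, (X - C (-T i)) with hP
  have hPdeg : P.natDegree < p + 1 := by
    rw [hP, natDegree_prod_of_monic _ _ fun i _ => monic_X_sub_C _]
    simp only [natDegree_X_sub_C, Finset.sum_const, smul_eq_mul, mul_one]
    rw [Finset.card_erase_of_mem hj]
    have := Finset.card_pos.2 ⟨j, hj⟩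
    omega
  have hsum : ∑ i ∈ S, e i * P.eval (-T i) = 0 := by
    simp only [eval_eq_sum_range' hPdeg, Finset.mul_sum]
    rw [Finset.sum_comm]
    refine Finset.sum_eq_zero fun l hl => ?_
    have := hmom l (Nat.lt_succ_iff.1 (Finset.mem_range.1 hl))
    calc ∑ i ∈ S, e i * (P.coeff l * (-T i) ^ l) = P.coeff l * ∑ i ∈ S, e i * (-T i) ^ l := by
          rw [Finset.mul_sum]; exact Finset.sum_congr rfl fun i _ => by ring
      _ = 0 := by rw [this, mul_zero]
  rw [Finset.sum_eq_single_of_mem j hj] at hsum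
  · refine (mul_eq_zero.1 hsum).resolve_right ?_
    rw [hP, eval_prod]
    refine Finset.prod_ne_zero_iff.2 fun i hi => ?_
    simp only [eval_sub, eval_X, eval_C, sub_neg_eq_add]
    have := hT.ne (Finset.mem_of_mem_erase hi) hj (Finset.ne_of_mem_erase hi)
    intro h'
    exact this (by linarith)
  · intro i hi hij
    rw [hP, eval_prod, Finset.prod_eq_zero (Finset.mem_erase.2 ⟨hij, hi⟩) (by simp), mul_zero]

open Polynomial in
/-- A combination of truncated powers with distinct nodes that vanishes on an interval has zero
coefficients at the interior nodes. -/
theorem eq_zero_of_sum_truncPow_eq_zero {J : Type*} [Fintype J] {T e : J → ℝ} {p : J → ℕ}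
    (hT : Function.Injective T) {α β : ℝ}
    (h : ∀ x ∈ Ico α β, ∑ j, e j * truncPow (p j) x (T j) = 0) {j₀ : J}
    (hj₀ : T j₀ ∈ Ioo α β) : e j₀ = 0 := by
  classical
  -- Just right of the node the combination equals the polynomial `q`, which is thus zero; just left
  -- of it only the term of `j₀` is added. The exponents may differ from node to node, as patches of
  -- different degrees require.
  set q : ℝ[X] := ∑ j ∈ Finset.univ.filter (fun j => T j₀ < T j), C (e j) * (C (T j) - X) ^ p j
    with hq
  have hqe : ∀ x, q.eval x =
      ∑ j ∈ Finset.univ.filter (fun j => T j₀ < T j), e j * (T j - x) ^ p j := fun x => by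
    simp [hq, eval_finsetSum]
  have hR : ∀ᶠ x in 𝓝[>] (T j₀), q.IsRoot x := by
    have h₁ : ∀ᶠ x in 𝓝[>] (T j₀), ∀ j, T j₀ < T j → x < T j := by
      rw [eventually_all]
      intro j
      by_cases hj : T j₀ < T j
      · filter_upwards [mem_nhdsWithin_of_mem_nhds (gt_mem_nhds hj)] with x hx _ using hx
      · exact Eventually.of_forall fun x h' => absurd h' hj
    filter_upwards [h₁, self_mem_nhdsWithin, mem_nhdsWithin_of_mem_nhds (gt_mem_nhds hj₀.2)]
      with x hx hx' hxβ
    rw [IsRoot.def, hqe, ← h x ⟨(hj₀.1.trans hx').le, hxβ⟩, Finset.sum_filter]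
    refine Finset.sum_congr rfl fun j _ => ?_
    split_ifs with hj
    · rw [truncPow, if_pos (hx j hj)]
    · rw [truncPow, if_neg (not_lt.2 ((not_lt.1 hj).trans (le_of_lt hx'))), mul_zero]
  have hq0 : q = 0 := by
    obtain ⟨u, hu, hu'⟩ := mem_nhdsGT_iff_exists_Ioo_subset.1 hR
    exact eq_zero_of_infinite_isRoot q ((Ioo_infinite hu).mono hu')
  have hL : ∀ᶠ x in 𝓝[<] (T j₀), e j₀ * (T j₀ - x) ^ p j₀ = 0 := by
    have h₁ : ∀ᶠ x in 𝓝[<] (T j₀), ∀ j, T j < T j₀ → T j < x := by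
      rw [eventually_all]
      intro j
      by_cases hj : T j < T j₀
      · filter_upwards [mem_nhdsWithin_of_mem_nhds (lt_mem_nhds hj)] with x hx _ using hx
      · exact Eventually.of_forall fun x h' => absurd h' hj
    filter_upwards [h₁, self_mem_nhdsWithin, mem_nhdsWithin_of_mem_nhds (lt_mem_nhds hj₀.1)]
      with x hx hx' hxα
    have h₂ := h x ⟨hxα.le, lt_trans hx' hj₀.2⟩
    have h₃ : ∑ j, e j * truncPow (p j) x (T j) = e j₀ * (T j₀ - x) ^ p j₀ + q.eval x := by
      rw [hqe, ← Finset.add_sum_erase _ _ (Finset.mem_univ j₀), truncPow,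
        if_pos (show x < T j₀ from hx')]
      congr 1
      rw [Finset.sum_filter, ← Finset.sum_erase (a := j₀) Finset.univ (by simp)]
      refine Finset.sum_congr rfl fun j hj => ?_
      have hne : T j ≠ T j₀ := hT.ne (Finset.ne_of_mem_erase hj)
      split_ifs with hj'
      · rw [truncPow, if_pos (lt_trans hx' hj')]
      · have := hx j (lt_of_le_of_ne (not_lt.1 hj') hne)
        rw [truncPow, if_neg this.not_gt, mul_zero]
    rw [h₃, hq0, eval_zero, add_zero] at h₂
    exact h₂
  obtain ⟨x, hx, hx'⟩ := (hL.and self_mem_nhdsWithin).exists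
  exact (mul_eq_zero.1 hx).resolve_right (pow_ne_zero _ (sub_ne_zero.2 (ne_of_gt hx')))

/-- B-splines with at most `p + 1` knots outside the open interval, in the presence of other
B-splines with different knots. -/
theorem bspline_coeff_eq_zero_of_anchored {R : Type*} [Fintype R] {n p : R → ℕ}
    {τ : (s : R) → Fin (n s) → ℝ}
    (hτ : Function.Injective fun q : (s : R) × Fin (n s) => τ q.1 q.2) {α β : ℝ}
    {c : (s : R) → Fin (n s - (p s + 1)) → ℝ}
    (h : ∀ x ∈ Ico α β, ∑ s, ∑ i, c s i * bspline (p s) (τ s) i x = 0) {s₀ : R}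
    (hs₀ : {m | τ s₀ m ∉ Ioo α β}.ncard ≤ p s₀ + 1) : c s₀ = 0 := by
  classical
  have hτ₀ : Function.Injective (τ s₀) := fun a b hab => by
    have := @hτ ⟨s₀, a⟩ ⟨s₀, b⟩ hab
    simpa using this
  have hint : ∀ m, τ s₀ m ∈ Ioo α β → truncCoeff (p s₀) (τ s₀) (c s₀) m = 0 := fun m hm =>
    eq_zero_of_sum_truncPow_eq_zero (J := (s : R) × Fin (n s)) (T := fun q => τ q.1 q.2)
      (e := fun q => truncCoeff (p q.1) (τ q.1) (c q.1) q.2) (p := fun q => p q.1) hτ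
      (j₀ := ⟨s₀, m⟩) (fun x hx => by
        rw [Fintype.sum_sigma, ← h x hx]
        exact Finset.sum_congr rfl fun s _ => (sum_mul_bspline (p s) (τ s) (c s) x).symm) hm
  refine eq_zero_of_truncCoeff_eq_zero hτ₀ fun m => ?_
  by_cases hm : τ s₀ m ∈ Ioo α β
  · exact hint m hm
  -- The identity for full powers holds for all real x and involves the patch `s₀` alone, so the
  -- exterior nodes of the other patches do no harm.
  refine eq_zero_of_sum_mul_pow_eq_zero (S := Finset.univ.filter fun m => τ s₀ m ∉ Ioo α β)
    (T := τ s₀) (p := p s₀) hτ₀.injOn ?_ infinite_univ (fun x _ => ?_) m (by simpa using hm)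
  · rw [← Set.ncard_coe_finset]
    simpa using hs₀
  · rw [← sum_truncCoeff_mul_pow (p s₀) hτ₀ (c s₀) x, Finset.sum_filter]
    refine Finset.sum_congr rfl fun i _ => ?_
    split_ifs with hi
    · rw [hint i hi, zero_mul]
    · rfl

/-- B-splines whose supports meet the interval are linearly independent on it. -/
theorem bspline_coeff_eq_zero {n p : ℕ} {τ : Fin n → ℝ} (hτ : StrictMono τ) {α β : ℝ}
    (hαβ : α < β) (hα : ∀ i : Fin n, (i : ℕ) = p → α ≤ τ i)
    (hβ : ∀ i : Fin n, (i : ℕ) + p + 1 = n → τ i ≤ β) (hn : p + 2 ≤ n)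
    {c : Fin (n - (p + 1)) → ℝ} (h : ∀ x ∈ Ico α β, ∑ i, c i * bspline p τ i x = 0) : c = 0 := by
  classical
  simp only [sum_mul_bspline] at h
  set d := truncCoeff p τ c with hd
  have hint : ∀ m, τ m ∈ Ioo α β → d m = 0 := fun m hm =>
    eq_zero_of_sum_truncPow_eq_zero (p := fun _ => p) hτ.injective h hm
  have hcard : ∀ (S : Finset (Fin n)) (a : ℕ), (∀ m ∈ S, a ≤ (m : ℕ) ∧ (m : ℕ) < a + (p + 1)) →
      S.card ≤ p + 1 := fun S a hS => by
    rw [← Finset.card_map Fin.valEmbedding]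
    refine (Finset.card_le_card (t := Finset.Ico a (a + (p + 1))) fun k hk => ?_).trans (by simp)
    obtain ⟨m, hm, rfl⟩ := Finset.mem_map.1 hk
    exact Finset.mem_Ico.2 (hS m hm)
  -- Knots at or beyond β have index at least n - p - 1, so there are at most p + 1; on the interval
  -- their truncated powers are full powers.
  have hup : ∀ m, β ≤ τ m → d m = 0 := fun m hm =>
    eq_zero_of_sum_mul_pow_eq_zero (S := Finset.univ.filter fun m => β ≤ τ m) (p := p)
      hτ.injective.injOn (hcard _ (n - (p + 1)) fun m hm => by
        rw [Finset.mem_filter] at hm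
        have h₁ := hm.2
        have := m.2
        refine ⟨?_, by omega⟩
        by_contra hlt
        have h₂ : τ m < τ ⟨n - (p + 1), by omega⟩ := hτ (Fin.lt_def.2 (not_le.1 hlt))
        have := hβ ⟨n - (p + 1), by omega⟩ (by simp only; omega)
        linarith) (Ioo_infinite hαβ) (fun x hx => by
        rw [← h x ⟨hx.1.le, hx.2⟩, Finset.sum_filter]
        refine Finset.sum_congr rfl fun i _ => ?_
        split_ifs with hi
        · rw [truncPow, if_pos (hx.2.trans_le hi)]
        · by_cases hi' : α < τ i
          · rw [hint i ⟨hi', not_le.1 hi⟩, zero_mul]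
          · rw [truncPow, if_neg (not_lt.2 ((not_lt.1 hi').trans hx.1.le)), mul_zero]) m
      (by simpa using hm)
  refine eq_zero_of_truncCoeff_eq_zero hτ.injective fun m => ?_
  rw [← hd]
  rcases le_or_gt β (τ m) with hm | hm
  · exact hup m hm
  rcases lt_or_ge α (τ m) with hm' | hm'
  · exact hint m ⟨hm', hm⟩
  -- The remaining knots, at most p + 1, lie at or left of α and are invisible on the interval; only
  -- the identity for full powers reaches them.
  refine eq_zero_of_sum_mul_pow_eq_zero (S := Finset.univ.filter fun m => τ m ≤ α) (p := p)
    hτ.injective.injOn (hcard _ 0 fun m hm => ?_) infinite_univ (fun x _ => ?_) m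
    (by simpa using hm')
  · rw [Finset.mem_filter] at hm
    have h₁ := hm.2
    refine ⟨Nat.zero_le _, ?_⟩
    by_contra hlt
    have h₂ : τ ⟨p, by omega⟩ < τ m := hτ (Fin.lt_def.2 (by simp only; omega))
    have := hα ⟨p, by omega⟩ rfl
    linarith
  · rw [← sum_truncCoeff_mul_pow p hτ.injective c x, Finset.sum_filter]
    refine Finset.sum_congr rfl fun i _ => ?_
    split_ifs with hi
    · rfl
    · rw [← hd]
      rcases le_or_gt β (τ i) with hi' | hi'
      · rw [hup i hi', zero_mul]
      · rw [hint i ⟨not_le.1 hi, hi'⟩, zero_mul]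

end SplineIndependence

/-! ### Linear independence of tensor products. -/

section Tensor

/-- Splitting one coordinate of a sum over multi-indices. -/
theorem sum_mul_prod_split {D : Type*} [Fintype D] [DecidableEq D] {I : D → Type*}
    [∀ t, Fintype (I t)] [∀ t, DecidableEq (I t)] (w : (∀ t, I t) → ℝ)
    (f : (t : D) → I t → ℝ) (t₀ : D) :
    ∑ i, w i * ∏ t, f t (i t) =
      ∑ b, (∑ i, if i t₀ = b then w i * ∏ t ∈ Finset.univ.erase t₀, f t (i t) else 0) *
        f t₀ b := by
  simp only [Finset.sum_mul]
  rw [Finset.sum_comm]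
  refine Finset.sum_congr rfl fun i _ => ?_
  simp only [ite_mul, zero_mul, Finset.sum_ite_eq, Finset.mem_univ, if_true]
  rw [← Finset.mul_prod_erase _ _ (Finset.mem_univ t₀)]
  ring

/-- Tensor products of linearly independent families are linearly independent. -/
theorem tensor_coeff_eq_zero {D : Type*} [Fintype D] [DecidableEq D] {I : D → Type*}
    [∀ t, Fintype (I t)] [∀ t, DecidableEq (I t)] {S : D → Set ℝ} (hS : ∀ t, (S t).Nonempty)
    {g : (t : D) → I t → ℝ → ℝ}
    (hg : ∀ t (c : I t → ℝ), (∀ x ∈ S t, ∑ i, c i * g t i x = 0) → c = 0)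
    {w : (∀ t, I t) → ℝ}
    (h : ∀ x : D → ℝ, (∀ t, x t ∈ S t) → ∑ i, w i * ∏ t, g t (i t) (x t) = 0) : w = 0 := by
  funext a
  -- In the directions of `T` evaluation at x is replaced by the coordinate functional of `a`; when
  -- `T` contains every direction the sum is `w a`.
  have key : ∀ (T : Finset D) (x : D → ℝ), (∀ t, x t ∈ S t) →
      ∑ i, w i * ∏ t, (if t ∈ T then (if i t = a t then 1 else 0) else g t (i t) (x t)) = 0 := by
    intro T
    induction T using Finset.induction_on with
    | empty => simpa using h
    | insert t₀ T ht₀ ih =>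
      intro x hx
      have hc := hg t₀ (fun b => ∑ i, if i t₀ = b then w i * ∏ t ∈ Finset.univ.erase t₀,
        (if t ∈ T then (if i t = a t then 1 else 0) else g t (i t) (x t)) else 0) fun y hy => by
          have h₁ := ih (Function.update x t₀ y) fun t => by
            by_cases ht : t = t₀
            · subst ht; simpa using hy
            · simpa [Function.update_of_ne ht] using hx t
          rw [sum_mul_prod_split w (fun t j => if t ∈ T then (if j = a t then 1 else 0)
            else g t j (Function.update x t₀ y t)) t₀] at h₁
          refine Eq.trans (Finset.sum_congr rfl fun b _ => ?_) h₁
          simp only [ht₀, if_false, Function.update_self]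
          congr 1
          refine Finset.sum_congr rfl fun i _ => ?_
          congr 2
          refine Finset.prod_congr rfl fun t ht => ?_
          rw [Function.update_of_ne (Finset.ne_of_mem_erase ht)]
      have hca := congrFun hc (a t₀)
      simp only [Pi.zero_apply] at hca
      refine Eq.trans (Finset.sum_congr rfl fun i _ => ?_) hca
      rw [← Finset.mul_prod_erase _ _ (Finset.mem_univ t₀)]
      simp only [Finset.mem_insert_self, if_true]
      have e : ∏ t ∈ Finset.univ.erase t₀, (if t ∈ insert t₀ T then
          (if i t = a t then (1 : ℝ) else 0) else g t (i t) (x t)) =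
          ∏ t ∈ Finset.univ.erase t₀, (if t ∈ T then
          (if i t = a t then 1 else 0) else g t (i t) (x t)) :=
        Finset.prod_congr rfl fun t ht => by
          simp [Finset.mem_insert, Finset.ne_of_mem_erase ht]
      rw [e]
      split_ifs <;> simp
  choose x hx using hS
  have := key Finset.univ x hx
  simp only [Finset.mem_univ, if_true] at this
  rw [Finset.sum_eq_single a] at this
  · simpa using this
  · intro i _ hi
    obtain ⟨t, ht⟩ := Function.ne_iff.1 hi
    rw [Finset.prod_eq_zero (Finset.mem_univ t) (if_neg ht), mul_zero]
  · simp

end Tensor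

/-! ### Geometry of the component and independence of the tensor-product basis. -/

section Patch

variable {d r : ℕ} {Q : Patches d r}

namespace Patches

theorem knots_add_le {ξ : Q.KnotSpace} (hξ : ξ ∈ Q.admissible) (s : Fin r) (t : Fin d)
    {i j : Fin (Q.N s t)} (hij : i < j) : Q.knots ξ s t i + Q.h ≤ Q.knots ξ s t j := by
  obtain ⟨k, hk⟩ : ∃ k, (j : ℕ) = i + 1 + k := ⟨j - (i + 1), by have := Fin.lt_def.1 hij; omega⟩
  induction k generalizing j with
  | zero => exact hξ.2.1 s t i j (by omega)
  | succ k ih =>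
    have hj := j.2
    have h₁ := @ih ⟨i + 1 + k, by omega⟩ (Fin.lt_def.2 (by simp only; omega)) rfl
    have h₂ := hξ.2.1 s t ⟨i + 1 + k, by omega⟩ j (by simp only; omega)
    linarith [Q.h_pos]

theorem strictMono_knots {ξ : Q.KnotSpace} (hξ : ξ ∈ Q.admissible) (s : Fin r) (t : Fin d) :
    StrictMono (Q.knots ξ s t) := fun i j hij => by
  linarith [knots_add_le hξ s t hij, Q.h_pos]

theorem knots_ne {ξ : Q.KnotSpace} (hξ : ξ ∈ Q.admissible) {s s' : Fin r} (t : Fin d)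
    (hs : s ≠ s') (i : Fin (Q.N s t)) (j : Fin (Q.N s' t)) :
    Q.knots ξ s t i ≠ Q.knots ξ s' t j := fun h => by
  have := hξ.2.2.1 s s' t hs i j
  rw [h, sub_self, abs_zero] at this
  linarith [Q.h_pos]

theorem injective_knots {ξ : Q.KnotSpace} (hξ : ξ ∈ Q.admissible) (t : Fin d) :
    Function.Injective fun q : (s : Fin r) × Fin (Q.N s t) => Q.knots ξ q.1 t q.2 := by
  rintro ⟨s, i⟩ ⟨s', j⟩ h
  by_cases hs : s = s'
  · subst hs
    exact congrArg (Sigma.mk s) ((strictMono_knots hξ s t).injective h)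
  · exact absurd h (knots_ne hξ t hs i j)

/-- The component is described by non-strict inequalities between affine functions. -/
theorem mem_component_iff {ξ₀ : Q.KnotSpace} (hξ₀ : ξ₀ ∈ Q.admissible) (ξ : Q.KnotSpace) :
    ξ ∈ Q.component ξ₀ ↔ (∀ s t i, Q.knots ξ s t i ∈ Icc (Q.ym t) (Q.yp t)) ∧
      (∀ s t, ∀ i j : Fin (Q.N s t), (j : ℕ) = i + 1 →
        Q.knots ξ s t i + Q.h ≤ Q.knots ξ s t j) ∧
      (∀ s s' t, s ≠ s' → ∀ i j, Q.knots ξ₀ s t i < Q.knots ξ₀ s' t j →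
        Q.knots ξ s t i + Q.h ≤ Q.knots ξ s' t j) ∧
      (∀ s t, ∀ i : Fin (Q.N s t), (i : ℕ) = Q.P s t → Q.xm t ≤ Q.knots ξ s t i) ∧
      (∀ s t, ∀ i : Fin (Q.N s t), (i : ℕ) + Q.P s t + 1 = Q.N s t →
        Q.knots ξ s t i ≤ Q.xp t) := by
  have hpos := Q.h_pos
  constructor
  · rintro ⟨hξ, hord⟩
    refine ⟨hξ.1, hξ.2.1, fun s s' t hs i j hij => ?_, hξ.2.2.2⟩
    have h₁ := (hord t s s' i j).2 hij
    have h₂ := hξ.2.2.1 s s' t hs i j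
    rw [abs_of_nonpos (by linarith)] at h₂
    linarith
  · rintro ⟨h₁, h₂, h₃, h₄⟩
    -- Knots of different patches are distinct at ξ₀, so one of the two orders holds there and is
    -- kept with gap h.
    have hdich : ∀ s s' t, s ≠ s' → ∀ i j,
        (Q.knots ξ₀ s t i < Q.knots ξ₀ s' t j ∧ Q.knots ξ s t i + Q.h ≤ Q.knots ξ s' t j) ∨
        (Q.knots ξ₀ s' t j < Q.knots ξ₀ s t i ∧ Q.knots ξ s' t j + Q.h ≤ Q.knots ξ s t i) := by
      intro s s' t hs i j
      rcases lt_or_gt_of_ne (knots_ne hξ₀ t hs i j) with h | h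
      · exact Or.inl ⟨h, h₃ s s' t hs i j h⟩
      · exact Or.inr ⟨h, h₃ s' s t hs.symm j i h⟩
    have hadm : ξ ∈ Q.admissible := by
      refine ⟨h₁, h₂, fun s s' t hs i j => ?_, h₄⟩
      rcases hdich s s' t hs i j with h | h
      · exact le_abs.2 (Or.inr (by linarith [h.2]))
      · exact le_abs.2 (Or.inl (by linarith [h.2]))
    refine ⟨hadm, fun t s s' i j => ?_⟩
    by_cases hs : s = s'
    · subst hs
      rw [(strictMono_knots hadm s t).lt_iff_lt, (strictMono_knots hξ₀ s t).lt_iff_lt]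
    · rcases hdich s s' t hs i j with h | h
      · exact ⟨fun _ => h.1, fun _ => by linarith [h.2]⟩
      · exact ⟨fun h' => by linarith [h.2], fun h' => absurd h' h.1.not_gt⟩

theorem knots_combo (ξ η : Q.KnotSpace) (a b : ℝ) (s : Fin r) (t : Fin d) (i : Fin (Q.N s t)) :
    Q.knots (a • ξ + b • η) s t i = a * Q.knots ξ s t i + b * Q.knots η s t i := rfl

theorem convex_component {ξ₀ : Q.KnotSpace} (hξ₀ : ξ₀ ∈ Q.admissible) :
    Convex ℝ (Q.component ξ₀) := by
  intro ξ hξ η hη a b ha hb hab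
  have hle : ∀ x y x' y' : ℝ, x ≤ y → x' ≤ y' → a * x + b * x' ≤ a * y + b * y' :=
    fun x y x' y' h h' =>
      add_le_add (mul_le_mul_of_nonneg_left h ha) (mul_le_mul_of_nonneg_left h' hb)
  have hc : ∀ z : ℝ, z = a * z + b * z := fun z => by rw [← add_mul, hab, one_mul]
  have hh : ∀ x y : ℝ, a * x + b * y + Q.h = a * (x + Q.h) + b * (y + Q.h) := fun x y => by
    linear_combination (-Q.h) * hab
  rw [mem_component_iff hξ₀] at hξ hη ⊢
  obtain ⟨h₁, h₂, h₃, h₄, h₅⟩ := hξ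
  obtain ⟨k₁, k₂, k₃, k₄, k₅⟩ := hη
  simp only [knots_combo]
  refine ⟨fun s t i => ⟨?_, ?_⟩, fun s t i j hij => ?_, fun s s' t hs i j hij => ?_,
    fun s t i hi => ?_, fun s t i hi => ?_⟩
  · rw [hc (Q.ym t)]; exact hle _ _ _ _ (h₁ s t i).1 (k₁ s t i).1
  · rw [hc (Q.yp t)]; exact hle _ _ _ _ (h₁ s t i).2 (k₁ s t i).2
  · rw [hh]; exact hle _ _ _ _ (h₂ s t i j hij) (k₂ s t i j hij)
  · rw [hh]; exact hle _ _ _ _ (h₃ s s' t hs i j hij) (k₃ s s' t hs i j hij)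
  · rw [hc (Q.xm t)]; exact hle _ _ _ _ (h₄ s t i hi) (k₄ s t i hi)
  · rw [hc (Q.xp t)]; exact hle _ _ _ _ (h₅ s t i hi) (k₅ s t i hi)

/-- One knot, as a continuous linear form. -/
noncomputable def knotCLM (Q : Patches d r) (s : Fin r) (t : Fin d) (i : Fin (Q.N s t)) :
    Q.KnotSpace →L[ℝ] ℝ :=
  EuclideanSpace.proj (⟨(s, t), i⟩ : (q : Fin r × Fin d) × Fin (Q.N q.1 q.2))

theorem continuous_knots (s : Fin r) (t : Fin d) (i : Fin (Q.N s t)) :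
    Continuous fun ξ => Q.knots ξ s t i := (Q.knotCLM s t i).continuous

theorem isCompact_component {ξ₀ : Q.KnotSpace} (hξ₀ : ξ₀ ∈ Q.admissible) :
    IsCompact (Q.component ξ₀) := by
  have hbox : IsCompact ((PiLp.homeomorph 2
      fun _ : (q : Fin r × Fin d) × Fin (Q.N q.1 q.2) => ℝ) ⁻¹'
      (Set.pi univ fun q => Icc (Q.ym q.1.2) (Q.yp q.1.2))) :=
    (Homeomorph.isCompact_preimage _).2 (isCompact_univ_pi fun q => isCompact_Icc)
  refine hbox.of_isClosed_subset ?_ fun ξ hξ => ?_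
  · have e : Q.component ξ₀ = {ξ | _} := Set.ext (mem_component_iff hξ₀)
    rw [e]
    simp only [mem_Icc, ofPred_and, ofPred_forall]
    refine IsClosed.inter ?_ (IsClosed.inter ?_ (IsClosed.inter ?_ (IsClosed.inter ?_ ?_)))
    · refine isClosed_iInter fun s => isClosed_iInter fun t => isClosed_iInter fun i => ?_
      exact (isClosed_le continuous_const (continuous_knots s t i)).inter
        (isClosed_le (continuous_knots s t i) continuous_const)
    · refine isClosed_iInter fun s => isClosed_iInter fun t => isClosed_iInter fun i =>
        isClosed_iInter fun j => isClosed_iInter fun _ => ?_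
      exact isClosed_le ((continuous_knots s t i).add continuous_const) (continuous_knots s t j)
    · refine isClosed_iInter fun s => isClosed_iInter fun s' => isClosed_iInter fun t =>
        isClosed_iInter fun _ => isClosed_iInter fun i => isClosed_iInter fun j =>
        isClosed_iInter fun _ => ?_
      exact isClosed_le ((continuous_knots s t i).add continuous_const) (continuous_knots s' t j)
    · refine isClosed_iInter fun s => isClosed_iInter fun t => isClosed_iInter fun i =>
        isClosed_iInter fun _ => ?_
      exact isClosed_le continuous_const (continuous_knots s t i)
    · refine isClosed_iInter fun s => isClosed_iInter fun t => isClosed_iInter fun i =>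
        isClosed_iInter fun _ => ?_
      exact isClosed_le (continuous_knots s t i) continuous_const
  · rintro ⟨⟨s, t⟩, i⟩ -
    exact hξ.1.1 s t i

theorem component_eq_admissible {ξ₀ : Q.KnotSpace} (hξ₀ : ξ₀ ∈ Q.admissible) (hr : r = 1) :
    Q.component ξ₀ = Q.admissible := by
  subst hr
  refine Subset.antisymm (fun ξ h => h.1) fun ξ hξ => ⟨hξ, fun t s s' i j => ?_⟩
  obtain rfl : s = s' := Subsingleton.elim _ _
  rw [(strictMono_knots hξ s t).lt_iff_lt, (strictMono_knots hξ₀ s t).lt_iff_lt]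

theorem self_mem_component {ξ₀ : Q.KnotSpace} (hξ₀ : ξ₀ ∈ Q.admissible) :
    ξ₀ ∈ Q.component ξ₀ := ⟨hξ₀, fun _ _ _ _ _ => Iff.rfl⟩

/-- Continuity from the right holds even for exponent 0, where the jump at x = y takes its
right-hand value; hence the half-open intervals in the independence results. -/
theorem continuousWithinAt_truncPow (p : ℕ) (x y : ℝ) :
    ContinuousWithinAt (fun x => truncPow p x y) (Ici x) x := by
  by_cases h : x < y
  · have : ContinuousAt (fun x => (y - x) ^ p) x := by fun_prop
    refine (this.congr ?_).continuousWithinAt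
    filter_upwards [gt_mem_nhds h] with z hz
    simp [truncPow, hz]
  · refine (continuousWithinAt_const (b := (0 : ℝ))).congr (fun z hz => ?_) ?_
    · rw [truncPow, if_neg (not_lt.2 ((not_lt.1 h).trans hz))]
    · rw [truncPow, if_neg h]

theorem continuousWithinAt_ansatz (w : Q.CoeffSpace) (ξ : Q.KnotSpace) (x : Fin d → ℝ) :
    ContinuousWithinAt (Q.ansatz w ξ) (Ici x) x := by
  unfold ansatz basisFun
  simp only [bspline_eq]
  refine tendsto_finsetSum _ fun i _ => tendsto_const_nhds.mul (tendsto_finsetProd _ fun t _ =>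
    tendsto_finsetSum _ fun j _ => tendsto_const_nhds.mul ?_)
  exact (continuousWithinAt_truncPow _ (x t) _).comp (f := fun z : Fin d → ℝ => z t)
    (continuous_apply t).continuousWithinAt (fun z hz => hz t)

/-- A nonzero value would persist on the part of a neighbourhood in the upper orthant, which meets
the domain in positive measure. -/
theorem ansatz_eq_zero_of_ae {w : Q.CoeffSpace} {ξ : Q.KnotSpace}
    (h : Q.ansatz w ξ =ᵐ[volume.restrict Q.Omega] 0) {x : Fin d → ℝ}
    (hx : ∀ t, x t ∈ Ico (Q.xm t) (Q.xp t)) : Q.ansatz w ξ x = 0 := by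
  by_contra hne
  have h₁ := (continuousWithinAt_ansatz w ξ x).eventually_ne hne
  obtain ⟨V, hV, hxV, hVs⟩ := mem_nhdsWithin.1 h₁
  set B : Set (Fin d → ℝ) := Set.pi univ fun t => Ioo (x t) (Q.xp t) with hB
  have hBo : IsOpen B := isOpen_set_pi finite_univ fun t _ => isOpen_Ioo
  have hxB : x ∈ closure B := by
    rw [hB, closure_pi_set]
    intro t _
    change x t ∈ closure (Ioo (x t) (Q.xp t))
    rw [closure_Ioo (hx t).2.ne]
    exact ⟨le_rfl, (hx t).2.le⟩
  have hVB : (V ∩ B).Nonempty := mem_closure_iff.1 hxB V hV hxV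
  have hpos : 0 < volume (V ∩ B) := (hV.inter hBo).measure_pos _ hVB
  have hsub : V ∩ B ⊆ {y | ¬ (Q.ansatz w ξ y = (0 : (Fin d → ℝ) → ℝ) y)} ∩ Q.Omega := by
    rintro y ⟨hyV, hyB⟩
    refine ⟨hVs ⟨hyV, fun t => (hyB t trivial).1.le⟩, fun t => ?_, fun t => ?_⟩
    · exact (hx t).1.trans (hyB t trivial).1.le
    · exact (hyB t trivial).2.le
  rw [Filter.EventuallyEq, ae_iff] at h
  rw [Measure.restrict_apply' (by exact measurableSet_Icc)] at h
  exact hpos.ne' (measure_mono_null hsub h)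

theorem patch_coeff_eq_zero {ξ : Q.KnotSpace} (hξ : ξ ∈ Q.admissible) (s : Fin r)
    {w : ((t : Fin d) → Fin (Q.N s t - (Q.P s t + 1))) → ℝ}
    (h : ∀ x : Fin d → ℝ, (∀ t, x t ∈ Ico (Q.xm t) (Q.xp t)) →
      ∑ i, w i * ∏ t, bspline (Q.P s t) (Q.knots ξ s t) (i t) (x t) = 0) : w = 0 :=
  tensor_coeff_eq_zero (S := fun t => Ico (Q.xm t) (Q.xp t))
    (g := fun t i x => bspline (Q.P s t) (Q.knots ξ s t) i x)
    (fun t => nonempty_Ico.2 (Q.xm_lt_xp t))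
    (fun t _ hc => bspline_coeff_eq_zero (strictMono_knots hξ s t) (Q.xm_lt_xp t)
      (hξ.2.2.2.1 s t) (hξ.2.2.2.2 s t) (Q.P_lt_N s t) hc) h

theorem ansatz_eq_sum (w : Q.CoeffSpace) (ξ : Q.KnotSpace) (x : Fin d → ℝ) :
    Q.ansatz w ξ x = ∑ s, ∑ i : (t : Fin d) → Fin (Q.N s t - (Q.P s t + 1)),
      w ⟨s, i⟩ * ∏ t, bspline (Q.P s t) (Q.knots ξ s t) (i t) (x t) := by
  rw [ansatz, Fintype.sum_sigma]
  rfl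

/-- With the other coordinates frozen, the univariate result in the anchored direction separates the
patch `s₀` from the rest; independence within one patch then applies. -/
theorem coeff_eq_zero_of_anchored {ξ : Q.KnotSpace} (hξ : ξ ∈ Q.admissible)
    {w : Q.CoeffSpace}
    (h : ∀ x : Fin d → ℝ, (∀ t, x t ∈ Ico (Q.xm t) (Q.xp t)) → Q.ansatz w ξ x = 0) {s₀ : Fin r}
    (hs₀ : Q.Anchored ξ s₀) : (fun i => w ⟨s₀, i⟩) = 0 := by
  obtain ⟨t₀, ht₀⟩ := hs₀
  refine patch_coeff_eq_zero hξ s₀ fun x hx => ?_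
  rw [sum_mul_prod_split _ (fun t j => bspline (Q.P s₀ t) (Q.knots ξ s₀ t) j (x t)) t₀]
  set c : (s : Fin r) → Fin (Q.N s t₀ - (Q.P s t₀ + 1)) → ℝ := fun s b =>
    ∑ i : (t : Fin d) → Fin (Q.N s t - (Q.P s t + 1)), if i t₀ = b then
      w ⟨s, i⟩ * ∏ t ∈ Finset.univ.erase t₀, bspline (Q.P s t) (Q.knots ξ s t) (i t) (x t)
      else 0 with hc
  have hc0 : c s₀ = 0 := by
    refine bspline_coeff_eq_zero_of_anchored (τ := fun s => Q.knots ξ s t₀)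
      (injective_knots hξ t₀) (p := fun s => Q.P s t₀)
      (fun y hy => ?_) ht₀
    have h₁ := h (Function.update x t₀ y) fun t => by
      by_cases ht : t = t₀
      · subst ht; simpa using hy
      · simpa [Function.update_of_ne ht] using hx t
    rw [ansatz_eq_sum] at h₁
    refine Eq.trans (Finset.sum_congr rfl fun s _ => ?_) h₁
    rw [sum_mul_prod_split _ (fun t j => bspline (Q.P s t) (Q.knots ξ s t) j
      (Function.update x t₀ y t)) t₀]
    refine Finset.sum_congr rfl fun b _ => ?_
    simp only [Function.update_self, hc]
    congr 1
    refine Finset.sum_congr rfl fun i _ => ?_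
    congr 2
    refine Finset.prod_congr rfl fun t ht => ?_
    rw [Function.update_of_ne (Finset.ne_of_mem_erase ht)]
  refine Finset.sum_eq_zero fun b _ => ?_
  have := congrFun hc0 b
  simp only [hc, Pi.zero_apply] at this
  rw [this, zero_mul]

/-- The tensor-product B-splines are linearly independent on the domain if all patches but one
are anchored. -/
theorem coeff_eq_zero_of_ae {ξ : Q.KnotSpace} (hξ : ξ ∈ Q.admissible)
    (hanch : ∀ s s', s ≠ s' → Q.Anchored ξ s ∨ Q.Anchored ξ s') {w : Q.CoeffSpace}
    (h : Q.ansatz w ξ =ᵐ[volume.restrict Q.Omega] 0) : w = 0 := by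
  have h' : ∀ x : Fin d → ℝ, (∀ t, x t ∈ Ico (Q.xm t) (Q.xp t)) → Q.ansatz w ξ x = 0 :=
    fun x hx => ansatz_eq_zero_of_ae h hx
  ext ⟨s, i⟩
  by_cases hs : Q.Anchored ξ s
  · exact congrFun (coeff_eq_zero_of_anchored hξ h' hs) i
  · refine congrFun (patch_coeff_eq_zero hξ s (w := fun i => w ⟨s, i⟩) fun x hx => ?_) i
    rw [← h' x hx, ansatz_eq_sum, Finset.sum_eq_single s]
    · intro s' _ hs'
      refine Finset.sum_eq_zero fun j _ => ?_
      have := congrFun (coeff_eq_zero_of_anchored hξ h' ((hanch s' s hs').resolve_right hs)) j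
      simp only [Pi.zero_apply] at this
      rw [this, zero_mul]
    · simp

end Patches

end Patch

/-! ### Moments of the data at moving knots. -/

section Moments

variable {d r : ℕ} {Q : Patches d r}

/-- The moments of order `m` of the datum `f` along `t` are differentiable functions of every knot
on `C`. -/
def MomentsC1On (Q : Patches d r) (lip : Prop) (C : Set Q.KnotSpace) (t : Fin d) (f : ℝ → ℝ)
    (m : ℕ) : Prop :=
  ∀ s i, C1On lip C fun ξ => truncMoment (Q.xm t) (Q.xp t) f m (Q.knots ξ s t i)

theorem momentsC1On_of_integrable {lip : Prop} {C : Set Q.KnotSpace} (hC : C ⊆ Q.admissible)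
    {t : Fin d} {f : ℝ → ℝ} (hf : IntegrableOn f (Icc (Q.xm t) (Q.xp t))) {m : ℕ} (hm : 1 ≤ m)
    (hl : lip → 2 ≤ m ∨ MemLp f ⊤ (volume.restrict (Icc (Q.xm t) (Q.xp t)))) :
    MomentsC1On Q lip C t f m := by
  obtain ⟨m, rfl⟩ : ∃ n, m = n + 1 := ⟨m - 1, by omega⟩
  intro s i
  exact (C1On.truncMoment_succ hf m (fun h => (hl h).imp_left fun h => by omega)
    (Q.ym t) (Q.yp t)).comp_clm (Q.knotCLM s t i) fun ξ hξ => (hC hξ).1 s t i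

theorem momentsC1On_of_bounded {lip : Prop} {C : Set Q.KnotSpace} (hC : C ⊆ Q.admissible)
    {t : Fin d} {f : ℝ → ℝ} (hf : MemLp f ⊤ (volume.restrict (Icc (Q.xm t) (Q.xp t)))) {m : ℕ}
    (hm : 1 ≤ m) : MomentsC1On Q lip C t f m :=
  momentsC1On_of_integrable hC (hf.integrable (by simp)) hm fun _ => Or.inr hf

theorem memLp_top_of_continuous {α β : ℝ} {f F : ℝ → ℝ} (hF : Continuous F)
    (hfF : f =ᵐ[volume.restrict (Icc α β)] F) : MemLp f ⊤ (volume.restrict (Icc α β)) := by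
  obtain ⟨M, hM⟩ := isCompact_Icc.exists_bound_of_continuousOn (s := Icc α β) hF.continuousOn
  refine (memLp_top_of_bound hF.aestronglyMeasurable M ?_).ae_eq hfF.symm
  filter_upwards [ae_restrict_Icc_mem] with x hx using hM x hx

theorem momentsC1On_of_continuous {lip : Prop} {C : Set Q.KnotSpace} (hC : C ⊆ Q.admissible)
    {t : Fin d} (hCt : ∀ ξ ∈ C, ∀ s i, Q.knots ξ s t i ∈ Icc (Q.xm t) (Q.xp t)) {f F : ℝ → ℝ}
    (hF : Continuous F) (hfF : f =ᵐ[volume.restrict (Icc (Q.xm t) (Q.xp t))] F)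
    (hl : lip → ∃ K, LipschitzOnWith K F (Icc (Q.xm t) (Q.xp t))) (m : ℕ) :
    MomentsC1On Q lip C t f m := by
  cases m with
  | succ m => exact momentsC1On_of_bounded hC (memLp_top_of_continuous hF hfF) (by omega)
  | zero =>
    intro s i
    exact (C1On.truncMoment_zero hF hfF hl).comp_clm (Q.knotCLM s t i) fun ξ hξ => hCt ξ hξ s i

theorem memLp_top_mul_pow {α β : ℝ} {f : ℝ → ℝ} (hf : MemLp f ⊤ (volume.restrict (Icc α β)))
    (b : ℕ) : MemLp (fun x => f x * x ^ b) ⊤ (volume.restrict (Icc α β)) := by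
  have hp : MemLp (fun x : ℝ => x ^ b) ⊤ (volume.restrict (Icc α β)) :=
    memLp_top_of_continuous (continuous_pow b) EventuallyEq.rfl
  exact hp.mul hf

theorem exists_lipschitzOnWith_mul_pow {α β : ℝ} {F : ℝ → ℝ}
    (hF : ∃ K, LipschitzOnWith K F (Icc α β)) (b : ℕ) :
    ∃ K, LipschitzOnWith K (fun x => F x * x ^ b) (Icc α β) := by
  refine exists_lipschitzOnWith_smul isCompact_Icc hF ?_
  have h : C1On True (Icc α β) fun x : ℝ => x ^ b :=
    C1On.pow isCompact_Icc (convex_Icc α β) b (C1On.clm True _ (ContinuousLinearMap.id ℝ ℝ))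
  exact h.exists_lipschitzOnWith isCompact_Icc (convex_Icc α β)

/-- The mixed moments `∫ f(x) (y - x)₊ ^ m (z - x)₊ ^ n dx` over `[α, β]`. -/
noncomputable def mixedMoment (α β : ℝ) (f : ℝ → ℝ) (m n : ℕ) (y z : ℝ) : ℝ :=
  ∫ x in Icc α β, f x * (truncPow m x y * truncPow n x z)

theorem mixedMoment_comm (α β : ℝ) (f : ℝ → ℝ) (m n : ℕ) (y z : ℝ) :
    mixedMoment α β f m n y z = mixedMoment α β f n m z y := by
  simp only [mixedMoment, mul_comm]

theorem mixedMoment_self (α β : ℝ) (f : ℝ → ℝ) (m n : ℕ) (y : ℝ) :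
    mixedMoment α β f m n y y = truncMoment α β f (m + n) y := by
  refine congrArg _ (funext fun x => ?_)
  by_cases h : x < y <;> simp [truncPow, h, pow_add]

/-- Where x < y < z the factor with the larger knot is a polynomial; expanding it in powers of x
leaves moments at y of weighted data. Its exponent imposes no regularity. -/
theorem mixedMoment_of_lt {α β : ℝ} {f : ℝ → ℝ}
    (hf : MemLp f ⊤ (volume.restrict (Icc α β))) (m n : ℕ) {y z : ℝ} (hyz : y < z) :
    mixedMoment α β f m n y z = ∑ b ∈ Finset.range (n + 1),
      ((-1) ^ b * (n.choose b) * z ^ (n - b)) * truncMoment α β (fun x => f x * x ^ b) m y := by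
  simp only [truncMoment, mixedMoment, ← integral_const_mul]
  rw [← integral_finsetSum]
  · refine congrArg _ (funext fun x => ?_)
    by_cases h : x < y
    · have hz : x < z := h.trans hyz
      simp only [truncPow, h, hz, if_true]
      rw [show z - x = -x + z by ring, add_pow, Finset.mul_sum, Finset.mul_sum]
      refine Finset.sum_congr rfl fun b _ => ?_
      rw [neg_pow]
      ring
    · simp [truncPow, h]
  · intro b _
    exact (integrable_mul_truncPow ((memLp_top_mul_pow hf b).integrable (by simp)) m y).const_mul _

theorem C1On.knots (lip : Prop) (C : Set Q.KnotSpace) (s : Fin r) (t : Fin d)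
    (i : Fin (Q.N s t)) : C1On lip C fun ξ => Q.knots ξ s t i := C1On.clm lip C (Q.knotCLM s t i)

theorem C1On.mixedMoment_of_lt {lip : Prop} {C : Set Q.KnotSpace} (hcpt : IsCompact C)
    (hconv : Convex ℝ C) {t : Fin d} {f : ℝ → ℝ}
    (hf : MemLp f ⊤ (volume.restrict (Icc (Q.xm t) (Q.xp t)))) {m n : ℕ}
    (hreg : ∀ b, MomentsC1On Q lip C t (fun x => f x * x ^ b) m) {s s' : Fin r}
    {i : Fin (Q.N s t)} {j : Fin (Q.N s' t)}
    (hlt : ∀ ξ ∈ C, Q.knots ξ s t i < Q.knots ξ s' t j) :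
    C1On lip C fun ξ =>
      mixedMoment (Q.xm t) (Q.xp t) f m n (Q.knots ξ s t i) (Q.knots ξ s' t j) := by
  have h : C1On lip C fun ξ => ∑ b ∈ Finset.range (n + 1),
      ((-1) ^ b * (n.choose b) * Q.knots ξ s' t j ^ (n - b)) *
        truncMoment (Q.xm t) (Q.xp t) (fun x => f x * x ^ b) m (Q.knots ξ s t i) :=
    C1On.sum _ fun b _ => ((((C1On.knots lip C s' t j).pow hcpt hconv (n - b)).const_mul hcpt hconv
      _).mul hcpt hconv (hreg b s i))
  exact h.congr fun ξ hξ => FreeKnot.mixedMoment_of_lt hf m n (hlt ξ hξ)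

/-- Two knots either keep their order throughout the component or are the same knot, in which case
the two powers merge into one of order m + n. -/
theorem C1On.mixedMoment {lip : Prop} {ξ₀ : Q.KnotSpace} (hξ₀ : ξ₀ ∈ Q.admissible) {t : Fin d}
    {f : ℝ → ℝ} (hf : MemLp f ⊤ (volume.restrict (Icc (Q.xm t) (Q.xp t)))) {m₀ m n : ℕ}
    (hreg : ∀ l ≥ m₀, ∀ b, MomentsC1On Q lip (Q.component ξ₀) t (fun x => f x * x ^ b) l)
    (hm : m₀ ≤ m) (hn : m₀ ≤ n) (s s' : Fin r) (i : Fin (Q.N s t)) (j : Fin (Q.N s' t)) :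
    C1On lip (Q.component ξ₀) fun ξ =>
      mixedMoment (Q.xm t) (Q.xp t) f m n (Q.knots ξ s t i) (Q.knots ξ s' t j) := by
  have hcpt := Patches.isCompact_component hξ₀
  have hconv := Patches.convex_component hξ₀
  rcases lt_trichotomy (Q.knots ξ₀ s t i) (Q.knots ξ₀ s' t j) with h | h | h
  · exact C1On.mixedMoment_of_lt hcpt hconv hf (hreg m hm) fun ξ hξ => (hξ.2 t s s' i j).2 h
  · have e : (⟨s, i⟩ : (s : Fin r) × Fin (Q.N s t)) = ⟨s', j⟩ := Patches.injective_knots hξ₀ t h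
    cases e
    refine (hreg (m + n) (by omega) 0 s i).congr fun ξ _ => ?_
    simp [mixedMoment_self]
  · refine (C1On.mixedMoment_of_lt hcpt hconv hf (hreg n hn) (n := m) fun ξ hξ =>
      (hξ.2 t s' s j i).2 h).congr fun ξ _ => mixedMoment_comm ..

theorem C1On.bsplineCoeff (lip : Prop) {C : Set Q.KnotSpace} (hC : C ⊆ Q.admissible)
    (hcpt : IsCompact C) (hconv : Convex ℝ C) (s : Fin r) (t : Fin d)
    (i : Fin (Q.N s t - (Q.P s t + 1))) (j : Fin (Q.P s t + 2)) :
    C1On lip C fun ξ => bsplineCoeff (Q.P s t) (fun j => Q.knots ξ s t (knotIndex i j)) j := by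
  have hsub : ∀ a b, C1On lip C fun ξ => Q.knots ξ s t a - Q.knots ξ s t b := fun a b =>
    C1On.clm lip C (Q.knotCLM s t a - Q.knotCLM s t b)
  refine (hsub _ _).mul hcpt hconv ((C1On.prod hcpt hconv _ fun l _ => hsub _ _).inv hcpt hconv
    fun ξ hξ => Finset.prod_ne_zero_iff.2 fun l hl => sub_ne_zero.2 ?_)
  exact ((Patches.strictMono_knots (hC hξ) s t).injective.comp (knotIndex_injective i)).ne
    (Finset.ne_of_mem_erase hl).symm

end Moments

/-! ### The discrete linear system and its entries. -/

theorem coeFn_sum_smul {Ω ι : Type*} [MeasurableSpace Ω] {μ : Measure Ω} (s : Finset ι)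
    (w : ι → ℝ) (f : ι → Ω →ₘ[μ] ℝ) :
    ⇑(∑ i ∈ s, w i • f i) =ᵐ[μ] fun x => ∑ i ∈ s, w i * f i x := by
  classical
  induction s using Finset.induction_on with
  | empty => exact AEEqFun.coeFn_zero
  | insert a s ha ih =>
    rw [Finset.sum_insert ha]
    filter_upwards [AEEqFun.coeFn_add (w a • f a) (∑ i ∈ s, w i • f i), ih,
      AEEqFun.coeFn_smul (w a) (f a)] with x h₁ h₂ h₃
    rw [h₁, Pi.add_apply, h₂, h₃, Finset.sum_insert ha, Pi.smul_apply, smul_eq_mul]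

namespace Problem

variable {d r : ℕ} {Q : Patches d r} {U : Type*} [NormedAddCommGroup U] [InnerProductSpace ℝ U]
  (E : Problem Q U)

/-- The element of `U` of a tensor-product B-spline. -/
noncomputable def basisElem (ξ : Q.KnotSpace) (i : Q.BasisIndex) : U :=
  Classical.epsilon fun z => E.incl z =ᵐ[volume.restrict Q.Omega] Q.basisFun ξ i

/-- The matrix of the discrete problem. -/
noncomputable def stiffness (ξ : Q.KnotSpace) : Matrix Q.BasisIndex Q.BasisIndex ℝ :=
  fun i j => E.a (E.basisElem ξ i) (E.basisElem ξ j)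

/-- The right-hand side of the discrete problem. -/
noncomputable def load (ξ : Q.KnotSpace) (i : Q.BasisIndex) : ℝ := E.ell (E.basisElem ξ i)

variable {E}

theorem incl_basisElem (hconf : E.Conforming) {ξ : Q.KnotSpace} (hξ : ξ ∈ Q.admissible)
    (i : Q.BasisIndex) :
    E.incl (E.basisElem ξ i) =ᵐ[volume.restrict Q.Omega] Q.basisFun ξ i :=
  Classical.epsilon_spec (p := fun z => E.incl z =ᵐ[volume.restrict Q.Omega] Q.basisFun ξ i)
    (E.tensor_mem (fun t => bspline (Q.P i.1 t) (Q.knots ξ i.1 t) (i.2 t))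
      fun t => hconf ξ hξ i.1 t (i.2 t))

theorem incl_sum_basisElem (hconf : E.Conforming) {ξ : Q.KnotSpace} (hξ : ξ ∈ Q.admissible)
    (w : Q.CoeffSpace) :
    E.incl (∑ i, w i • E.basisElem ξ i) =ᵐ[volume.restrict Q.Omega] Q.ansatz w ξ := by
  have h : ∀ᵐ x ∂volume.restrict Q.Omega, ∀ i, E.incl (E.basisElem ξ i) x = Q.basisFun ξ i x :=
    ae_all_iff.2 fun i => incl_basisElem hconf hξ i
  simp only [map_sum, map_smul]
  filter_upwards [coeFn_sum_smul Finset.univ w fun i => E.incl (E.basisElem ξ i), h] with x h₁ h₂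
  rw [h₁, Patches.ansatz]
  exact Finset.sum_congr rfl fun i _ => by rw [h₂ i]

/-- The realisation is defined by choice; injectivity of the inclusion identifies it with the linear
combination. -/
theorem realise_eq (hconf : E.Conforming) {ξ : Q.KnotSpace} (hξ : ξ ∈ Q.admissible)
    (w : Q.CoeffSpace) : E.realise w ξ = ∑ i, w i • E.basisElem ξ i := by
  have h := incl_sum_basisElem hconf hξ w
  have h' : E.incl (E.realise w ξ) =ᵐ[volume.restrict Q.Omega] Q.ansatz w ξ :=
    Classical.epsilon_spec (p := fun z => E.incl z =ᵐ[volume.restrict Q.Omega] Q.ansatz w ξ) ⟨_, h⟩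
  exact E.incl_injective (AEEqFun.ext (h'.trans h.symm))

open Matrix in
theorem a_realise (hconf : E.Conforming) {ξ : Q.KnotSpace} (hξ : ξ ∈ Q.admissible)
    (w : Q.CoeffSpace) :
    E.a (E.realise w ξ) (E.realise w ξ) = ⇑w ⬝ᵥ E.stiffness ξ *ᵥ ⇑w := by
  rw [realise_eq hconf hξ]
  simp only [map_sum, map_smul, _root_.sum_apply, _root_.smul_apply, smul_eq_mul,
    dotProduct, mulVec, stiffness, Finset.mul_sum]
  rw [Finset.sum_comm]
  refine Finset.sum_congr rfl fun i _ => Finset.sum_congr rfl fun j _ => ?_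
  ring

theorem discreteEnergy_eq (hconf : E.Conforming) {ξ : Q.KnotSpace} (hξ : ξ ∈ Q.admissible)
    (w : Q.CoeffSpace) :
    E.discreteEnergy w ξ = quadEnergy (E.stiffness ξ) (E.load ξ) w := by
  rw [discreteEnergy, energy, a_realise hconf hξ, quadEnergy]
  congr 1
  rw [realise_eq hconf hξ]
  simp [dotProduct, load, mul_comm]

theorem isSymm_stiffness (ξ : Q.KnotSpace) : (E.stiffness ξ).IsSymm :=
  Matrix.IsSymm.ext fun _ _ => E.symm _ _

open Matrix in
theorem stiffness_pos (hconf : E.Conforming) {ξ : Q.KnotSpace} (hξ : ξ ∈ Q.admissible)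
    (hanch : ∀ s s', s ≠ s' → Q.Anchored ξ s ∨ Q.Anchored ξ s') (w : Q.BasisIndex → ℝ)
    (hw : w ≠ 0) : 0 < w ⬝ᵥ E.stiffness ξ *ᵥ w := by
  set w' : Q.CoeffSpace := WithLp.toLp 2 w with hw'
  have hne : E.realise w' ξ ≠ 0 := fun h0 => by
    refine hw ?_
    have h := incl_sum_basisElem hconf hξ w'
    rw [← realise_eq hconf hξ, h0, map_zero] at h
    have h₁ := Patches.coeff_eq_zero_of_ae hξ hanch (h.symm.trans AEEqFun.coeFn_zero)
    exact congrArg (WithLp.ofLp) h₁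
  have h := a_realise hconf hξ w'
  obtain ⟨c, hc, hcoer⟩ := E.coercive
  have h₁ := hcoer (E.realise w' ξ)
  have h₂ : 0 < c * ‖E.realise w' ξ‖ * ‖E.realise w' ξ‖ := by
    have := norm_pos_iff.2 hne
    positivity
  calc 0 < E.a (E.realise w' ξ) (E.realise w' ξ) := h₂.trans_le h₁
    _ = _ := h

/-- The Sobolev jet of a B-spline. -/
noncomputable def bsplineJet {n : ℕ} (p : ℕ) (τ : Fin n → ℝ) (i : Fin (n - (p + 1))) (α : ℕ)
    (x : ℝ) : ℝ :=
  ∑ j, bsplineCoeff p (fun j => τ (knotIndex i j)) j * truncPowDeriv p α x (τ (knotIndex i j))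

theorem isSobolevJet_bspline {α β : ℝ} (hαβ : α ≤ β) {n k p : ℕ} (hk : k ≤ p) (τ : Fin n → ℝ)
    (i : Fin (n - (p + 1))) : IsSobolevJet k α β (bspline p τ i) (bsplineJet p τ i) := by
  have := isSobolevJet_sum_truncPow hαβ hk
    (fun j => bsplineCoeff p (fun j => τ (knotIndex i j)) j) (fun j => τ (knotIndex i j))
  have e : bspline p τ i = fun x => ∑ j, bsplineCoeff p (fun j => τ (knotIndex i j)) j *
      truncPow p x (τ (knotIndex i j)) := funext fun x => bspline_eq p τ i x
  rw [e]
  exact this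

theorem integral_mul_bsplineJet {α β : ℝ} {f : ℝ → ℝ} (hf : IntegrableOn f (Icc α β))
    {n p : ℕ} (τ : Fin n → ℝ) (i : Fin (n - (p + 1))) (a : ℕ) :
    ∫ x in Icc α β, f x * bsplineJet p τ i a x =
      ∑ j, bsplineCoeff p (fun j => τ (knotIndex i j)) j * ((-1) ^ a * p.descFactorial a) *
        truncMoment α β f (p - a) (τ (knotIndex i j)) := by
  simp only [truncMoment, ← integral_const_mul]
  rw [← integral_finsetSum]
  · refine congrArg _ (funext fun x => ?_)
    rw [bsplineJet, Finset.mul_sum]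
    refine Finset.sum_congr rfl fun j _ => ?_
    rw [truncPowDeriv]
    ring
  · intro j _
    exact (integrable_mul_truncPow hf _ _).const_mul _

theorem integral_mul_bsplineJet_mul {α β : ℝ} {f : ℝ → ℝ} (hf : IntegrableOn f (Icc α β))
    {n p n' p' : ℕ} (τ : Fin n → ℝ) (i : Fin (n - (p + 1))) (a : ℕ) (τ' : Fin n' → ℝ)
    (i' : Fin (n' - (p' + 1))) (a' : ℕ) :
    ∫ x in Icc α β, f x * bsplineJet p τ i a x * bsplineJet p' τ' i' a' x =
      ∑ j, ∑ j', (bsplineCoeff p (fun j => τ (knotIndex i j)) j *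
          bsplineCoeff p' (fun j => τ' (knotIndex i' j)) j') *
        (((-1) ^ a * p.descFactorial a) * ((-1) ^ a' * p'.descFactorial a')) *
        mixedMoment α β f (p - a) (p' - a') (τ (knotIndex i j)) (τ' (knotIndex i' j')) := by
  have hint : ∀ m m' y y',
      IntegrableOn (fun x => f x * (truncPow m x y * truncPow m' x y')) (Icc α β) := by
    intro m m' y y'
    have := integrable_mul_truncPow (integrable_mul_truncPow hf m y) m' y'
    simpa only [mul_assoc] using this
  simp only [mixedMoment, ← integral_const_mul]
  have e : ∀ j, ∑ j', ∫ x in Icc α β, (bsplineCoeff p (fun j => τ (knotIndex i j)) j *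
          bsplineCoeff p' (fun j => τ' (knotIndex i' j)) j') *
        (((-1) ^ a * p.descFactorial a) * ((-1) ^ a' * p'.descFactorial a')) *
        (f x * (truncPow (p - a) x (τ (knotIndex i j)) *
          truncPow (p' - a') x (τ' (knotIndex i' j')))) =
      ∫ x in Icc α β, ∑ j', (bsplineCoeff p (fun j => τ (knotIndex i j)) j *
          bsplineCoeff p' (fun j => τ' (knotIndex i' j)) j') *
        (((-1) ^ a * p.descFactorial a) * ((-1) ^ a' * p'.descFactorial a')) *
        (f x * (truncPow (p - a) x (τ (knotIndex i j)) *
          truncPow (p' - a') x (τ' (knotIndex i' j')))) := fun j =>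
    (integral_finsetSum _ fun j' _ => (hint _ _ _ _).const_mul _).symm
  simp only [e]
  rw [← integral_finsetSum _ fun j _ => integrable_finsetSum _ fun j' _ =>
    (hint _ _ _ _).const_mul _]
  refine congrArg _ (funext fun x => ?_)
  rw [bsplineJet, bsplineJet, mul_assoc, Finset.sum_mul_sum, Finset.mul_sum]
  refine Finset.sum_congr rfl fun j _ => ?_
  rw [Finset.mul_sum]
  refine Finset.sum_congr rfl fun j' _ => ?_
  rw [truncPowDeriv, truncPowDeriv]
  ring

/-- The entries of the matrix are differentiable functions of the knots. -/
theorem C1On_stiffness (hconf : E.Conforming) {lip : Prop} {ξ₀ : Q.KnotSpace}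
    (hξ₀ : ξ₀ ∈ Q.admissible) {m₀ : ℕ} (hP : ∀ s t, E.k + m₀ ≤ Q.P s t)
    (hreg : ∀ σ t, ∀ α ≤ E.k, ∀ β ≤ E.k, ∀ l ≥ m₀, ∀ b,
      MomentsC1On Q lip (Q.component ξ₀) t (fun x => E.c σ t α β x * x ^ b) l)
    (i j : Q.BasisIndex) : C1On lip (Q.component ξ₀) fun ξ => E.stiffness ξ i j := by
  have hcpt := Patches.isCompact_component hξ₀
  have hconv := Patches.convex_component hξ₀
  have hsub : Q.component ξ₀ ⊆ Q.admissible := fun ξ h => h.1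
  have h : C1On lip (Q.component ξ₀) fun ξ => ∑ σ, ∏ t, ∑ α ∈ Finset.range (E.k + 1),
      ∑ β ∈ Finset.range (E.k + 1), ∫ x in Icc (Q.xm t) (Q.xp t), E.c σ t α β x *
        bsplineJet (Q.P i.1 t) (Q.knots ξ i.1 t) (i.2 t) α x *
        bsplineJet (Q.P j.1 t) (Q.knots ξ j.1 t) (j.2 t) β x := by
    refine C1On.sum _ fun σ _ => C1On.prod hcpt hconv _ fun t _ => C1On.sum _ fun α hα =>
      C1On.sum _ fun β hβ => ?_
    have hα' : α ≤ E.k := Nat.lt_succ_iff.1 (Finset.mem_range.1 hα)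
    have hβ' : β ≤ E.k := Nat.lt_succ_iff.1 (Finset.mem_range.1 hβ)
    have hc := E.c_bdd σ t α hα' β hβ'
    simp only [integral_mul_bsplineJet_mul (hc.integrable (by simp))]
    refine C1On.sum _ fun l _ => C1On.sum _ fun l' _ => ?_
    have hPi := hP i.1 t
    have hPj := hP j.1 t
    refine C1On.mul hcpt hconv (C1On.mul hcpt hconv (C1On.mul hcpt hconv
      (C1On.bsplineCoeff lip hsub hcpt hconv i.1 t (i.2 t) l)
      (C1On.bsplineCoeff lip hsub hcpt hconv j.1 t (j.2 t) l')) (C1On.const _ _ _)) ?_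
    -- Derivatives of order at most k lower the exponents P to no less than `m₀`, the surplus of the
    -- degrees over the order.
    exact C1On.mixedMoment hξ₀ hc (hreg σ t α hα' β hβ') (by omega) (by omega) _ _ _ _
  refine h.congr fun ξ hξ => ?_
  refine E.a_separable (fun t => bspline (Q.P i.1 t) (Q.knots ξ i.1 t) (i.2 t))
    (fun t => bspline (Q.P j.1 t) (Q.knots ξ j.1 t) (j.2 t)) _ _ _ _
    (fun t => hconf ξ hξ.1 i.1 t (i.2 t)) (fun t => hconf ξ hξ.1 j.1 t (j.2 t))
    (fun t => isSobolevJet_bspline (Q.xm_lt_xp t).le ((Nat.le_add_right _ _).trans (hP i.1 t)) _ _)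
    (fun t => isSobolevJet_bspline (Q.xm_lt_xp t).le ((Nat.le_add_right _ _).trans (hP j.1 t)) _ _)
    (incl_basisElem hconf hξ.1 i) (incl_basisElem hconf hξ.1 j)

/-- The entries of the right-hand side are differentiable functions of the knots. -/
theorem C1On_load (hconf : E.Conforming) {lip : Prop} {ξ₀ : Q.KnotSpace}
    (hξ₀ : ξ₀ ∈ Q.admissible) {m₀ : ℕ} (hP : ∀ s t, E.k + m₀ ≤ Q.P s t)
    (hreg : ∀ σ t, ∀ α ≤ E.k, ∀ l ≥ m₀, MomentsC1On Q lip (Q.component ξ₀) t (E.f σ t α) l)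
    (i : Q.BasisIndex) : C1On lip (Q.component ξ₀) fun ξ => E.load ξ i := by
  have hcpt := Patches.isCompact_component hξ₀
  have hconv := Patches.convex_component hξ₀
  have hsub : Q.component ξ₀ ⊆ Q.admissible := fun ξ h => h.1
  have h : C1On lip (Q.component ξ₀) fun ξ => ∑ σ, ∏ t, ∑ α ∈ Finset.range (E.k + 1),
      ∫ x in Icc (Q.xm t) (Q.xp t), E.f σ t α x *
        bsplineJet (Q.P i.1 t) (Q.knots ξ i.1 t) (i.2 t) α x := by
    refine C1On.sum _ fun σ _ => C1On.prod hcpt hconv _ fun t _ => C1On.sum _ fun α hα => ?_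
    have hα' : α ≤ E.k := Nat.lt_succ_iff.1 (Finset.mem_range.1 hα)
    simp only [integral_mul_bsplineJet ((E.f_sq σ t α hα').integrable (by norm_num))]
    refine C1On.sum _ fun l _ => ?_
    have hPi := hP i.1 t
    refine C1On.mul hcpt hconv (C1On.mul hcpt hconv
      (C1On.bsplineCoeff lip hsub hcpt hconv i.1 t (i.2 t) l) (C1On.const _ _ _)) ?_
    exact hreg σ t α hα' (Q.P i.1 t - α) (by omega) _ _
  refine h.congr fun ξ hξ => ?_
  refine E.ell_separable (fun t => bspline (Q.P i.1 t) (Q.knots ξ i.1 t) (i.2 t)) _ _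
    (fun t => hconf ξ hξ.1 i.1 t (i.2 t))
    (fun t => isSobolevJet_bspline (Q.xm_lt_xp t).le ((Nat.le_add_right _ _).trans (hP i.1 t)) _ _)
    (incl_basisElem hconf hξ.1 i)

end Problem

theorem exists_continuous_of_lipschitzOnWith {α β : ℝ} (hαβ : α ≤ β) {f : ℝ → ℝ}
    (hf : ∃ K, LipschitzOnWith K f (Icc α β)) :
    ∃ F : ℝ → ℝ, Continuous F ∧ f =ᵐ[volume.restrict (Icc α β)] F ∧
      ∃ K, LipschitzOnWith K F (Icc α β) := by
  obtain ⟨K, hK⟩ := hf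
  have he : EqOn f (IccExtend hαβ ((Icc α β).domRestrict f)) (Icc α β) := fun x hx => by
    rw [IccExtend_of_mem _ _ hx, domRestrict_apply]
  refine ⟨IccExtend hαβ ((Icc α β).domRestrict f),
    (continuousOn_iff_continuous_domRestrict.1 hK.continuousOn).Icc_extend', ?_, K,
    fun x hx y hy => ?_⟩
  · filter_upwards [ae_restrict_Icc_mem] with x hx using he hx
  · rw [← he hx, ← he hy]
    exact hK hx hy

/-! ### Regularity of the reduced energy, and reduction of the algorithm to mirror descent. -/

namespace Problem

variable {d r : ℕ} {Q : Patches d r} {U : Type*} [NormedAddCommGroup U] [InnerProductSpace ℝ U]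
  {E : Problem Q U}

/-- Bounded coefficients already give a matrix with Lipschitz derivative at surplus 1. The linear
data are only square-integrable, so the right-hand side needs either one more degree or boundedness.
-/
theorem C1On_data_of_lt (hconf : E.Conforming) {lip : Prop} {ξ₀ : Q.KnotSpace}
    (hξ₀ : ξ₀ ∈ Q.admissible) (hP : ∀ s t, E.k < Q.P s t)
    (hl : lip → (∀ s t, E.k + 1 < Q.P s t) ∨ ∀ σ t, ∀ α ≤ E.k,
      MemLp (E.f σ t α) ⊤ (volume.restrict (Icc (Q.xm t) (Q.xp t)))) :
    (∀ i j, C1On lip (Q.component ξ₀) fun ξ => E.stiffness ξ i j) ∧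
      ∀ i, C1On lip (Q.component ξ₀) fun ξ => E.load ξ i := by
  have hsub : Q.component ξ₀ ⊆ Q.admissible := fun ξ h => h.1
  refine ⟨C1On_stiffness hconf hξ₀ (m₀ := 1) hP fun σ t α hα β hβ l hm b =>
    momentsC1On_of_bounded hsub (memLp_top_mul_pow (E.c_bdd σ t α hα β hβ) b) hm, ?_⟩
  have hfi : ∀ σ t, ∀ α ≤ E.k, IntegrableOn (E.f σ t α) (Icc (Q.xm t) (Q.xp t)) :=
    fun σ t α hα => (E.f_sq σ t α hα).integrable (by norm_num)
  by_cases hlip : lip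
  · rcases hl hlip with h | h
    · exact C1On_load hconf hξ₀ (m₀ := 2) h fun σ t α hα l hm =>
        momentsC1On_of_integrable hsub (hfi σ t α hα) (by omega) fun _ => Or.inl hm
    · exact C1On_load hconf hξ₀ (m₀ := 1) hP fun σ t α hα l hm =>
        momentsC1On_of_bounded hsub (h σ t α hα) hm
  · exact C1On_load hconf hξ₀ (m₀ := 1) hP fun σ t α hα l hm =>
      momentsC1On_of_integrable hsub (hfi σ t α hα) hm fun h => absurd h hlip

theorem C1On_data_of_le (hconf : E.Conforming) {lip : Prop} {ξ₀ : Q.KnotSpace}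
    (hξ₀ : ξ₀ ∈ Q.admissible) (hP : ∀ s t, E.k ≤ Q.P s t)
    (hC : ∀ ξ ∈ Q.component ξ₀, ∀ s t i, Q.knots ξ s t i ∈ Icc (Q.xm t) (Q.xp t))
    (hc : ∀ σ t, ∀ α ≤ E.k, ∀ β ≤ E.k, ∃ F : ℝ → ℝ, Continuous F ∧
      E.c σ t α β =ᵐ[volume.restrict (Icc (Q.xm t) (Q.xp t))] F ∧
      (lip → ∃ K, LipschitzOnWith K F (Icc (Q.xm t) (Q.xp t))))
    (hf : ∀ σ t, ∀ α ≤ E.k, ∃ F : ℝ → ℝ, Continuous F ∧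
      E.f σ t α =ᵐ[volume.restrict (Icc (Q.xm t) (Q.xp t))] F ∧
      (lip → ∃ K, LipschitzOnWith K F (Icc (Q.xm t) (Q.xp t)))) :
    (∀ i j, C1On lip (Q.component ξ₀) fun ξ => E.stiffness ξ i j) ∧
      ∀ i, C1On lip (Q.component ξ₀) fun ξ => E.load ξ i := by
  have hsub : Q.component ξ₀ ⊆ Q.admissible := fun ξ h => h.1
  refine ⟨C1On_stiffness hconf hξ₀ (m₀ := 0) hP fun σ t α hα β hβ l _ b => ?_,
    C1On_load hconf hξ₀ (m₀ := 0) hP fun σ t α hα l _ => ?_⟩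
  · obtain ⟨F, hF, hcF, hL⟩ := hc σ t α hα β hβ
    refine momentsC1On_of_continuous hsub (fun ξ hξ s i => hC ξ hξ s t i)
      (by fun_prop : Continuous fun x => F x * x ^ b) ?_
      (fun h => exists_lipschitzOnWith_mul_pow (hL h) b) l
    filter_upwards [hcF] with x hx
    rw [hx]
  · obtain ⟨F, hF, hfF, hL⟩ := hf σ t α hα
    exact momentsC1On_of_continuous hsub (fun ξ hξ s i => hC ξ hξ s t i) hF hfF hL l

/-- The matrix and the right-hand side are continuously differentiable functions of the knots, with
Lipschitz derivatives for regular data. -/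
theorem C1On_data (hconf : E.Conforming) {lip : Prop} {ξ₀ : Q.KnotSpace}
    (hξ₀ : ξ₀ ∈ Q.admissible) (hdeg : E.DegreeCondition (Q.component ξ₀))
    (hl : lip → E.LipschitzData) :
    (∀ i j, C1On lip (Q.component ξ₀) fun ξ => E.stiffness ξ i j) ∧
      ∀ i, C1On lip (Q.component ξ₀) fun ξ => E.load ξ i := by
  have hx : ∀ t, Q.xm t ≤ Q.xp t := fun t => (Q.xm_lt_xp t).le
  rcases hdeg with hP | ⟨-, hP, hc, hf, hC⟩
  · refine C1On_data_of_lt hconf hξ₀ hP fun h => ?_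
    rcases hl h with h | h | h
    · exact Or.inl h
    · exact Or.inr h.2
    · refine Or.inr fun σ t α hα => ?_
      obtain ⟨F, hF, hfF, -⟩ := exists_continuous_of_lipschitzOnWith (hx t) (h.2 σ t α hα)
      exact memLp_top_of_continuous hF hfF
  · by_cases hlip : lip
    · rcases hl hlip with h | h | h
      · exact C1On_data_of_lt hconf hξ₀ (fun s t => (Nat.lt_succ_self _).trans (h s t))
          fun _ => Or.inl h
      · exact C1On_data_of_lt hconf hξ₀ h.1 fun _ => Or.inr h.2
      · refine C1On_data_of_le hconf hξ₀ hP hC (fun σ t α hα β hβ => ?_) fun σ t α hα => ?_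
        · obtain ⟨F, hF, hcF, hL⟩ :=
            exists_continuous_of_lipschitzOnWith (hx t) (h.1 σ t α hα β hβ)
          exact ⟨F, hF, hcF, fun _ => hL⟩
        · obtain ⟨F, hF, hfF, hL⟩ := exists_continuous_of_lipschitzOnWith (hx t) (h.2 σ t α hα)
          exact ⟨F, hF, hfF, fun _ => hL⟩
    · refine C1On_data_of_le hconf hξ₀ hP hC (fun σ t α hα β hβ => ?_) fun σ t α hα => ?_
      · obtain ⟨F, hF, hcF⟩ := (hc σ t α hα β hβ).exists_continuous (Q.xm_lt_xp t)
        exact ⟨F, hF, hcF, fun h => absurd h hlip⟩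
      · obtain ⟨F, hF, hfF⟩ := (hf σ t α hα).exists_continuous (Q.xm_lt_xp t)
        exact ⟨F, hF, hfF, fun h => absurd h hlip⟩

variable (E) in
/-- The optimal linear parameters. -/
noncomputable def optCoeff (ξ : Q.KnotSpace) : Q.CoeffSpace :=
  WithLp.toLp 2 (Matrix.mulVec (E.stiffness ξ)⁻¹ (E.load ξ))

theorem discreteEnergy_optCoeff_le (hconf : E.Conforming) {ξ : Q.KnotSpace}
    (hξ : ξ ∈ Q.admissible) (hanch : ∀ s s', s ≠ s' → Q.Anchored ξ s ∨ Q.Anchored ξ s')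
    (w : Q.CoeffSpace) : E.discreteEnergy (E.optCoeff ξ) ξ ≤ E.discreteEnergy w ξ := by
  rw [discreteEnergy_eq hconf hξ, discreteEnergy_eq hconf hξ]
  exact quadEnergy_min (isSymm_stiffness ξ) (stiffness_pos hconf hξ hanch) _ _

theorem eq_optCoeff (hconf : E.Conforming) {ξ : Q.KnotSpace} (hξ : ξ ∈ Q.admissible)
    (hanch : ∀ s s', s ≠ s' → Q.Anchored ξ s ∨ Q.Anchored ξ s') {w : Q.CoeffSpace}
    (h : ∀ w', E.discreteEnergy w ξ ≤ E.discreteEnergy w' ξ) : w = E.optCoeff ξ := by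
  have h₁ := h (E.optCoeff ξ)
  rw [discreteEnergy_eq hconf hξ, discreteEnergy_eq hconf hξ] at h₁
  exact WithLp.ofLp_injective 2
    (eq_of_quadEnergy_le (isSymm_stiffness ξ) (stiffness_pos hconf hξ hanch) h₁)

theorem reducedEnergy_eq (hconf : E.Conforming) {ξ : Q.KnotSpace} (hξ : ξ ∈ Q.admissible)
    (hanch : ∀ s s', s ≠ s' → Q.Anchored ξ s ∨ Q.Anchored ξ s') :
    E.reducedEnergy ξ = E.discreteEnergy (E.optCoeff ξ) ξ :=
  le_antisymm (ciInf_le ⟨E.discreteEnergy (E.optCoeff ξ) ξ, by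
      rintro _ ⟨w, rfl⟩
      exact discreteEnergy_optCoeff_le hconf hξ hanch w⟩ _)
    (le_ciInf fun w => discreteEnergy_optCoeff_le hconf hξ hanch w)

theorem reducedEnergy_le (hconf : E.Conforming) {ξ : Q.KnotSpace} (hξ : ξ ∈ Q.admissible)
    (hanch : ∀ s s', s ≠ s' → Q.Anchored ξ s ∨ Q.Anchored ξ s') (w : Q.CoeffSpace) :
    E.reducedEnergy ξ ≤ E.discreteEnergy w ξ :=
  (reducedEnergy_eq hconf hξ hanch).trans_le (discreteEnergy_optCoeff_le hconf hξ hanch w)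

section Component

variable {ξ₀ : Q.KnotSpace}

theorem C1On_optCoeff (hconf : E.Conforming) (hξ₀ : ξ₀ ∈ Q.admissible)
    (hanch : ∀ ξ ∈ Q.component ξ₀, ∀ s s', s ≠ s' → Q.Anchored ξ s ∨ Q.Anchored ξ s')
    (hdeg : E.DegreeCondition (Q.component ξ₀)) {lip : Prop} (hl : lip → E.LipschitzData)
    (i : Q.BasisIndex) : C1On lip (Q.component ξ₀) fun ξ => E.optCoeff ξ i := by
  obtain ⟨hA, hb⟩ := C1On_data hconf hξ₀ hdeg hl
  exact C1On.inv_mulVec (Patches.isCompact_component hξ₀) (Patches.convex_component hξ₀) hA hb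
    (fun ξ hξ => det_ne_zero_of_pos (stiffness_pos hconf hξ.1 (hanch ξ hξ))) i

theorem C1On_reducedEnergy (hconf : E.Conforming) (hξ₀ : ξ₀ ∈ Q.admissible)
    (hanch : ∀ ξ ∈ Q.component ξ₀, ∀ s s', s ≠ s' → Q.Anchored ξ s ∨ Q.Anchored ξ s')
    (hdeg : E.DegreeCondition (Q.component ξ₀)) {lip : Prop} (hl : lip → E.LipschitzData) :
    C1On lip (Q.component ξ₀) E.reducedEnergy := by
  obtain ⟨hA, hb⟩ := C1On_data hconf hξ₀ hdeg hl
  refine (C1On.quadEnergy (Patches.isCompact_component hξ₀) (Patches.convex_component hξ₀) hA hb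
    (C1On_optCoeff hconf hξ₀ hanch hdeg hl)).congr fun ξ hξ => ?_
  rw [reducedEnergy_eq hconf hξ.1 (hanch ξ hξ), discreteEnergy_eq hconf hξ.1]

theorem continuousOn_optCoeff (hconf : E.Conforming) (hξ₀ : ξ₀ ∈ Q.admissible)
    (hanch : ∀ ξ ∈ Q.component ξ₀, ∀ s s', s ≠ s' → Q.Anchored ξ s ∨ Q.Anchored ξ s')
    (hdeg : E.DegreeCondition (Q.component ξ₀)) : ContinuousOn E.optCoeff (Q.component ξ₀) :=
  (PiLp.continuous_toLp 2 _).comp_continuousOn (continuousOn_pi.2 fun i =>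
    (C1On_optCoeff hconf hξ₀ hanch hdeg (lip := False) False.elim i).continuousOn)

/-- The gradient of the reduced energy is the partial gradient of the discrete energy at the
optimal linear parameters. -/
theorem hasGradientWithinAt_iff (hconf : E.Conforming) (hξ₀ : ξ₀ ∈ Q.admissible)
    (hanch : ∀ ξ ∈ Q.component ξ₀, ∀ s s', s ≠ s' → Q.Anchored ξ s ∨ Q.Anchored ξ s')
    (hdeg : E.DegreeCondition (Q.component ξ₀)) {ξ g : Q.KnotSpace}
    (hξ : ξ ∈ Q.component ξ₀) :
    HasGradientWithinAt (fun η => E.discreteEnergy (E.optCoeff ξ) η) g (Q.component ξ₀) ξ ↔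
      HasGradientWithinAt E.reducedEnergy g (Q.component ξ₀) ξ := by
  obtain ⟨hA, -⟩ := C1On_data hconf hξ₀ hdeg (lip := False) False.elim
  have hdiff : ∀ {F : Q.KnotSpace → ℝ}, C1On False (Q.component ξ₀) F →
      DifferentiableWithinAt ℝ F (Q.component ξ₀) ξ := fun hF => by
    obtain ⟨f, hf, -⟩ := hF
    exact (hf ξ hξ).differentiableWithinAt
  -- Envelope argument: the energy with frozen coefficients exceeds the reduced energy by a
  -- quadratic form in the difference of the optimal coefficients, which has zero derivative at ξ.
  have h0 := hasFDerivWithinAt_quadForm_zero (C := Q.component ξ₀) (ξ := ξ) (A := E.stiffness)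
    (e := fun η => ⇑(E.optCoeff ξ) - ⇑(E.optCoeff η)) (fun i j => hdiff (hA i j))
    (fun i => (hdiff ((C1On.const False _ (E.optCoeff ξ i)).add
      ((C1On.const False _ (-1)).mul (Patches.isCompact_component hξ₀)
        (Patches.convex_component hξ₀) (C1On_optCoeff hconf hξ₀ hanch hdeg False.elim i)))).congr
      (fun η _ => by simp [sub_eq_add_neg]) (by simp)) (sub_self _)
  have he : ∀ η ∈ Q.component ξ₀, E.discreteEnergy (E.optCoeff ξ) η = E.reducedEnergy η +
      (⇑(E.optCoeff ξ) - ⇑(E.optCoeff η)) ⬝ᵥ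
        Matrix.mulVec (E.stiffness η) (⇑(E.optCoeff ξ) - ⇑(E.optCoeff η)) / 2 := fun η hη => by
    rw [reducedEnergy_eq hconf hη.1 (hanch η hη), discreteEnergy_eq hconf hη.1,
      discreteEnergy_eq hconf hη.1]
    exact quadEnergy_eq (isSymm_stiffness η)
      (det_ne_zero_of_pos (stiffness_pos hconf hη.1 (hanch η hη))) _ _
  constructor
  · intro h
    have h₁ := h.hasFDerivWithinAt.sub h0
    rw [sub_zero] at h₁
    exact h₁.congr (fun η hη => by simp [he η hη]) (by simp [he ξ hξ])
  · intro h
    have h₁ := h.hasFDerivWithinAt.add h0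
    rw [add_zero] at h₁
    exact h₁.congr (fun η hη => by simp [he η hη]) (by simp [he ξ hξ])

theorem isMirrorStep_iff (hconf : E.Conforming) (hξ₀ : ξ₀ ∈ Q.admissible)
    (hanch : ∀ ξ ∈ Q.component ξ₀, ∀ s s', s ≠ s' → Q.Anchored ξ s ∨ Q.Anchored ξ s')
    (hdeg : E.DegreeCondition (Q.component ξ₀)) {ψ : Q.KnotSpace → ℝ} {γ : ℝ}
    {ξ ξ' : Q.KnotSpace} (hξ : ξ ∈ Q.component ξ₀) :
    IsMirrorStep ψ (Q.component ξ₀) γ (fun η => E.discreteEnergy (E.optCoeff ξ) η) ξ ξ' ↔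
      IsMirrorStep ψ (Q.component ξ₀) γ E.reducedEnergy ξ ξ' := by
  unfold IsMirrorStep
  simp only [hasGradientWithinAt_iff hconf hξ₀ hanch hdeg hξ]

/-- Uniqueness of the linear solve forces the coefficients, so the knots of a run are exactly the
mirror descent iterates of the reduced energy. -/
theorem isRun_iff (hconf : E.Conforming) (hξ₀ : ξ₀ ∈ Q.admissible)
    (hanch : ∀ ξ ∈ Q.component ξ₀, ∀ s s', s ≠ s' → Q.Anchored ξ s ∨ Q.Anchored ξ s')
    (hdeg : E.DegreeCondition (Q.component ξ₀)) {ψ : Q.KnotSpace → ℝ} {γ : ℝ}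
    {w : ℕ → Q.CoeffSpace} {ξ : ℕ → Q.KnotSpace} :
    E.IsRun ψ (Q.component ξ₀) γ ξ₀ w ξ ↔ ξ 0 = ξ₀ ∧ (∀ n, w n = E.optCoeff (ξ n)) ∧
      ∀ n, IsMirrorStep ψ (Q.component ξ₀) γ E.reducedEnergy (ξ n) (ξ (n + 1)) := by
  constructor
  · rintro ⟨h0, hw, hstep⟩
    have hmem : ∀ n, ξ n ∈ Q.component ξ₀ := fun n => by
      cases n with
      | zero => rw [h0]; exact Patches.self_mem_component hξ₀
      | succ n => obtain ⟨_, _, h, _⟩ := hstep n; exact h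
    have hw' : ∀ n, w n = E.optCoeff (ξ n) := fun n =>
      eq_optCoeff hconf (hmem n).1 (hanch _ (hmem n)) fun w' => hw n (mem_univ w')
    refine ⟨h0, hw', fun n => ?_⟩
    have := hstep n
    rw [hw' n] at this
    exact (isMirrorStep_iff hconf hξ₀ hanch hdeg (hmem n)).1 this
  · rintro ⟨h0, hw, hstep⟩
    have hmem := mem_of_isMirrorStep (h0.symm ▸ Patches.self_mem_component hξ₀ :
      ξ 0 ∈ Q.component ξ₀) hstep
    refine ⟨h0, fun n w' _ => ?_, fun n => ?_⟩
    · rw [hw n]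
      exact discreteEnergy_optCoeff_le hconf (hmem n).1 (hanch _ (hmem n)) w'
    · rw [hw n]
      exact (isMirrorStep_iff hconf hξ₀ hanch hdeg (hmem n)).2 (hstep n)

theorem exists_isRun (hconf : E.Conforming) (hξ₀ : ξ₀ ∈ Q.admissible)
    (hanch : ∀ ξ ∈ Q.component ξ₀, ∀ s s', s ≠ s' → Q.Anchored ξ s ∨ Q.Anchored ξ s')
    (hdeg : E.DegreeCondition (Q.component ξ₀)) {ψ : Q.KnotSpace → ℝ}
    (hψ : IsMirrorMap (Q.component ξ₀) ψ) (γ : ℝ) :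
    ∃ w ξ, E.IsRun ψ (Q.component ξ₀) γ ξ₀ w ξ := by
  obtain ⟨g, hg, -⟩ :=
    (C1On_reducedEnergy hconf hξ₀ hanch hdeg (lip := False) False.elim).exists_gradient
  have hstep : ∀ ξ : Q.component ξ₀, ∃ ξ' : Q.component ξ₀,
      IsMirrorStep ψ (Q.component ξ₀) γ E.reducedEnergy ξ ξ' := fun ξ => by
    obtain ⟨ξ', h⟩ :=
      exists_isMirrorStep (Patches.isCompact_component hξ₀) hψ γ ξ.2 (hg ξ ξ.2)
    obtain ⟨_, _, h', _⟩ := id h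
    exact ⟨⟨ξ', h'⟩, h⟩
  choose next hnext using hstep
  let ξ : ℕ → Q.component ξ₀ := fun n => next^[n] ⟨ξ₀, Patches.self_mem_component hξ₀⟩
  refine ⟨fun n => E.optCoeff (ξ n), fun n => ξ n,
    (isRun_iff hconf hξ₀ hanch hdeg).2 ⟨rfl, fun n => rfl, fun n => ?_⟩⟩
  have : ξ (n + 1) = next (ξ n) := Function.iterate_succ_apply' ..
  rw [this]
  exact hnext (ξ n)

theorem isGlobalMin_iff (hconf : E.Conforming)
    (hanch : ∀ ξ ∈ Q.component ξ₀, ∀ s s', s ≠ s' → Q.Anchored ξ s ∨ Q.Anchored ξ s')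
    {w : Q.CoeffSpace} {ξ : Q.KnotSpace} :
    E.IsGlobalMin (Q.component ξ₀) w ξ ↔ ξ ∈ Q.component ξ₀ ∧ w = E.optCoeff ξ ∧
      ∀ η ∈ Q.component ξ₀, E.reducedEnergy ξ ≤ E.reducedEnergy η := by
  constructor
  · rintro ⟨hξ, h⟩
    have hw := eq_optCoeff hconf hξ.1 (hanch ξ hξ) fun w' => h w' ξ hξ
    refine ⟨hξ, hw, fun η hη => ?_⟩
    rw [reducedEnergy_eq hconf hξ.1 (hanch ξ hξ), reducedEnergy_eq hconf hη.1 (hanch η hη), ← hw]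
    exact h _ η hη
  · rintro ⟨hξ, rfl, h⟩
    refine ⟨hξ, fun w' η hη => ?_⟩
    rw [← reducedEnergy_eq hconf hξ.1 (hanch ξ hξ)]
    exact (h η hη).trans (reducedEnergy_le hconf hη.1 (hanch η hη) w')

theorem mem_minimisers_iff (hconf : E.Conforming)
    (hanch : ∀ ξ ∈ Q.component ξ₀, ∀ s s', s ≠ s' → Q.Anchored ξ s ∨ Q.Anchored ξ s')
    {ξ : Q.KnotSpace} :
    ξ ∈ E.minimisers (Q.component ξ₀) ↔ ξ ∈ Q.component ξ₀ ∧
      ∀ η ∈ Q.component ξ₀, E.reducedEnergy ξ ≤ E.reducedEnergy η := by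
  constructor
  · rintro ⟨w, hw⟩
    obtain ⟨h₁, -, h₂⟩ := (isGlobalMin_iff hconf hanch).1 hw
    exact ⟨h₁, h₂⟩
  · rintro ⟨h₁, h₂⟩
    exact ⟨_, (isGlobalMin_iff hconf hanch).2 ⟨h₁, rfl, h₂⟩⟩

theorem exists_isGlobalMin (hconf : E.Conforming) (hξ₀ : ξ₀ ∈ Q.admissible)
    (hanch : ∀ ξ ∈ Q.component ξ₀, ∀ s s', s ≠ s' → Q.Anchored ξ s ∨ Q.Anchored ξ s')
    (hdeg : E.DegreeCondition (Q.component ξ₀)) :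
    ∃ w ξ, E.IsGlobalMin (Q.component ξ₀) w ξ := by
  obtain ⟨ξ, hξ, hmin⟩ := (Patches.isCompact_component hξ₀).exists_isMinOn
    ⟨ξ₀, Patches.self_mem_component hξ₀⟩
    (C1On_reducedEnergy hconf hξ₀ hanch hdeg (lip := False) False.elim).continuousOn
  exact ⟨_, ξ, (isGlobalMin_iff hconf hanch).2 ⟨hξ, rfl, fun η hη => hmin hη⟩⟩

end Component

/-! ### Energy gaps as squared errors. -/

theorem a_eq_ell {ustar : U} (hustar : ∀ v, E.energy ustar ≤ E.energy v) (v : U) :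
    E.a ustar v = E.ell v := by
  obtain ⟨c, hc, hcoer⟩ := E.coercive
  have hy : 0 ≤ E.a v v := (by positivity : 0 ≤ c * ‖v‖ * ‖v‖).trans (hcoer v)
  have h : ∀ t : ℝ, 0 ≤ t * (E.a ustar v - E.ell v) + t ^ 2 * (E.a v v / 2) := fun t => by
    have := hustar (ustar + t • v)
    simp only [energy, map_add, map_smul, _root_.add_apply, _root_.smul_apply, smul_eq_mul] at this
    rw [E.symm v ustar] at this
    linarith
  set x := E.a ustar v - E.ell v with hx
  set y := E.a v v / 2 with hy'
  have hy₁ : 0 < y + 1 := by linarith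
  -- Dividing by y + 1 rather than y avoids the case a(v, v) = 0; the value is -(x / (y + 1))² in
  -- any case.
  have h₁ := h (-x / (y + 1))
  have e : -x / (y + 1) * x + (-x / (y + 1)) ^ 2 * y = -(x / (y + 1)) ^ 2 := by
    field_simp
    ring
  rw [e] at h₁
  have h₂ : x / (y + 1) = 0 := pow_eq_zero_iff two_ne_zero |>.1
    (by nlinarith [sq_nonneg (x / (y + 1))])
  have h₃ : x = 0 := (div_eq_zero_iff.1 h₂).resolve_right hy₁.ne'
  linarith

/-- By a(u⋆, v) = ℓ(v), the energy is half the squared distance to u⋆ up to a constant; minimising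
it is best approximation in the energy norm. -/
theorem normSq_sub {ustar : U} (hustar : ∀ v, E.energy ustar ≤ E.energy v) (v : U) :
    E.normSq (v - ustar) = 2 * (E.energy v - E.energy ustar) := by
  have h₁ := a_eq_ell hustar v
  have h₂ := a_eq_ell hustar ustar
  simp only [normSq, energy, map_sub, _root_.sub_apply, E.symm v ustar, h₁, h₂]
  ring

theorem bestErrorSq_eq {S : Set Q.KnotSpace} {ustar : U}
    (hustar : ∀ v, E.energy ustar ≤ E.energy v) {w : Q.CoeffSpace} {ξ : Q.KnotSpace}
    (h : E.IsGlobalMin S w ξ) :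
    E.bestErrorSq S ustar = 2 * (E.discreteEnergy w ξ - E.energy ustar) := by
  have hmem : E.realise w ξ ∈ E.approxSpace S := ⟨w, ξ, h.1, rfl⟩
  have : Nonempty (E.approxSpace S) := ⟨⟨_, hmem⟩⟩
  have hle : ∀ v : E.approxSpace S,
      2 * (E.discreteEnergy w ξ - E.energy ustar) ≤ E.normSq (v - ustar) := by
    rintro ⟨_, w', ξ', hξ', rfl⟩
    rw [normSq_sub hustar]
    have := h.2 w' ξ' hξ'
    simp only [discreteEnergy] at this ⊢
    linarith
  refine le_antisymm ((ciInf_le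
    ⟨2 * (E.discreteEnergy w ξ - E.energy ustar), ?_⟩ (⟨_, hmem⟩ : E.approxSpace S)).trans_eq
    (normSq_sub hustar _)) (le_ciInf hle)
  rintro _ ⟨v, rfl⟩
  exact hle v

end Problem

/-! ### Convergence and error bounds along runs. -/

namespace Problem

variable {d r : ℕ} {Q : Patches d r} {U : Type*} [NormedAddCommGroup U] [InnerProductSpace ℝ U]
  {E : Problem Q U} {ξ₀ : Q.KnotSpace} {ψ : Q.KnotSpace → ℝ} {L : ℝ} {w : ℕ → Q.CoeffSpace}
  {ξ : ℕ → Q.KnotSpace}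

theorem discreteEnergy_run (hconf : E.Conforming) (hξ₀ : ξ₀ ∈ Q.admissible)
    (hanch : ∀ ξ ∈ Q.component ξ₀, ∀ s s', s ≠ s' → Q.Anchored ξ s ∨ Q.Anchored ξ s')
    (hdeg : E.DegreeCondition (Q.component ξ₀)) {γ : ℝ}
    (hrun : E.IsRun ψ (Q.component ξ₀) γ ξ₀ w ξ) (n : ℕ) :
    E.discreteEnergy (w n) (ξ n) = E.reducedEnergy (ξ n) := by
  obtain ⟨h0, hw, hstep⟩ := (isRun_iff hconf hξ₀ hanch hdeg).1 hrun
  have hmem := mem_of_isMirrorStep (h0.symm ▸ Patches.self_mem_component hξ₀ :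
    ξ 0 ∈ Q.component ξ₀) hstep n
  rw [hw n, reducedEnergy_eq hconf hmem.1 (hanch _ hmem)]

theorem antitone_run (hconf : E.Conforming) (hξ₀ : ξ₀ ∈ Q.admissible)
    (hanch : ∀ ξ ∈ Q.component ξ₀, ∀ s s', s ≠ s' → Q.Anchored ξ s ∨ Q.Anchored ξ s')
    (hdeg : E.DegreeCondition (Q.component ξ₀)) (hψ : IsMirrorMap (Q.component ξ₀) ψ)
    (hL : 0 < L) (hF : HasLipschitzGradientOn E.reducedEnergy (Q.component ξ₀) L)
    (hrun : E.IsRun ψ (Q.component ξ₀) (1 / L) ξ₀ w ξ) :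
    Antitone fun n => E.discreteEnergy (w n) (ξ n) := by
  simp only [discreteEnergy_run hconf hξ₀ hanch hdeg hrun]
  obtain ⟨h0, -, hstep⟩ := (isRun_iff hconf hξ₀ hanch hdeg).1 hrun
  exact antitone_of_isMirrorStep hψ hL hF (h0 ▸ Patches.self_mem_component (h0.symm ▸ hξ₀)) hstep

theorem mem_convexTargets_iff (hconf : E.Conforming)
    (hanch : ∀ ξ ∈ Q.component ξ₀, ∀ s s', s ≠ s' → Q.Anchored ξ s ∨ Q.Anchored ξ s')
    {η : Q.KnotSpace} :
    η ∈ E.convexTargets (Q.component ξ₀) ↔ (η ∈ Q.component ξ₀ ∧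
      ∀ ξ ∈ Q.component ξ₀, E.reducedEnergy η ≤ E.reducedEnergy ξ) ∧
      ConvexToward E.reducedEnergy (Q.component ξ₀) η := by
  rw [← mem_minimisers_iff hconf hanch]
  rfl

theorem iInf_discreteEnergy (hconf : E.Conforming)
    (hanch : ∀ ξ ∈ Q.component ξ₀, ∀ s s', s ≠ s' → Q.Anchored ξ s ∨ Q.Anchored ξ s')
    {η : Q.KnotSpace} (hη : η ∈ Q.component ξ₀)
    (hmin : ∀ ξ ∈ Q.component ξ₀, E.reducedEnergy η ≤ E.reducedEnergy ξ) :
    ⨅ q : Q.CoeffSpace × Q.component ξ₀, E.discreteEnergy q.1 q.2 = E.reducedEnergy η := by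
  have hl : IsLeast (range fun q : Q.CoeffSpace × Q.component ξ₀ => E.discreteEnergy q.1 q.2)
      (E.reducedEnergy η) :=
    ⟨⟨(E.optCoeff η, ⟨η, hη⟩), (reducedEnergy_eq hconf hη.1 (hanch η hη)).symm⟩,
      forall_mem_range.2 fun q =>
        (hmin _ q.2.2).trans (reducedEnergy_le hconf q.2.2.1 (hanch _ q.2.2) q.1)⟩
  exact hl.csInf_eq

theorem tendsto_discreteEnergy_run (hconf : E.Conforming) (hξ₀ : ξ₀ ∈ Q.admissible)
    (hanch : ∀ ξ ∈ Q.component ξ₀, ∀ s s', s ≠ s' → Q.Anchored ξ s ∨ Q.Anchored ξ s')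
    (hdeg : E.DegreeCondition (Q.component ξ₀)) (hψ : IsMirrorMap (Q.component ξ₀) ψ)
    (hL : 0 < L) (hF : HasLipschitzGradientOn E.reducedEnergy (Q.component ξ₀) L)
    (hrun : E.IsRun ψ (Q.component ξ₀) (1 / L) ξ₀ w ξ) {η : Q.KnotSpace}
    (hη : η ∈ E.convexTargets (Q.component ξ₀)) :
    Tendsto (fun n => E.discreteEnergy (w n) (ξ n)) atTop (𝓝 (E.reducedEnergy η)) := by
  simp only [discreteEnergy_run hconf hξ₀ hanch hdeg hrun]
  obtain ⟨h0, -, hstep⟩ := (isRun_iff hconf hξ₀ hanch hdeg).1 hrun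
  obtain ⟨⟨hηC, hmin⟩, hconv⟩ := (mem_convexTargets_iff hconf hanch).1 hη
  exact tendsto_value_of_isMirrorStep hψ hL hF
    (h0.symm ▸ Patches.self_mem_component hξ₀ : ξ 0 ∈ Q.component ξ₀) hstep hηC hconv hmin

/-- The coefficients are a continuous function of the knots on the closed component, so limits of
pairs inherit both optimality and the limit value. -/
theorem isGlobalMin_of_mapClusterPt (hconf : E.Conforming) (hξ₀ : ξ₀ ∈ Q.admissible)
    (hanch : ∀ ξ ∈ Q.component ξ₀, ∀ s s', s ≠ s' → Q.Anchored ξ s ∨ Q.Anchored ξ s')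
    (hdeg : E.DegreeCondition (Q.component ξ₀)) (hψ : IsMirrorMap (Q.component ξ₀) ψ)
    (hL : 0 < L) (hF : HasLipschitzGradientOn E.reducedEnergy (Q.component ξ₀) L)
    (hrun : E.IsRun ψ (Q.component ξ₀) (1 / L) ξ₀ w ξ) {η : Q.KnotSpace}
    (hη : η ∈ E.convexTargets (Q.component ξ₀)) {w' : Q.CoeffSpace} {ξ' : Q.KnotSpace}
    (h : MapClusterPt (w', ξ') atTop fun n => (w n, ξ n)) :
    E.IsGlobalMin (Q.component ξ₀) w' ξ' := by
  have hval := tendsto_discreteEnergy_run hconf hξ₀ hanch hdeg hψ hL hF hrun hη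
  simp only [discreteEnergy_run hconf hξ₀ hanch hdeg hrun] at hval
  obtain ⟨h0, hw, hstep⟩ := (isRun_iff hconf hξ₀ hanch hdeg).1 hrun
  obtain ⟨⟨hηC, hmin⟩, -⟩ := (mem_convexTargets_iff hconf hanch).1 hη
  have hmem := mem_of_isMirrorStep
    (h0.symm ▸ Patches.self_mem_component hξ₀ : ξ 0 ∈ Q.component ξ₀) hstep
  obtain ⟨φ, hφ, hlim⟩ := h.tendsto_subseq
  have hlw : Tendsto (fun n => w (φ n)) atTop (𝓝 w') := (continuous_fst.tendsto _).comp hlim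
  have hlξ : Tendsto (fun n => ξ (φ n)) atTop (𝓝 ξ') := (continuous_snd.tendsto _).comp hlim
  have hξ' : ξ' ∈ Q.component ξ₀ := (Patches.isCompact_component hξ₀).isClosed.mem_of_tendsto hlξ
    (Eventually.of_forall fun n => hmem _)
  have hlξ' : Tendsto (fun n => ξ (φ n)) atTop (𝓝[Q.component ξ₀] ξ') :=
    tendsto_nhdsWithin_iff.2 ⟨hlξ, Eventually.of_forall fun n => hmem _⟩
  have hw' : w' = E.optCoeff ξ' := by
    refine tendsto_nhds_unique hlw ?_
    simp only [hw]
    exact (continuousOn_optCoeff hconf hξ₀ hanch hdeg ξ' hξ').tendsto.comp hlξ'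
  have hv : E.reducedEnergy ξ' = E.reducedEnergy η :=
    tendsto_nhds_unique
      (((C1On_reducedEnergy hconf hξ₀ hanch hdeg (lip := False) False.elim).continuousOn ξ'
        hξ').tendsto.comp hlξ') (hval.comp hφ.tendsto_atTop)
  exact (isGlobalMin_iff hconf hanch).2 ⟨hξ', hw', fun x hx => hv.trans_le (hmin x hx)⟩

theorem tendsto_run (hconf : E.Conforming) (hξ₀ : ξ₀ ∈ Q.admissible)
    (hanch : ∀ ξ ∈ Q.component ξ₀, ∀ s s', s ≠ s' → Q.Anchored ξ s ∨ Q.Anchored ξ s')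
    (hdeg : E.DegreeCondition (Q.component ξ₀)) (hψ : IsMirrorMap (Q.component ξ₀) ψ)
    (hL : 0 < L) (hF : HasLipschitzGradientOn E.reducedEnergy (Q.component ξ₀) L)
    (hrun : E.IsRun ψ (Q.component ξ₀) (1 / L) ξ₀ w ξ) {η : Q.KnotSpace}
    (hη : η ∈ E.convexTargets (Q.component ξ₀))
    (hall : E.convexTargets (Q.component ξ₀) = E.minimisers (Q.component ξ₀)) :
    ∃ w' ξ', E.IsGlobalMin (Q.component ξ₀) w' ξ' ∧ Tendsto w atTop (𝓝 w') ∧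
      Tendsto ξ atTop (𝓝 ξ') := by
  obtain ⟨h0, hw, hstep⟩ := (isRun_iff hconf hξ₀ hanch hdeg).1 hrun
  obtain ⟨⟨hηC, hmin⟩, -⟩ := (mem_convexTargets_iff hconf hanch).1 hη
  have h0C : ξ 0 ∈ Q.component ξ₀ := h0.symm ▸ Patches.self_mem_component hξ₀
  have hmem := mem_of_isMirrorStep h0C hstep
  obtain ⟨y, hy, hFy, hlim⟩ := tendsto_of_isMirrorStep (Patches.isCompact_component hξ₀) hψ hL hF
    h0C hstep hηC hmin fun y hy hFy => by
      have : y ∈ E.minimisers (Q.component ξ₀) :=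
        (mem_minimisers_iff hconf hanch).2 ⟨hy, fun x hx => hFy.trans_le (hmin x hx)⟩
      rw [← hall] at this
      exact ((mem_convexTargets_iff hconf hanch).1 this).2
  refine ⟨E.optCoeff y, y,
    (isGlobalMin_iff hconf hanch).2 ⟨hy, rfl, fun x hx => hFy.trans_le (hmin x hx)⟩, ?_, hlim⟩
  rw [funext hw]
  exact (continuousOn_optCoeff hconf hξ₀ hanch hdeg y hy).tendsto.comp
    (tendsto_nhdsWithin_iff.2 ⟨hlim, Eventually.of_forall hmem⟩)

theorem deltaStar_nonneg (hconf : E.Conforming) (hξ₀ : ξ₀ ∈ Q.admissible)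
    (hanch : ∀ ξ ∈ Q.component ξ₀, ∀ s s', s ≠ s' → Q.Anchored ξ s ∨ Q.Anchored ξ s')
    (hψ : IsMirrorMap (Q.component ξ₀) ψ) : 0 ≤ E.deltaStar ψ (Q.component ξ₀) ξ₀ :=
  Real.iInf_nonneg fun ξ' => hψ.bregman_nonneg
    ((mem_convexTargets_iff hconf hanch).1 ξ'.2).1.1 (Patches.self_mem_component hξ₀)

theorem normSq_run_le (hconf : E.Conforming) (hξ₀ : ξ₀ ∈ Q.admissible)
    (hanch : ∀ ξ ∈ Q.component ξ₀, ∀ s s', s ≠ s' → Q.Anchored ξ s ∨ Q.Anchored ξ s')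
    (hdeg : E.DegreeCondition (Q.component ξ₀)) (hψ : IsMirrorMap (Q.component ξ₀) ψ)
    (hL : 0 < L) (hF : HasLipschitzGradientOn E.reducedEnergy (Q.component ξ₀) L)
    (hrun : E.IsRun ψ (Q.component ξ₀) (1 / L) ξ₀ w ξ)
    (hne : (E.convexTargets (Q.component ξ₀)).Nonempty) {ustar : U}
    (hustar : ∀ v, E.energy ustar ≤ E.energy v) {n : ℕ} (hn : 1 ≤ n) :
    E.normSq (E.realise (w n) (ξ n) - ustar) ≤ E.bestErrorSq (Q.component ξ₀) ustar +
      2 * L * E.deltaStar ψ (Q.component ξ₀) ξ₀ / n := by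
  have hne' : Nonempty (E.convexTargets (Q.component ξ₀)) := hne.to_subtype
  obtain ⟨η, hη⟩ := hne
  have hval := discreteEnergy_run hconf hξ₀ hanch hdeg hrun n
  obtain ⟨h0, hw, hstep⟩ := (isRun_iff hconf hξ₀ hanch hdeg).1 hrun
  obtain ⟨⟨hηC, hmin⟩, -⟩ := (mem_convexTargets_iff hconf hanch).1 hη
  have h0C : ξ 0 ∈ Q.component ξ₀ := h0.symm ▸ Patches.self_mem_component hξ₀
  have hn' : (0 : ℝ) < n := by exact_mod_cast hn
  have hδ : (E.reducedEnergy (ξ n) - E.reducedEnergy η) * n / L ≤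
      E.deltaStar ψ (Q.component ξ₀) ξ₀ := by
    refine le_ciInf fun ξ' => ?_
    obtain ⟨⟨hC, hmin'⟩, hconv⟩ := (mem_convexTargets_iff hconf hanch).1 ξ'.2
    have h₁ := sub_le_div_of_isMirrorStep hψ hL hF h0C hstep hC hconv hn
    -- All targets have the same minimal energy, so the bound for each one controls the same gap and
    -- the infimum of the divergences may be taken.
    rw [le_div_iff₀ hn', h0, le_antisymm (hmin' η hηC) (hmin _ hC)] at h₁
    rw [div_le_iff₀ hL]
    linarith
  rw [bestErrorSq_eq hustar ((isGlobalMin_iff hconf hanch).2 ⟨hηC, rfl, hmin⟩),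
    ← reducedEnergy_eq hconf hηC.1 (hanch η hηC), normSq_sub hustar]
  change 2 * (E.discreteEnergy (w n) (ξ n) - _) ≤ _
  rw [hval]
  rw [div_le_iff₀ hL] at hδ
  have : E.reducedEnergy (ξ n) - E.reducedEnergy η ≤
      E.deltaStar ψ (Q.component ξ₀) ξ₀ * L / n := (le_div_iff₀ hn').2 hδ
  have e : 2 * L * E.deltaStar ψ (Q.component ξ₀) ξ₀ / n =
      2 * (E.deltaStar ψ (Q.component ξ₀) ξ₀ * L / n) := by ring
  rw [e]
  linarith

theorem bestErrorSq_nonneg {S : Set Q.KnotSpace} (u : U) : 0 ≤ E.bestErrorSq S u :=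
  Real.iInf_nonneg fun v => by
    obtain ⟨c, hc, hcoer⟩ := E.coercive
    exact (by positivity : 0 ≤ c * ‖(v : U) - u‖ * ‖(v : U) - u‖).trans (hcoer _)

end Problem

theorem sqrt_le_sqrt_add_sqrt_mul_rpow {x y z : ℝ} (hy : 0 ≤ y) (hz : 0 ≤ z) (n : ℕ)
    (h : x ≤ y + z / n) : √x ≤ √y + √z * (n : ℝ) ^ (-(1 / 2) : ℝ) := by
  have e : √z * (n : ℝ) ^ (-(1 / 2) : ℝ) = √(z / n) := by
    rw [Real.sqrt_div hz, Real.rpow_neg (Nat.cast_nonneg n), ← Real.sqrt_eq_rpow, div_eq_mul_inv]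
  rw [e, Real.sqrt_le_iff]
  have hzn : 0 ≤ z / n := by positivity
  refine ⟨by positivity, h.trans ?_⟩
  have h₁ := Real.sq_sqrt hy
  have h₂ := Real.sq_sqrt hzn
  have h₃ : 0 ≤ √y * √(z / n) := by positivity
  nlinarith

end FreeKnot

theorem mainTheorem1 {d r : ℕ} (hd : 1 ≤ d) (hr : 1 ≤ r) (Q : FreeKnot.Patches d r)
    {U : Type*} [NormedAddCommGroup U] [InnerProductSpace ℝ U] [CompleteSpace U]
    (E : FreeKnot.Problem Q U) (hconf : E.Conforming)
    (ξ₀ : Q.KnotSpace) (hξ₀ : ξ₀ ∈ Q.admissible)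
    (hdeg : E.DegreeCondition (Q.component ξ₀))
    (hanch : ∀ ξ ∈ Q.component ξ₀, ∀ s s', s ≠ s' → Q.Anchored ξ s ∨ Q.Anchored ξ s')
    (ψ : Q.KnotSpace → ℝ) (hψ : FreeKnot.IsMirrorMap (Q.component ξ₀) ψ)
    (ustar : U) (hustar : ∀ v, E.energy ustar ≤ E.energy v) :
    -- the component is convex, and it is everything in the case of a single patch
    Convex ℝ (Q.component ξ₀) ∧
    (r = 1 → Q.component ξ₀ = Q.admissible) ∧
    -- the discrete energy has a global minimiser
    (∃ w ξ, E.IsGlobalMin (Q.component ξ₀) w ξ) ∧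
    -- the reduced energy has a Lipschitz gradient
    (E.LipschitzData →
      ∃ L, 0 < L ∧ FreeKnot.HasLipschitzGradientOn E.reducedEnergy (Q.component ξ₀) L) ∧
    -- if the component contains a minimiser over all admissible knots, nothing is lost
    ((∃ ξ ∈ Q.component ξ₀, ξ ∈ E.minimisers Q.admissible) →
      E.bestErrorSq (Q.component ξ₀) ustar = E.bestErrorSq Q.admissible ustar) ∧
    -- the algorithm with step size `1 / L`
    ∀ L, 0 < L → FreeKnot.HasLipschitzGradientOn E.reducedEnergy (Q.component ξ₀) L →
      (∃ w ξ, E.IsRun ψ (Q.component ξ₀) (1 / L) ξ₀ w ξ) ∧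
      ∀ w ξ, E.IsRun ψ (Q.component ξ₀) (1 / L) ξ₀ w ξ →
        Antitone (fun n => E.discreteEnergy (w n) (ξ n)) ∧
        -- under directional convexity
        ((E.convexTargets (Q.component ξ₀)).Nonempty →
          Tendsto (fun n => E.discreteEnergy (w n) (ξ n)) atTop
            (𝓝 (⨅ q : Q.CoeffSpace × Q.component ξ₀, E.discreteEnergy q.1 q.2)) ∧
          (∀ w' ξ', MapClusterPt (w', ξ') atTop (fun n => (w n, ξ n)) →
            E.IsGlobalMin (Q.component ξ₀) w' ξ') ∧
          (E.convexTargets (Q.component ξ₀) = E.minimisers (Q.component ξ₀) →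
            ∃ w' ξ', E.IsGlobalMin (Q.component ξ₀) w' ξ' ∧
              Tendsto w atTop (𝓝 w') ∧ Tendsto ξ atTop (𝓝 ξ')) ∧
          ∀ n : ℕ, 1 ≤ n →
            E.normSq (E.realise (w n) (ξ n) - ustar) ≤
              E.bestErrorSq (Q.component ξ₀) ustar +
                2 * L * E.deltaStar ψ (Q.component ξ₀) ξ₀ / n ∧
            √(E.normSq (E.realise (w n) (ξ n) - ustar)) ≤
              √(E.bestErrorSq (Q.component ξ₀) ustar) +
                √(2 * L * E.deltaStar ψ (Q.component ξ₀) ξ₀) * (n : ℝ) ^ (-(1 / 2) : ℝ)) := by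
  refine ⟨FreeKnot.Patches.convex_component hξ₀, FreeKnot.Patches.component_eq_admissible hξ₀,
    FreeKnot.Problem.exists_isGlobalMin hconf hξ₀ hanch hdeg, fun hl => ?_, ?_,
    fun L hL hF => ⟨FreeKnot.Problem.exists_isRun hconf hξ₀ hanch hdeg hψ (1 / L),
      fun w ξ hrun => ⟨FreeKnot.Problem.antitone_run hconf hξ₀ hanch hdeg hψ hL hF hrun,
        fun hne => ?_⟩⟩⟩
  · exact (FreeKnot.Problem.C1On_reducedEnergy hconf hξ₀ hanch hdeg (lip := True)
      fun _ => hl).hasLipschitzGradientOn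
  -- A minimiser over all admissible knots that lies in the component also minimises there, so both
  -- best errors equal twice the same energy gap.
  · rintro ⟨ξ, hξ, w, hw⟩
    rw [FreeKnot.Problem.bestErrorSq_eq hustar hw, FreeKnot.Problem.bestErrorSq_eq hustar
      (S := Q.component ξ₀) ⟨hξ, fun w' ξ' hξ' => hw.2 w' ξ' hξ'.1⟩]
  · obtain ⟨η, hη⟩ := id hne
    refine ⟨?_, fun w' ξ' h => FreeKnot.Problem.isGlobalMin_of_mapClusterPt hconf hξ₀ hanch hdeg hψ
      hL hF hrun hη h, fun hall => FreeKnot.Problem.tendsto_run hconf hξ₀ hanch hdeg hψ hL hF hrun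
      hη hall, fun n hn => ?_⟩
    · obtain ⟨⟨hηC, hmin⟩, -⟩ := (FreeKnot.Problem.mem_convexTargets_iff hconf hanch).1 hη
      rw [FreeKnot.Problem.iInf_discreteEnergy hconf hanch hηC hmin]
      exact FreeKnot.Problem.tendsto_discreteEnergy_run hconf hξ₀ hanch hdeg hψ hL hF hrun hη
    · have hle := FreeKnot.Problem.normSq_run_le hconf hξ₀ hanch hdeg hψ hL hF hrun hne hustar hn
      have hδ := FreeKnot.Problem.deltaStar_nonneg hconf hξ₀ hanch hψ
      exact ⟨hle, FreeKnot.sqrt_le_sqrt_add_sqrt_mul_rpow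
        (FreeKnot.Problem.bestErrorSq_nonneg ustar) (by positivity) n hle⟩
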